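/- Let $k$ be a finite field with $q$ elements, $V$ a finite-dimensional $k$-vector space and $Q:V\to k$ a quadratic form with associated bilinear form $\langle x,y\rangle=Q(x+y)-Q(x)-Q(y)$; assume $Q$ is nondegenerate, i.e. $Q$ is injective on the radical of $\langle\,,\rangle$. If $\dim V$ is even, let $\eta_Q=1$ if $V$ has a subspace of dimension $\frac12\dim V$ on which $Q$ vanishes, and $\eta_Q=-1$ otherwise. A $Q$-filtration $X^*$ of $V$ is a decreasing sequence of subspaces $(X^{\ge a})_{a\in\mathbf Z}$, equal to $V$ for some $a$ and to $0$ for some $a$, such that for every $a\ge1$ one has $Q|_{X^{\ge a}}=0$ and $X^{\ge 1-a}=(X^{\ge a})^\perp$. Put $\mathrm{gr}^aX^*=X^{\ge a}/X^{\ge a+1}$, $\mathrm{gr}X^*=\bigoplus_a\mathrm{gr}^aX^*$, with the quadratic form $\bar Q(\sum_a x_a)=Q(\dot x_0)+\sum_{a\ge1}\langle\dot x_{-a},\dot x_a\rangle$ (where $\dot x_a\in X^{\ge a}$ represents $x_a$) and its associated bilinear form $\langle\,,\rangle$. Let $E^2\,\mathrm{gr}X^*$ be the set of linear maps $T:\mathrm{gr}X^*\to\mathrm{gr}X^*$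 of degree $2$ with $\langle Tx,y\rangle+\langle x,Ty\rangle=0$ for all $x,y$ and $\langle x,Tx\rangle=0$ for $x\in\mathrm{gr}^{-1}X^*$. Let $E^2_*\,\mathrm{gr}X^*$ be the set of $T\in E^2\,\mathrm{gr}X^*$ such that for every even $a\ge0$ the quadratic form $x\mapsto\bar Q(T^{a/2}x)$ on $\mathrm{gr}^{-a}X^*$ is nondegenerate, and for every odd $a\ge1$ the bilinear form $(x,y)\mapsto\langle x,T^ay\rangle$ on $\mathrm{gr}^{-a}X^*$ is nondegenerate. Let $E^{\ge2}X^*$ be the set of nilpotent $N\in\mathrm{End}(V)$ such that $Q((1+N)x)=Q(x)$ for all $x\in V$ and $NX^{\ge a}\subset X^{\ge a+2}$ for all $a$; such an $N$ induces a linear map $\bar N:\mathrm{gr}X^*\to\mathrm{gr}X^*$ of degree $2$. Let $E^{\ge2}_*X^*=\{N\in E^{\ge2}X^*:\bar N\in E^2_*\,\mathrm{gr}X^*\}$. Let $f=(f_a)_{a\in\mathbf Z}$ be a family of natural numbers, almost all zero, which is admissible: $f_0\ge f_{-2}\ge f_{-4}\ge\cdots$, $f_{-1}\ge f_{-3}\ge\cdots$,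 and $f_a$ is even for odd $a$. Then: (1) For each $\epsilon\in\{1,-1\}$ there is a polynomial $P\in\mathbf Z[t]$, depending only on $f$ and $\epsilon$ (not on $k$, $q$ or its characteristic $p$), such that $|E^{\ge2}_*X^*|=P(q)$ for all $k,V,Q$ as above with $\eta_Q=\epsilon$ in case $\dim V$ is even (no condition in case $\dim V$ is odd) and all $Q$-filtrations $X^*$ of $V$ with $\dim\mathrm{gr}^aX^*=f_a$ for all $a$. (2) For all $k,V,Q$ as above and all $Q$-filtrations $X^*$ with $\dim\mathrm{gr}^aX^*=f_a$ for all $a$, $$|E^{\ge2}_*X^*|=q^d\,|E^2_*\,\mathrm{gr}X^*|,\qquad d=\sum_{a<a',\,-a-a'\ge3}f_af_{a'}+\sum_{a,\,-2a\ge4}\frac{f_a(f_a-1)}2 .$$ (3) In the situation of (2), let $R^0$ be the set of sequences $U_0\supset U_2\supset U_4\supset\cdots$ of subspaces of $\mathrm{gr}^0X^*$ with $\dim U_a=f_{-a}$ and $\bar Q|_{U_a}$ nondegenerate, and let $R^{-1}$ be the set of pairs $(\omega,(U_1\supset U_3\supset\cdots))$ with $\omega$ a nondegenerate symplectic form on $\mathrm{gr}^{-1}X^*$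 and $U_a$ subspaces of $\mathrm{gr}^{-1}X^*$ with $\dim U_a=f_{-a}$ and $\omega|_{U_a}$ nondegenerate. For $T\in E^2_*\,\mathrm{gr}X^*$ let $I_a^T$ be the image of $T^{a/2}:\mathrm{gr}^{-a}X^*\to\mathrm{gr}^0X^*$ for even $a\ge0$ and of $T^{(a-1)/2}:\mathrm{gr}^{-a}X^*\to\mathrm{gr}^{-1}X^*$ for odd $a\ge1$, and let $\omega_T(x,y)=\langle x,Ty\rangle$ on $\mathrm{gr}^{-1}X^*$. Then $$\psi(T)=\bigl((I^T_0,I^T_2,\dots),(\omega_T,(I^T_1,I^T_3,\dots))\bigr)$$ defines a map $\psi:E^2_*\,\mathrm{gr}X^*\to R^0\times R^{-1}$, each of whose fibres has exactly $\prod_{a\ge2}A_{f_a}$ elements, where $A_m=q^{m(m-1)/2}(q-1)(q^2-1)\cdots(q^m-1)=|GL_m(\mathbf F_q)|$. Hence $$|E^2_*\,\mathrm{gr}X^*|=|R^0|\,|R^{-1}|\prod_{a\ge2}A_{f_a}.$$ -/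

import Mathlib

universe u v

open scoped DirectSum

noncomputable section

namespace Lusztig

section Forms

variable {k : Type u} [Field k] {V : Type v} [AddCommGroup V] [Module k V]

/-- `Q` is nondegenerate: its restriction to the radical of the associated bilinear form
`⟨x, y⟩ = Q (x + y) - Q x - Q y` is injective. -/
def IsNondeg (Q : QuadraticForm k V) : Prop :=
  Set.InjOn Q {x | ∀ y, QuadraticMap.polar Q x y = 0}

/-- The restriction of `Q` to the subspace `W` is nondegenerate. -/
def IsNondegOn (Q : QuadraticForm k V) (W : Submodule k V) : Prop :=
  IsNondeg (Q.comp W.subtype)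

/-- The bilinear form `ω` restricts to a nondegenerate form on the subspace `W`
(for `ω` alternating, hence reflexive, one side suffices). -/
def BilinNondegOn (ω : LinearMap.BilinForm k V) (W : Submodule k V) : Prop :=
  ∀ x ∈ W, (∀ y ∈ W, ω x y = 0) → x = 0

open Classical in
/-- The sign of a quadratic form on an even-dimensional space `V`: it is `1` if there is a
totally singular subspace of dimension `dim V / 2`, and `-1` otherwise. -/
def wittSign (Q : QuadraticForm k V) : ℤ :=
  if ∃ W : Submodule k V, 2 * Module.finrank k W = Module.finrank k V ∧ ∀ x ∈ W, Q x = 0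
  then 1 else -1

/-- The nilpotent `N` such that `1 + N` is a (unipotent) element of the orthogonal group. -/
def nilOrthogonal (Q : QuadraticForm k V) : Set (Module.End k V) :=
  {N | IsNilpotent N ∧ ∀ x, Q ((1 + N) x) = Q x}

end Forms

/-! Graded spaces `⨁ a, W a` with a quadratic form. -/

section Graded

variable {k : Type u} [Field k] {W : ℤ → Type v} [∀ a, AddCommGroup (W a)]
  [∀ a, Module k (W a)]

/-- The set `E²` of endomorphisms `T` of degree `2` that are skew for the bilinear form and
satisfy `⟨x, T x⟩ = 0` for `x` of degree `-1`. -/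
def gradedE2 (Q : QuadraticForm k (⨁ a, W a)) : Set (Module.End k (⨁ a, W a)) :=
  {T | (∀ (a : ℤ) (x : W a), ∃ y : W (a + 2),
          T (DirectSum.lof k ℤ W a x) = DirectSum.lof k ℤ W (a + 2) y) ∧
       (∀ x y, QuadraticMap.polar Q (T x) y + QuadraticMap.polar Q x (T y) = 0) ∧
       ∀ x : W (-1), QuadraticMap.polar Q (DirectSum.lof k ℤ W (-1) x)
          (T (DirectSum.lof k ℤ W (-1) x)) = 0}

/-- The set `E²_*` of all `T` in `E²` such that, for even `a = 2 n ≥ 0`, the quadratic form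
`x ↦ Q (T ^ n x)` on the piece of degree `-a` is nondegenerate and, for odd `a = 2 n + 1 ≥ 1`,
the form `x, y ↦ ⟨x, T ^ a y⟩` on the piece of degree `-a` is nondegenerate. -/
def gradedE2Star (Q : QuadraticForm k (⨁ a, W a)) : Set (Module.End k (⨁ a, W a)) :=
  {T | T ∈ gradedE2 Q ∧
       (∀ n : ℕ, IsNondeg (Q.comp ((T ^ n) ∘ₗ DirectSum.lof k ℤ W (-(2 * n : ℤ))))) ∧
       ∀ (n : ℕ) (x : W (-(2 * n + 1 : ℤ))),
         (∀ y : W (-(2 * n + 1 : ℤ)),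
            QuadraticMap.polar Q (DirectSum.lof k ℤ W _ x)
              ((T ^ (2 * n + 1)) (DirectSum.lof k ℤ W _ y)) = 0) → x = 0}

/-- The set `R⁰` of sequences `U 0 ⊇ U 1 ⊇ U 2 ⊇ …` of subspaces of the degree `0` piece with
`dim (U n) = dim (W (-2n))` such that `Q` is nondegenerate on each `U n`. -/
def flagsZero (Q : QuadraticForm k (⨁ a, W a)) : Set (ℕ → Submodule k (W 0)) :=
  {U | (∀ n, U (n + 1) ≤ U n) ∧
       (∀ n : ℕ, Module.finrank k (U n) = Module.finrank k (W (-(2 * n : ℤ)))) ∧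
       ∀ n, IsNondegOn (Q.comp (DirectSum.lof k ℤ W 0)) (U n)}

variable (k W) in
/-- The set `R⁻¹` of pairs `(ω, (U 0 ⊇ U 1 ⊇ …))` where `ω` is a nondegenerate symplectic form
on the degree `-1` piece and the `U n` are subspaces of that piece with
`dim (U n) = dim (W (-(2n+1)))` on which `ω` is nondegenerate. -/
def flagsOne : Set (LinearMap.BilinForm k (W (-1)) × (ℕ → Submodule k (W (-1)))) :=
  {p | p.1.IsAlt ∧ BilinNondegOn p.1 ⊤ ∧
       (∀ n, p.2 (n + 1) ≤ p.2 n) ∧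
       (∀ n : ℕ, Module.finrank k (p.2 n) = Module.finrank k (W (-(2 * n + 1 : ℤ)))) ∧
       ∀ n, BilinNondegOn p.1 (p.2 n)}

/-- The image of `T ^ n : W (-2n) → W 0`. -/
def imageZero (T : Module.End k (⨁ a, W a)) (n : ℕ) : Submodule k (W 0) :=
  LinearMap.range
    (DirectSum.component k ℤ W 0 ∘ₗ (T ^ n) ∘ₗ DirectSum.lof k ℤ W (-(2 * n : ℤ)))

/-- The image of `T ^ n : W (-(2n+1)) → W (-1)`. -/
def imageOne (T : Module.End k (⨁ a, W a)) (n : ℕ) : Submodule k (W (-1)) :=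
  LinearMap.range
    (DirectSum.component k ℤ W (-1) ∘ₗ (T ^ n) ∘ₗ DirectSum.lof k ℤ W (-(2 * n + 1 : ℤ)))

/-- The form `ω_T (x, y) = ⟨x, T y⟩` on the degree `-1` piece. -/
def omegaForm (Q : QuadraticForm k (⨁ a, W a)) (T : Module.End k (⨁ a, W a)) :
    LinearMap.BilinForm k (W (-1)) :=
  Q.polarBilin.compl₁₂ (DirectSum.lof k ℤ W (-1)) (T ∘ₗ DirectSum.lof k ℤ W (-1))

/-- The map `ψ`, sending `T` to the two flags of images together with the form `ω_T`. -/
def psi (Q : QuadraticForm k (⨁ a, W a)) (T : Module.End k (⨁ a, W a)) :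
    (ℕ → Submodule k (W 0)) ×
      (LinearMap.BilinForm k (W (-1)) × (ℕ → Submodule k (W (-1)))) :=
  (imageZero T, (omegaForm Q T, imageOne T))

end Graded

/-! Filtrations. -/

/-- A `Q`-filtration of `V`: a decreasing sequence of subspaces `X^{≥ a}` indexed by integers,
equal to `V` for some `a` and to `0` for some `a`, such that for `a ≥ 1` the form `Q` vanishes
on `X^{≥ a}` and `X^{≥ 1 - a}` is the orthogonal of `X^{≥ a}`. -/
structure QFiltration {k : Type u} [Field k] {V : Type v} [AddCommGroup V] [Module k V]
    (Q : QuadraticForm k V) where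
  /-- The subspace `X^{≥ a}`. -/
  ge : ℤ → Submodule k V
  ge_succ_le : ∀ a, ge (a + 1) ≤ ge a
  exists_eq_bot : ∃ a, ge a = ⊥
  exists_eq_top : ∃ a, ge a = ⊤
  isotropic : ∀ a, 1 ≤ a → ∀ x ∈ ge a, Q x = 0
  orthogonal : ∀ a, 1 ≤ a → ge (1 - a) = LinearMap.BilinForm.orthogonal Q.polarBilin (ge a)

namespace QFiltration

variable {k : Type u} [Field k] {V : Type v} [AddCommGroup V] [Module k V]
  {Q : QuadraticForm k V} (X : QFiltration Q)

/-- The graded piece `gr^a = X^{≥ a} / X^{≥ a + 1}`. -/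
abbrev gr (a : ℤ) : Type v := (X.ge a) ⧸ (X.ge (a + 1)).submoduleOf (X.ge a)

theorem polar_eq_zero {a b : ℤ} (h : a + b = 0) {x y : V} (hx : x ∈ X.ge a)
    (hy : y ∈ X.ge (b + 1)) : QuadraticMap.polar Q x y = 0 := by
  rcases le_or_gt 1 a with ha | ha
  · have e : b + 1 = 1 - a := by omega
    rw [e, X.orthogonal a ha] at hy
    exact hy x hx
  · have e : a = 1 - (b + 1) := by omega
    rw [e, X.orthogonal (b + 1) (by omega)] at hx
    rw [QuadraticMap.polar_comm]
    exact hx y hy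

/-- The pairing `gr^a × gr^b → k` for `a + b = 0` induced by the bilinear form of `Q`. -/
def pairing (a b : ℤ) (h : a + b = 0) : X.gr a →ₗ[k] X.gr b →ₗ[k] k :=
  Submodule.liftQ _
    (LinearMap.flip
      (Submodule.liftQ _ (LinearMap.flip (Q.polarBilin.domRestrict₁₂ (X.ge a) (X.ge b))) (by
        intro y hy
        rw [LinearMap.mem_ker]
        ext x
        exact X.polar_eq_zero h x.2 hy)))
    (by
      intro x hx
      rw [LinearMap.mem_ker]
      ext y
      change QuadraticMap.polar Q (x : V) (y : V) = 0
      rw [QuadraticMap.polar_comm]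
      exact X.polar_eq_zero (by omega) y.2 hx)

@[simp] theorem pairing_mk (a b : ℤ) (h : a + b = 0) (x : X.ge a) (y : X.ge b) :
    X.pairing a b h (Submodule.Quotient.mk x) (Submodule.Quotient.mk y) =
      QuadraticMap.polar Q (x : V) (y : V) := rfl

/-- The function on `gr^0` induced by `Q`. -/
def quadZeroFun : X.gr 0 → k :=
  Quotient.lift (fun x : X.ge 0 => Q (x : V)) (by
    intro x y hxy
    have hm : ((x : V) - y) ∈ X.ge (0 + 1) :=
      (Submodule.quotientRel_def (p := (X.ge (0 + 1)).submoduleOf (X.ge 0))).1 hxy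
    have h1 : Q ((x : V) - y) = 0 := X.isotropic (0 + 1) (by norm_num) _ hm
    have h2 : QuadraticMap.polar Q (y : V) ((x : V) - y) = 0 :=
      X.polar_eq_zero (a := 0) (b := 0) (by norm_num) y.2 hm
    change Q (x : V) = Q (y : V)
    rw [QuadraticMap.polar, h1, add_sub_cancel] at h2
    linear_combination h2)

/-- The quadratic form on `gr^0` induced by `Q`. -/
def quadZero : QuadraticForm k (X.gr 0) where
  toFun := X.quadZeroFun
  toFun_smul := by
    intro c x
    obtain ⟨x, rfl⟩ := Submodule.Quotient.mk_surjective _ x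
    exact QuadraticMap.map_smul Q c (x : V)
  exists_companion' := by
    refine ⟨X.pairing 0 0 (by norm_num), ?_⟩
    intro x y
    obtain ⟨x, rfl⟩ := Submodule.Quotient.mk_surjective _ x
    obtain ⟨y, rfl⟩ := Submodule.Quotient.mk_surjective _ y
    exact QuadraticMap.map_add Q (x : V) (y : V)

@[simp] theorem quadZero_mk (x : X.ge 0) :
    X.quadZero (Submodule.Quotient.mk x) = Q (x : V) := rfl

/-- The bilinear form `(x, y) ↦ ∑_{a ≥ 1} ⟨x_a, y_{-a}⟩` on `gr X`. -/
def halfForm : (⨁ a, X.gr a) →ₗ[k] (⨁ a, X.gr a) →ₗ[k] k :=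
  DirectSum.toModule k ℤ _ fun a =>
    if 1 ≤ a then
      (X.pairing a (-a) (add_neg_cancel a)).compl₂ (DirectSum.component k ℤ X.gr (-a))
    else 0

/-- The quadratic form `x ↦ Q x_0 + ∑_{a ≥ 1} ⟨x_{-a}, x_a⟩` on `gr X`. -/
def grQuad : QuadraticForm k (⨁ a, X.gr a) :=
  X.quadZero.comp (DirectSum.component k ℤ X.gr 0) + LinearMap.BilinMap.toQuadraticMap X.halfForm

/-- `E^{≥2} X`: the `N` with `1 + N` unipotent orthogonal and `N X^{≥ a} ⊆ X^{≥ a + 2}`. -/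
def E2 : Set (Module.End k V) :=
  {N | N ∈ nilOrthogonal Q ∧ ∀ a, X.ge a ≤ (X.ge (a + 2)).comap N}

/-- The map `gr^a → gr^{a+2}` induced by `N`. -/
def grMap (N : Module.End k V) (h : ∀ a, X.ge a ≤ (X.ge (a + 2)).comap N) (a : ℤ) :
    X.gr a →ₗ[k] X.gr (a + 2) :=
  Submodule.mapQ _ _ (N.restrict (p := X.ge a) (q := X.ge (a + 2)) (h a)) (by
    intro x hx
    change N (x : V) ∈ X.ge (a + 2 + 1)
    have e : a + 2 + 1 = a + 1 + 2 := by ring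
    rw [e]
    exact h (a + 1) hx)

/-- The endomorphism of `gr X` of degree `2` induced by `N`. -/
def grEnd (N : Module.End k V) (h : ∀ a, X.ge a ≤ (X.ge (a + 2)).comap N) :
    Module.End k (⨁ a, X.gr a) :=
  DirectSum.toModule k ℤ _ fun a => DirectSum.lof k ℤ X.gr (a + 2) ∘ₗ X.grMap N h a

/-- `E^{≥2}_* X`: the `N` in `E^{≥2} X` whose associated graded map lies in `E²_* (gr X)`. -/
def E2Star : Set (Module.End k V) :=
  {N | ∃ h : N ∈ X.E2, X.grEnd N h.2 ∈ gradedE2Star X.grQuad}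

end QFiltration

/-! Numerical data. -/

/-- `f_0 ≥ f_{-2} ≥ f_{-4} ≥ …`, `f_{-1} ≥ f_{-3} ≥ …`, and `f_a` is even for odd `a`. -/
def Admissible (f : ℤ →₀ ℕ) : Prop :=
  (∀ a ≤ 0, f (a - 2) ≤ f a) ∧ ∀ a, Odd a → Even (f a)

/-- `d = ∑_{a < a', -a-a' ≥ 3} f_a f_{a'} + ∑_{-2a ≥ 4} f_a (f_a - 1) / 2`. -/
def fibreDim (f : ℤ →₀ ℕ) : ℕ :=
  (∑ a ∈ f.support, ∑ b ∈ f.support, if a < b ∧ 3 ≤ -a - b then f a * f b else 0) +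
    ∑ a ∈ f.support, if 4 ≤ -2 * a then f a * (f a - 1) / 2 else 0

/-- `A_m = q^{m(m-1)/2} (q - 1)(q² - 1) ⋯ (q^m - 1)`, the order of `GL_m` over a field with `q`
elements. -/
def glCard (q m : ℕ) : ℕ := q ^ (m * (m - 1) / 2) * ∏ i ∈ Finset.Icc 1 m, (q ^ i - 1)

end Lusztig

end

/-!
Three arguments carry the theorem, one for each of its assertions.

*The fibration over the graded space.* For `i ≥ 1` let `isoGroup i` be the group of isometries `g`
of `Q` such that `g - 1` raises the filtration by `i`; the elements of `E^{≥2} X` are the `g - 1`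
with `g ∈ isoGroup 2`. The leading terms `gr^a → gr^{a+i}` of `g - 1` are additive in `g`. Those with
`2 a > -i` are adjoint to those with `2 a < -i`, and for `2 a = -i` the leading term is an alternating
form on `gr^a`; so the leading terms with `2 a ≤ -i` have the kernel `isoGroup (i + 1)`
(`mem_isoGroup_succ_iff`). Every family of linear maps and alternating forms occurs (`exists_lead`):
an Eichler transformation `x ↦ x + ⟨u, x⟩ v - ⟨v, x⟩ u - Q(v) ⟨u, x⟩ u` with `u`, `v` homogeneous
modulo higher terms has a leading term of rank one, respectively the form `u ∧ v`, and these generate.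
Descending induction on `i` gives the order of `isoGroup i` as a power of `q` (`card_isoGroup`).
For `i = 2` the leading terms make up `E² gr X`, and the fibres of `E^{≥2} X → E² gr X` are cosets of
`isoGroup 3`, of order `q ^ d` (`ncard_E2Star`). Everything works in all characteristics.

*The fibration over flags.* For `T ∈ E² gr X` the nondegeneracy conditions say that the maps
`T^{a/2} : gr^{-a} → gr^0` and `T^{(a-1)/2} : gr^{-a} → gr^{-1}` are injective with nondegenerate images,
that is, that `ψ(T)` is a pair of flags (`mem_gradedE2Star_iff`). As the components of `T` in degrees
`≥ 0` are adjoint to those in degrees `≤ -2`, and that in degree `-1` is the form `ω_T`, an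
element of the fibre of `ψ` is the same as a free choice of isomorphisms of the pieces `gr^{-a}`, `a ≥ 2`,
with the members of the flags (`card_psi_fibre_eq_prod`), which accounts for the product of the orders
of general linear groups.

*The flags.* It remains to see that the numbers of flags are polynomials in `q`. The number of zeros
of a nondegenerate quadratic form depends on the dimension and on the sign only (`zeroExcess_eq`), and
the sign of `gr^0 X` is that of `V` (`sgn_quadZero`). Counting the pairs of a nondegenerate subspace
and a hyperbolic pair in it in two ways (`sum_nondegSubs_mul_card_hypPairs`) gives a recursion for the
number of nondegenerate subspaces and for the sum of their signs, hence expressions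
`(A(q) + ε B(q)) / M(q)` with integral polynomials `A`, `B` and monic `M`
(`exists_quasiPoly_card_quadSubs`); symplectic spaces are treated in the same way, and the number
of symplectic forms comes from counting symplectic frames (`card_symplecticForms`). Since the counts are
integers at infinitely many `q`, where quadratic spaces of the given dimension and sign exist
(`exists_quadraticForm`), division by `M` leaves no remainder (`QuasiPoly.exists_polynomial`). This
avoids any explicit formula for the polynomials.
-/

noncomputable section

namespace Lusztig

/-! ### Nondegenerate subspaces containing a hyperbolic pair -/

section HyperbolicPairs

variable {k : Type*} [Field k] {V : Type*} [AddCommGroup V] [Module k V]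

/-- Nondegeneracy of the subspace `U` for a reflexive bilinear form `B` together with a set `S`
of "singular" vectors: no nonzero singular vector of `U` is orthogonal to `U`. For `S` the zeros
of a quadratic form and `B` its polar form this is nondegeneracy of the quadratic form on `U`;
for `S` everything it is nondegeneracy of `B` on `U`. -/
def NondegSub (B : LinearMap.BilinForm k V) (S : Set V) (U : Submodule k V) : Prop :=
  ∀ x ∈ U, x ∈ S → (∀ y ∈ U, B x y = 0) → x = 0

/-- The nondegenerate subspaces of `U` of dimension `m`. -/
def nondegSubs (B : LinearMap.BilinForm k V) (S : Set V) (U : Submodule k V) (m : ℕ) :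
    Set (Submodule k V) :=
  {W | W ≤ U ∧ Module.finrank k W = m ∧ NondegSub B S W}

/-- The pairs of singular vectors `e, f` of `U` with `B e f = 1`. -/
def hypPairs (B : LinearMap.BilinForm k V) (S : Set V) (U : Submodule k V) : Set (V × V) :=
  {p | p.1 ∈ U ∧ p.2 ∈ U ∧ p.1 ∈ S ∧ p.2 ∈ S ∧ B p.1 p.2 = 1}

/-- The orthogonal in `U` of a pair of vectors. -/
def hypCompl (B : LinearMap.BilinForm k V) (U : Submodule k V) (p : V × V) : Submodule k V :=
  U ⊓ LinearMap.ker (B p.1) ⊓ LinearMap.ker (B p.2)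

variable {B : LinearMap.BilinForm k V} {S : Set V} {U W : Submodule k V} {p : V × V}

theorem mem_hypCompl {x : V} : x ∈ hypCompl B U p ↔ x ∈ U ∧ B p.1 x = 0 ∧ B p.2 x = 0 := by
  simp [hypCompl, and_assoc]

theorem hypCompl_le : hypCompl B U p ≤ U := fun _ hx => (mem_hypCompl.1 hx).1

theorem hypCompl_mono (h : W ≤ U) : hypCompl B W p ≤ hypCompl B U p := fun _ hx =>
  mem_hypCompl.2 ⟨h (mem_hypCompl.1 hx).1, (mem_hypCompl.1 hx).2⟩

theorem hypPairs_mono (h : W ≤ U) : hypPairs B S W ⊆ hypPairs B S U := fun _ hp =>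
  ⟨h hp.1, h hp.2.1, hp.2.2⟩

/-- A hyperbolic pair in `U` splits off its plane: `U` is the sum of the plane and of `hypCompl B
U p`. -/
theorem exists_hyp_decomp (hB : B.IsRefl) (hS : ∀ x ∈ S, B x x = 0) (hp : p ∈ hypPairs B S U)
    {x : V} (hx : x ∈ U) :
    ∃ a b : k, ∃ w ∈ hypCompl B U p, x = a • p.1 + b • p.2 + w := by
  obtain ⟨h1, h2, h3, h4, h5⟩ := hp
  have h6 : B p.2 p.1 ≠ 0 := fun h => by
    have := hB _ _ h
    rw [h5] at this
    exact one_ne_zero this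
  refine ⟨B p.2 x / B p.2 p.1, B p.1 x,
    x - (B p.2 x / B p.2 p.1) • p.1 - B p.1 x • p.2, mem_hypCompl.2 ⟨?_, ?_, ?_⟩, by abel⟩
  · exact U.sub_mem (U.sub_mem hx (U.smul_mem _ h1)) (U.smul_mem _ h2)
  · simp [hS _ h3, h5]
  · simp [hS _ h4, h6]

/-- The plane of a hyperbolic pair meets the orthogonal of the pair trivially, and the pair is
linearly independent. -/
theorem eq_zero_of_mem_hypCompl (hB : B.IsRefl) (hS : ∀ x ∈ S, B x x = 0)
    (hp : p ∈ hypPairs B S U) {a b : k} (h : a • p.1 + b • p.2 ∈ hypCompl B U p) :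
    a = 0 ∧ b = 0 := by
  obtain ⟨h1, h2, h3, h4, h5⟩ := hp
  have h6 : B p.2 p.1 ≠ 0 := fun h => by
    have := hB _ _ h
    rw [h5] at this
    exact one_ne_zero this
  obtain ⟨-, e1, e2⟩ := mem_hypCompl.1 h
  simp only [map_add, map_smul, hS _ h3, hS _ h4, h5, smul_eq_mul] at e1 e2
  constructor
  · simpa [h6] using e2
  · simpa using e1

theorem finrank_hypCompl [FiniteDimensional k V] (hB : B.IsRefl) (hS : ∀ x ∈ S, B x x = 0)
    (hp : p ∈ hypPairs B S U) :
    Module.finrank k (hypCompl B U p) + 2 = Module.finrank k U := by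
  let φ : ((k × k) × hypCompl B U p) →ₗ[k] V :=
    LinearMap.coprod (LinearMap.coprod (LinearMap.toSpanSingleton k V p.1)
      (LinearMap.toSpanSingleton k V p.2)) (hypCompl B U p).subtype
  have hφ : ∀ a b w, φ ((a, b), w) = a • p.1 + b • p.2 + (w : V) := fun a b w => by simp [φ]
  have hinj : Function.Injective φ := by
    rw [injective_iff_map_eq_zero]
    rintro ⟨⟨a, b⟩, w⟩ h
    rw [hφ] at h
    have h' : a • p.1 + b • p.2 ∈ hypCompl B U p := by
      rw [eq_neg_of_add_eq_zero_left h]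
      exact neg_mem w.2
    obtain ⟨rfl, rfl⟩ := eq_zero_of_mem_hypCompl hB hS hp h'
    have : w = 0 := by
      apply Subtype.ext
      simpa using h
    subst this
    rfl
  have hrange : LinearMap.range φ = U := by
    apply le_antisymm
    · rintro _ ⟨⟨⟨a, b⟩, w⟩, rfl⟩
      rw [hφ]
      exact U.add_mem (U.add_mem (U.smul_mem _ hp.1) (U.smul_mem _ hp.2.1)) (hypCompl_le w.2)
    · intro x hx
      obtain ⟨a, b, w, hw, rfl⟩ := exists_hyp_decomp hB hS hp hx
      exact ⟨((a, b), ⟨w, hw⟩), hφ _ _ _⟩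
  have := LinearMap.finrank_range_of_inj hinj
  rw [hrange] at this
  rw [this]
  simp
  ring

/-- A hyperbolic plane is nondegenerate, so that it can be removed without affecting
nondegeneracy. -/
theorem nondegSub_hypCompl_iff (hB : B.IsRefl) (hS : ∀ x ∈ S, B x x = 0)
    (hp : p ∈ hypPairs B S U) : NondegSub B S (hypCompl B U p) ↔ NondegSub B S U := by
  constructor
  · intro h x hx hxS hxU
    refine h x (mem_hypCompl.2 ⟨hx, hB _ _ (hxU _ hp.1), hB _ _ (hxU _ hp.2.1)⟩) hxS ?_
    exact fun y hy => hxU y (hypCompl_le hy)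
  · intro h x hx hxS hxU
    refine h x (hypCompl_le hx) hxS fun y hy => ?_
    obtain ⟨a, b, w, hw, rfl⟩ := exists_hyp_decomp hB hS hp hy
    obtain ⟨-, h1, h2⟩ := mem_hypCompl.1 hx
    simp [hB _ _ h1, hB _ _ h2, hxU w hw]

theorem span_sup_hypCompl (hB : B.IsRefl) (hS : ∀ x ∈ S, B x x = 0)
    (hp : p ∈ hypPairs B S W) :
    Submodule.span k {p.1, p.2} ⊔ hypCompl B W p = W := by
  apply le_antisymm
  · refine sup_le (Submodule.span_le.2 ?_) hypCompl_le
    rintro x (rfl | rfl)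
    exacts [hp.1, hp.2.1]
  · intro x hx
    obtain ⟨a, b, w, hw, rfl⟩ := exists_hyp_decomp hB hS hp hx
    exact Submodule.add_mem_sup (Submodule.mem_span_pair.2 ⟨a, b, rfl⟩) hw

theorem hypCompl_span_sup (hB : B.IsRefl) (hS : ∀ x ∈ S, B x x = 0)
    (hp : p ∈ hypPairs B S U) (hW : W ≤ hypCompl B U p) :
    hypCompl B (Submodule.span k {p.1, p.2} ⊔ W) p = W := by
  apply le_antisymm
  · intro x hx
    obtain ⟨h1, h2, h3⟩ := mem_hypCompl.1 hx
    obtain ⟨y, hy, w, hw, rfl⟩ := Submodule.mem_sup.1 h1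
    obtain ⟨a, b, rfl⟩ := Submodule.mem_span_pair.1 hy
    obtain ⟨-, g2, g3⟩ := mem_hypCompl.1 (hW hw)
    rw [map_add, g2, add_zero] at h2
    rw [map_add, g3, add_zero] at h3
    have : a • p.1 + b • p.2 ∈ hypCompl B U p := mem_hypCompl.2
      ⟨U.add_mem (U.smul_mem _ hp.1) (U.smul_mem _ hp.2.1), h2, h3⟩
    obtain ⟨rfl, rfl⟩ := eq_zero_of_mem_hypCompl hB hS hp this
    simpa using hw
  · intro x hx
    exact mem_hypCompl.2 ⟨Submodule.mem_sup_right hx, (mem_hypCompl.1 (hW hx)).2⟩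

theorem mem_hypPairs_span_sup (hp : p ∈ hypPairs B S U) :
    p ∈ hypPairs B S (Submodule.span k {p.1, p.2} ⊔ W) :=
  ⟨Submodule.mem_sup_left (Submodule.subset_span (by simp)),
    Submodule.mem_sup_left (Submodule.subset_span (by simp)), hp.2.2⟩

open Classical in
/-- Double count of the pairs formed by a nondegenerate `W ≤ U` and a hyperbolic pair in `W`:
splitting off the hyperbolic plane turns `W` into a nondegenerate subspace, of dimension two less,
of the orthogonal of the pair in `U`. -/
theorem sum_nondegSubs_mul_card_hypPairs [FiniteDimensional k V] [Finite V] (hB : B.IsRefl)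
    (hS : ∀ x ∈ S, B x x = 0) (U : Submodule k V) (m : ℕ) (wt : Submodule k V → ℤ)
    (hwt : ∀ W p, NondegSub B S W → p ∈ hypPairs B S W → wt (hypCompl B W p) = wt W) :
    ∑ W ∈ (Set.toFinite (nondegSubs B S U (m + 2))).toFinset, ((hypPairs B S W).ncard : ℤ) * wt W =
      ∑ p ∈ (Set.toFinite (hypPairs B S U)).toFinset,
        ∑ W ∈ (Set.toFinite (nondegSubs B S (hypCompl B U p) m)).toFinset, wt W := by
  have h1 : ∀ W, ((hypPairs B S W).ncard : ℤ) * wt W =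
      ∑ p ∈ (Set.toFinite (hypPairs B S W)).toFinset, wt W := fun W => by
    rw [Finset.sum_const, Set.ncard_eq_toFinset_card _ (Set.toFinite _), nsmul_eq_mul]
  simp_rw [h1]
  rw [Finset.sum_comm' (t' := (Set.toFinite (hypPairs B S U)).toFinset)
    (s' := fun p => ((Set.toFinite (nondegSubs B S U (m + 2))).toFinset.filter fun W => p ∈ hypPairs B S W))]
  · refine Finset.sum_congr rfl fun p hp => ?_
    rw [Set.Finite.mem_toFinset] at hp
    refine Finset.sum_bij' (fun W _ => hypCompl B W p)
      (fun W _ => Submodule.span k {p.1, p.2} ⊔ W) ?_ ?_ ?_ ?_ ?_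
    · intro W hW
      simp only [Finset.mem_filter, Set.Finite.mem_toFinset] at hW ⊢
      obtain ⟨⟨h1, h2, h3⟩, h4⟩ := hW
      refine ⟨hypCompl_mono h1, ?_, (nondegSub_hypCompl_iff hB hS h4).2 h3⟩
      have := finrank_hypCompl hB hS h4
      omega
    · intro W hW
      simp only [Finset.mem_filter, Set.Finite.mem_toFinset] at hW ⊢
      obtain ⟨h1, h2, h3⟩ := hW
      have h4 := mem_hypPairs_span_sup (W := W) hp
      have h5 := hypCompl_span_sup hB hS hp h1
      refine ⟨⟨sup_le (Submodule.span_le.2 ?_) (h1.trans hypCompl_le), ?_, ?_⟩, h4⟩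
      · rintro x (rfl | rfl)
        exacts [hp.1, hp.2.1]
      · rw [← finrank_hypCompl hB hS h4, h5, h2]
      · rwa [← nondegSub_hypCompl_iff hB hS h4, h5]
    · intro W hW
      simp only [Finset.mem_filter, Set.Finite.mem_toFinset] at hW
      exact span_sup_hypCompl hB hS hW.2
    · intro W hW
      rw [Set.Finite.mem_toFinset] at hW
      exact hypCompl_span_sup hB hS hp hW.1
    · intro W hW
      simp only [Finset.mem_filter, Set.Finite.mem_toFinset] at hW
      exact (hwt W p hW.1.2.2 hW.2).symm
  · intro W p
    simp only [Finset.mem_filter, Set.Finite.mem_toFinset]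
    constructor
    · rintro ⟨h1, h2⟩
      exact ⟨⟨h1, h2⟩, hypPairs_mono h1.1 h2⟩
    · rintro ⟨⟨h1, h2⟩, -⟩
      exact ⟨h1, h2⟩

end HyperbolicPairs

/-! ### Counting zeros of quadratic forms -/

section Zeros

variable {k : Type*} [Field k] {V : Type*} [AddCommGroup V] [Module k V]

theorem polar_self_of_eq_zero (Q : QuadraticForm k V) {x : V} (hx : Q x = 0) :
    QuadraticMap.polar Q x x = 0 := by
  rw [QuadraticMap.polar_self, hx, smul_zero]

theorem polarBilin_isRefl (Q : QuadraticForm k V) : Q.polarBilin.IsRefl := fun x y h => by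
  rw [QuadraticMap.polarBilin_apply_apply, QuadraticMap.polar_comm]
  exact h

theorem map_add_smul_eq (Q : QuadraticForm k V) {e : V} (he : Q e = 0) (x : V) (t : k) :
    Q (x + t • e) = Q x + t * QuadraticMap.polar Q x e := by
  rw [QuadraticMap.map_add Q, QuadraticMap.map_smul, he, QuadraticMap.polar_smul_right]
  simp

/-- Injectivity of `Q` on the radical means that the radical contains no nonzero singular vector:
on the radical `Q` is additive, and `Q (-y) = Q y`. -/
theorem isNondeg_iff (Q : QuadraticForm k V) :
    IsNondeg Q ↔ ∀ x, Q x = 0 → (∀ y, QuadraticMap.polar Q x y = 0) → x = 0 := by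
  constructor
  · intro h x hx hxV
    refine h hxV (fun y => ?_) (by rw [hx, QuadraticMap.map_zero])
    simp
  · intro h x hx y hy hxy
    rw [← sub_eq_zero]
    refine h _ ?_ fun z => ?_
    · have h1 : Q (x + y) = 0 := by
        rw [QuadraticMap.map_add Q, hx y, add_zero, ← hxy, ← two_smul k, ← Nat.cast_ofNat,
          Nat.cast_smul_eq_nsmul, ← QuadraticMap.polar_self]
        exact hx x
      have h2 : Q (x + y) = Q (x - y) := by
        rw [sub_eq_add_neg, QuadraticMap.map_add Q, QuadraticMap.map_add Q, hx y, hx (-y),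
          QuadraticMap.map_neg]
      rw [← h2, h1]
    · rw [QuadraticMap.polar_sub_left, hx z, hy z, sub_zero]

theorem isNondegOn_iff (Q : QuadraticForm k V) (W : Submodule k V) :
    IsNondegOn Q W ↔ NondegSub Q.polarBilin {x | Q x = 0} W := by
  rw [IsNondegOn, isNondeg_iff]
  constructor
  · intro h x hx hxQ hxW
    have := h ⟨x, hx⟩ hxQ fun y => hxW y y.2
    simpa using this
  · intro h x hxQ hxW
    exact Subtype.ext (h x x.2 hxQ fun y hy => hxW ⟨y, hy⟩)

theorem isNondeg_iff_top (Q : QuadraticForm k V) :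
    IsNondeg Q ↔ NondegSub Q.polarBilin {x | Q x = 0} ⊤ := by
  rw [isNondeg_iff]
  simp [NondegSub]

/-- The zeros of `Q` in `U`. -/
def zeros (Q : QuadraticForm k V) (U : Submodule k V) : Set V := {x | x ∈ U ∧ Q x = 0}

/-- The deviation `q · #{x ∈ U : Q x = 0} - #U` from the expected number of zeros. -/
def zeroExcess (Q : QuadraticForm k V) (U : Submodule k V) : ℤ :=
  Nat.card k * (zeros Q U).ncard - Nat.card k ^ Module.finrank k U

/-- The existence of a totally singular subspace of half the dimension of `U`. -/
def IsSplit (Q : QuadraticForm k V) (U : Submodule k V) : Prop :=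
  ∃ L ≤ U, 2 * Module.finrank k L = Module.finrank k U ∧ ∀ x ∈ L, Q x = 0

open Classical in
/-- The sign of `Q` on `U`, with the convention that it is `0` when `U` has odd dimension. -/
def sgn (Q : QuadraticForm k V) (U : Submodule k V) : ℤ :=
  if Even (Module.finrank k U) then if IsSplit Q U then 1 else -1 else 0

theorem sgn_top (Q : QuadraticForm k V) (h : Even (Module.finrank k V)) :
    sgn Q ⊤ = wittSign Q := by
  have h1 : IsSplit Q ⊤ ↔ ∃ W : Submodule k V,
      2 * Module.finrank k W = Module.finrank k V ∧ ∀ x ∈ W, Q x = 0 := by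
    rw [IsSplit, finrank_top]
    exact ⟨fun ⟨W, _, hW⟩ => ⟨W, hW⟩, fun ⟨W, hW⟩ => ⟨W, le_top, hW⟩⟩
  rw [sgn, wittSign, finrank_top, if_pos h]
  by_cases hs : IsSplit Q ⊤
  · rw [if_pos hs, if_pos (h1.1 hs)]
  · rw [if_neg hs, if_neg fun h' => hs (h1.2 h')]

theorem card_eq_pow [Finite k] [FiniteDimensional k V] (U : Submodule k V) :
    (U : Set V).ncard = Nat.card k ^ Module.finrank k U :=
  Module.natCard_eq_pow_finrank (K := k) (V := U)

/-- In a nondegenerate space every nonzero singular vector belongs to a hyperbolic pair. -/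
theorem exists_hypPair (Q : QuadraticForm k V) {U : Submodule k V}
    (hU : NondegSub Q.polarBilin {x | Q x = 0} U) {e : V} (heU : e ∈ U)
    (he : Q e = 0) (he0 : e ≠ 0) :
    ∃ f, (e, f) ∈ hypPairs Q.polarBilin {x | Q x = 0} U := by
  have : ∃ y ∈ U, Q.polarBilin e y ≠ 0 := by
    by_contra! h
    exact he0 (hU e heU he h)
  obtain ⟨y, hyU, hy⟩ := this
  set z := (Q.polarBilin e y)⁻¹ • y with hz
  have hzU : z ∈ U := U.smul_mem _ hyU
  have hez : QuadraticMap.polar Q e z = 1 := by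
    rw [← QuadraticMap.polarBilin_apply_apply, hz, map_smul, smul_eq_mul, inv_mul_cancel₀ hy]
  refine ⟨z + (-Q z) • e, heU, U.add_mem hzU (U.smul_mem _ heU), he, ?_, ?_⟩
  · change Q _ = 0
    rw [map_add_smul_eq Q he, QuadraticMap.polar_comm, hez]
    ring
  · simp [hez, polar_self_of_eq_zero Q he, -QuadraticMap.polar_self]

section Finite

variable [Finite k] [FiniteDimensional k V] [Finite V] (Q : QuadraticForm k V)
  {U : Submodule k V}

/-- Restricting to the orthogonal of a singular vector `e` does not change the excess: off that
orthogonal exactly one vector on each line parallel to `e` is singular. -/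
theorem zeroExcess_inf_ker {e : V} (heU : e ∈ U) (he : Q e = 0) :
    zeroExcess Q (U ⊓ LinearMap.ker (Q.polarBilin e)) = zeroExcess Q U := by
  set K := LinearMap.ker (Q.polarBilin e) with hK
  have hKmem : ∀ x, x ∈ K ↔ QuadraticMap.polar Q x e = 0 := fun x => by
    rw [hK, LinearMap.mem_ker, QuadraticMap.polarBilin_apply_apply, QuadraticMap.polar_comm]
  have heK : e ∈ K := (hKmem e).2 (polar_self_of_eq_zero Q he)
  have h1 : (zeros Q U).ncard = (zeros Q (U ⊓ K)).ncard + (zeros Q U \ K).ncard := by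
    rw [← Set.ncard_inter_add_ncard_sdiff_eq_ncard (zeros Q U) K]
    congr 2
    ext x
    simp only [zeros, Set.mem_inter_iff, Set.mem_ofPred_eq, SetLike.mem_coe, Submodule.mem_inf]
    tauto
  have h2 : (U : Set V).ncard = ((U ⊓ K : Submodule k V) : Set V).ncard + (U \ K : Set V).ncard := by
    rw [← Set.ncard_inter_add_ncard_sdiff_eq_ncard (U : Set V) K]
    rfl
  have h3 : (U \ K : Set V).ncard = Nat.card k * (zeros Q U \ K).ncard := by
    have : (fun p : k × V => p.2 + p.1 • e) '' (Set.univ ×ˢ (zeros Q U \ K)) = (U \ K : Set V) := by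
      ext y
      constructor
      · rintro ⟨⟨t, x⟩, ⟨-, ⟨hx1, hx2⟩, hx3⟩, rfl⟩
        exact ⟨U.add_mem hx1 (U.smul_mem _ heU), fun h => hx3 ((K.add_mem_iff_left
          (K.smul_mem _ heK)).1 h)⟩
      · rintro ⟨hy1, hy2⟩
        have hy3 : QuadraticMap.polar Q y e ≠ 0 := fun h => hy2 ((hKmem y).2 h)
        refine ⟨(Q y / QuadraticMap.polar Q y e, y + (-(Q y / QuadraticMap.polar Q y e)) • e),
          ⟨trivial, ⟨U.add_mem hy1 (U.smul_mem _ heU), ?_⟩, fun h => hy2 ((K.add_mem_iff_left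
          (K.smul_mem _ heK)).1 h)⟩, by simp⟩
        rw [map_add_smul_eq Q he]
        field_simp
        ring
    rw [← this, Set.InjOn.ncard_image, Set.ncard_prod, Set.ncard_univ]
    rintro ⟨t, x⟩ ⟨-, ⟨hx1, hx2⟩, hx3⟩ ⟨s, y⟩ ⟨-, ⟨hy1, hy2⟩, hy3⟩ h
    simp only at h
    have h' : y = x + (t - s) • e := by
      rw [sub_smul, ← add_sub_assoc, h, add_sub_cancel_right]
    have h4 : t - s = 0 := by
      rw [h', map_add_smul_eq Q he, hx2, zero_add] at hy2
      exact (mul_eq_zero.1 hy2).resolve_right fun h => hx3 ((hKmem x).2 h)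
    rw [h4, zero_smul, add_zero] at h'
    rw [h', sub_eq_zero.1 h4]
  rw [zeroExcess, zeroExcess, ← Nat.cast_pow, ← Nat.cast_pow, ← card_eq_pow, ← card_eq_pow, h1, h2,
    h3]
  push_cast
  ring

/-- Restricting to the orthogonal of a totally singular subspace does not change the excess. -/
theorem zeroExcess_inf_orthogonal {Z : Submodule k V} (hZU : Z ≤ U) (hZ : ∀ x ∈ Z, Q x = 0) :
    zeroExcess Q (U ⊓ LinearMap.BilinForm.orthogonal Q.polarBilin Z) = zeroExcess Q U := by
  have key : ∀ s : Set V, s.Finite → s ⊆ Z →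
      zeroExcess Q (U ⊓ ⨅ e ∈ s, LinearMap.ker (Q.polarBilin e)) = zeroExcess Q U := by
    intro s hs
    induction s, hs using Set.Finite.induction_on with
    | empty => simp
    | @insert a s _ _ ih =>
      intro h
      rw [iInf_insert, inf_comm (LinearMap.ker _), ← inf_assoc, zeroExcess_inf_ker Q _
        (hZ a (h (Set.mem_insert a s))), ih ((Set.subset_insert a s).trans h)]
      rw [Submodule.mem_inf]
      refine ⟨hZU (h (Set.mem_insert a s)), ?_⟩
      simp only [Submodule.mem_iInf, LinearMap.mem_ker, QuadraticMap.polarBilin_apply_apply]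
      intro b hb
      have ha : a ∈ Z := h (Set.mem_insert a s)
      have hb : b ∈ Z := h (Set.mem_insert_of_mem a hb)
      rw [QuadraticMap.polar, hZ _ ha, hZ _ hb, hZ _ (Z.add_mem hb ha)]
      simp
  rw [← key Z (Set.toFinite _) le_rfl]
  congr 2
  ext x
  simp only [Submodule.mem_iInf, LinearMap.mem_ker]
  rfl

/-- The removal of a hyperbolic plane divides the excess by `q`: the orthogonal of `e` has the
same excess, and it is the direct sum of the line of `e` and of the orthogonal of the pair. -/
theorem zeroExcess_hypCompl {p : V × V} (hp : p ∈ hypPairs Q.polarBilin {x | Q x = 0} U) :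
    zeroExcess Q U = Nat.card k * zeroExcess Q (hypCompl Q.polarBilin U p) := by
  have hB := polarBilin_isRefl Q
  have hS : ∀ x ∈ {x | Q x = 0}, Q.polarBilin x x = 0 := fun x hx => polar_self_of_eq_zero Q hx
  obtain ⟨h1, h2, h3, h4, h5⟩ := hp
  rw [← zeroExcess_inf_ker Q h1 h3]
  set K := U ⊓ LinearMap.ker (Q.polarBilin p.1) with hK
  set C := hypCompl Q.polarBilin U p with hC
  have e1 : p.1 ∈ K := ⟨h1, hS _ h3⟩
  have hval : ∀ w ∈ C, ∀ t : k, Q (w + t • p.1) = Q w := fun w hw t => by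
    rw [map_add_smul_eq Q h3, QuadraticMap.polar_comm]
    have := (mem_hypCompl.1 hw).2.1
    rw [QuadraticMap.polarBilin_apply_apply] at this
    rw [this, mul_zero, add_zero]
  have hinj : ∀ T ⊆ (C : Set V),
      Set.InjOn (fun x : k × V => x.2 + x.1 • p.1) (Set.univ ×ˢ T) := by
    rintro T hT ⟨t, x⟩ ⟨-, hx⟩ ⟨s, y⟩ ⟨-, hy⟩ h
    simp only at h hx hy
    have h' : (t - s) • p.1 + (0 : k) • p.2 ∈ C := by
      have : (t - s) • p.1 + (0 : k) • p.2 = y - x := by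
        rw [zero_smul, add_zero, sub_smul, sub_eq_sub_iff_add_eq_add, add_comm, h, add_comm]
      rw [this]
      exact C.sub_mem (hT hy) (hT hx)
    have h6 := (eq_zero_of_mem_hypCompl hB hS ⟨h1, h2, h3, h4, h5⟩ h').1
    rw [sub_eq_zero.1 h6, add_left_inj] at h
    rw [h, sub_eq_zero.1 h6]
  have hdec : ∀ x ∈ K, ∃ t : k, ∃ w ∈ C, w + t • p.1 = x := fun x hx => by
    obtain ⟨a, b, w, hw, rfl⟩ := exists_hyp_decomp hB hS ⟨h1, h2, h3, h4, h5⟩ hx.1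
    have hb : b = 0 := by
      have : Q.polarBilin p.1 (a • p.1 + b • p.2 + w) = 0 := hx.2
      rw [map_add, map_add, map_smul, map_smul, h5, hS _ h3,
        (mem_hypCompl.1 hw).2.1] at this
      simpa using this
    subst hb
    exact ⟨a, w, hw, by simp [add_comm]⟩
  have hCK : C ≤ K := fun x hx => ⟨hypCompl_le hx, (mem_hypCompl.1 hx).2.1⟩
  have c1 : (K : Set V).ncard = Nat.card k * (C : Set V).ncard := by
    rw [← Set.ncard_univ, ← Set.ncard_prod, ← Set.InjOn.ncard_image (hinj _ le_rfl)]
    congr 1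
    ext x
    constructor
    · intro hx
      obtain ⟨t, w, hw, rfl⟩ := hdec x hx
      exact ⟨(t, w), ⟨trivial, hw⟩, rfl⟩
    · rintro ⟨⟨t, w⟩, ⟨-, hw⟩, rfl⟩
      exact K.add_mem (hCK hw) (K.smul_mem _ e1)
  have c2 : (zeros Q K).ncard = Nat.card k * (zeros Q C).ncard := by
    rw [← Set.ncard_univ, ← Set.ncard_prod, ← Set.InjOn.ncard_image (hinj _ fun x hx => hx.1)]
    congr 1
    ext x
    constructor
    · rintro ⟨hx, hx'⟩
      obtain ⟨t, w, hw, rfl⟩ := hdec x hx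
      exact ⟨(t, w), ⟨trivial, hw, by rwa [hval w hw] at hx'⟩, rfl⟩
    · rintro ⟨⟨t, w⟩, ⟨-, hw, hw'⟩, rfl⟩
      exact ⟨K.add_mem (hCK hw) (K.smul_mem _ e1), by simpa only [hval w hw] using hw'⟩
  rw [zeroExcess, zeroExcess, ← Nat.cast_pow, ← Nat.cast_pow, ← card_eq_pow, ← card_eq_pow, c1, c2]
  push_cast
  ring

end Finite

end Zeros

section Anisotropic

variable {k : Type*} [Field k] {V : Type*} [AddCommGroup V] [Module k V] [FiniteDimensional k V]

theorem finrank_inf_ker {L : Submodule k V} {φ : V →ₗ[k] k} {x : V} (hx : x ∈ L)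
    (hφ : φ x ≠ 0) :
    Module.finrank k (L ⊓ LinearMap.ker φ : Submodule k V) + 1 = Module.finrank k L := by
  have h0 : φ ∘ₗ L.subtype ≠ 0 := fun h => hφ (LinearMap.congr_fun h ⟨x, hx⟩)
  have h1 := Module.Dual.finrank_ker_add_one_of_ne_zero (f := φ ∘ₗ L.subtype) h0
  rw [← h1, LinearMap.ker_comp, ← Submodule.map_comap_subtype,
    Submodule.finrank_map_subtype_eq]

/-- An anisotropic subspace over a finite field has dimension at most two, by the
Chevalley–Warning theorem. -/
theorem finrank_le_two_of_anisotropic [Finite k] (Q : QuadraticForm k V) {U : Submodule k V}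
    (h : ∀ x ∈ U, Q x = 0 → x = 0) :
    Module.finrank k U ≤ 2 := by
  classical
  by_contra! hlt
  obtain ⟨v, hv⟩ : ∃ v : Fin 3 → U, LinearIndependent k v :=
    exists_linearIndependent_of_le_finrank (n := 3) hlt
  obtain ⟨B, hB⟩ := LinearMap.BilinMap.toQuadraticMap_surjective (R := k) Q
  let f : MvPolynomial (Fin 3) k := ∑ i, ∑ j,
    MvPolynomial.C (B (v i) (v j)) * (MvPolynomial.X i * MvPolynomial.X j)
  have hf : ∀ x : Fin 3 → k, MvPolynomial.eval x f = Q (∑ i, x i • (v i : V)) := fun x => by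
    rw [← hB, LinearMap.BilinMap.toQuadraticMap_apply]
    simp only [f, map_sum, map_mul, MvPolynomial.eval_C, MvPolynomial.eval_X, map_smul,
      LinearMap.sum_apply, LinearMap.smul_apply, smul_eq_mul, Finset.mul_sum]
    rw [Finset.sum_comm]
    refine Finset.sum_congr rfl fun i _ => Finset.sum_congr rfl fun j _ => ?_
    ring
  have hdeg : f.totalDegree < Fintype.card (Fin 3) := by
    refine lt_of_le_of_lt (b := 2) ?_ (by simp)
    refine MvPolynomial.totalDegree_finsetSum_le fun i _ =>
      MvPolynomial.totalDegree_finsetSum_le fun j _ => ?_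
    refine (MvPolynomial.totalDegree_mul _ _).trans ?_
    rw [MvPolynomial.totalDegree_C, zero_add]
    refine (MvPolynomial.totalDegree_mul _ _).trans ?_
    rw [MvPolynomial.totalDegree_X, MvPolynomial.totalDegree_X]
  have := Fintype.ofFinite k
  obtain ⟨p, hp⟩ := CharP.exists k
  have hprime : p.Prime := (CharP.char_is_prime_or_zero k p).resolve_right fun h0 => by
    subst h0
    have := CharP.charP_to_charZero k
    exact not_finite k
  have hdvd := char_dvd_card_solutions p hdeg
  have hcard : Fintype.card {x : Fin 3 → k // MvPolynomial.eval x f = 0} = 1 := by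
    rw [Fintype.card_eq_one_iff]
    refine ⟨⟨0, by rw [hf]; simp⟩, ?_⟩
    rintro ⟨x, hx⟩
    rw [hf] at hx
    have h1 : (∑ i, x i • (v i : V)) = 0 :=
      h _ (U.sum_mem fun i _ => U.smul_mem _ (v i).2) hx
    have h2 : ∑ i, x i • v i = 0 := by
      apply Subtype.ext
      push_cast
      exact h1
    exact Subtype.ext (funext fun i => Fintype.linearIndependent_iff.1 hv x h2 i)
  rw [hcard] at hdvd
  exact hprime.one_lt.ne' (Nat.dvd_one.1 hdvd)

end Anisotropic

section ZeroCount

variable {k : Type*} [Field k] [Finite k] {V : Type*} [AddCommGroup V] [Module k V]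
  [FiniteDimensional k V] [Finite V] (Q : QuadraticForm k V) {U : Submodule k V}

/-- The excess of a nondegenerate space with a totally singular subspace of half the dimension. -/
theorem zeroExcess_eq_of_isSplit (n : ℕ) : ∀ (U : Submodule k V),
    NondegSub Q.polarBilin {x | Q x = 0} U → ∀ L ≤ U, Module.finrank k L = n →
    Module.finrank k U = 2 * n → (∀ x ∈ L, Q x = 0) →
    zeroExcess Q U = (Nat.card k - 1) * Nat.card k ^ n := by
  induction n with
  | zero =>
    intro U _ L _ _ hU0 _
    have : U = ⊥ := Submodule.finrank_eq_zero.1 (by simpa using hU0)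
    subst this
    have : zeros Q (⊥ : Submodule k V) = {0} := by
      ext x
      simp only [zeros, Submodule.mem_bot, Set.mem_ofPred_eq, Set.mem_singleton_iff]
      exact ⟨fun h => h.1, fun h => ⟨h, by rw [h, QuadraticMap.map_zero]⟩⟩
    simp [zeroExcess, this]
  | succ n ih =>
    intro U hU L hLU hLn hUn hLQ
    have : Nontrivial L := Module.nontrivial_of_finrank_pos (R := k) (by omega)
    obtain ⟨⟨e, heL⟩, he0⟩ := exists_ne (0 : L)
    have he0 : e ≠ 0 := fun h => he0 (Subtype.ext h)
    obtain ⟨f, hp⟩ := exists_hypPair Q hU (hLU heL) (hLQ e heL) he0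
    have hB := polarBilin_isRefl Q
    have hS : ∀ x ∈ {x | Q x = 0}, Q.polarBilin x x = 0 := fun x hx => polar_self_of_eq_zero Q hx
    have hfe : Q.polarBilin f e ≠ 0 := by
      rw [QuadraticMap.polarBilin_apply_apply, QuadraticMap.polar_comm]
      have : QuadraticMap.polar Q e f = 1 := hp.2.2.2.2
      rw [this]
      exact one_ne_zero
    have h1 := finrank_inf_ker (L := L) (φ := Q.polarBilin f) heL hfe
    have h2 := finrank_hypCompl hB hS hp
    rw [zeroExcess_hypCompl Q hp, ih _ ((nondegSub_hypCompl_iff hB hS hp).2 hU)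
      (L ⊓ LinearMap.ker (Q.polarBilin f)) ?_ (by omega) (by omega) fun x hx => hLQ x hx.1]
    · ring
    · intro x hx
      refine mem_hypCompl.2 ⟨hLU hx.1, ?_, hx.2⟩
      rw [QuadraticMap.polarBilin_apply_apply, QuadraticMap.polar, hLQ e heL, hLQ x hx.1,
        hLQ _ (L.add_mem heL hx.1)]
      simp

/-- The removal of hyperbolic planes leads from any nondegenerate space to an anisotropic one, of
dimension at most two: dimension `0` is the split case, and dimensions `2` and `1` give the other
two. -/
theorem zeroExcess_trichotomy (n : ℕ) : ∀ (U : Submodule k V), Module.finrank k U = n →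
    NondegSub Q.polarBilin {x | Q x = 0} U →
    (IsSplit Q U ∧ Even n) ∨ (Even n ∧ zeroExcess Q U = -((Nat.card k - 1) * Nat.card k ^ (n / 2)))
      ∨ (¬ Even n ∧ zeroExcess Q U = 0) := by
  induction n using Nat.strong_induction_on with
  | _ n ih =>
    intro U hUn hU
    by_cases hz : ∀ x ∈ U, Q x = 0 → x = 0
    · have hle := finrank_le_two_of_anisotropic Q hz
      have hzeros : (zeros Q U).ncard = 1 := by
        rw [Set.ncard_eq_one]
        refine ⟨0, Set.ext fun x => ⟨fun h => hz x h.1 h.2, ?_⟩⟩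
        rintro rfl
        exact ⟨U.zero_mem, QuadraticMap.map_zero Q⟩
      rw [zeroExcess, hzeros]
      rw [hUn] at hle ⊢
      interval_cases n
      · exact Or.inl ⟨⟨⊥, bot_le, by simp [hUn], by simp⟩, ⟨0, rfl⟩⟩
      · right; right
        exact ⟨by decide, by ring⟩
      · right; left
        exact ⟨even_two, by norm_num; ring⟩
    · push Not at hz
      obtain ⟨e, heU, he, he0⟩ := hz
      obtain ⟨f, hp⟩ := exists_hypPair Q hU heU he he0
      have hB := polarBilin_isRefl Q
      have hS : ∀ x ∈ {x | Q x = 0}, Q.polarBilin x x = 0 := fun x hx =>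
        polar_self_of_eq_zero Q hx
      have h2 := finrank_hypCompl hB hS hp
      obtain ⟨m, rfl⟩ : ∃ m, n = m + 2 := ⟨_, by rw [← hUn, ← h2]⟩
      have hev : Even (m + 2) ↔ Even m := by simp [Nat.even_add]
      have hdiv : (m + 2) / 2 = m / 2 + 1 := by omega
      rw [hev, zeroExcess_hypCompl Q hp, hdiv]
      rcases ih m (by omega) (hypCompl Q.polarBilin U (e, f)) (by omega)
        ((nondegSub_hypCompl_iff hB hS hp).2 hU) with ⟨⟨L, hL, hLn, hLQ⟩, hm⟩ | ⟨hm, h⟩ | ⟨hm, h⟩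
      · refine Or.inl ⟨⟨L ⊔ Submodule.span k {e}, ?_, ?_, ?_⟩, hm⟩
        · exact sup_le (hL.trans hypCompl_le) (by simpa using heU)
        · have hd : Disjoint L (Submodule.span k {e}) := by
            rw [Submodule.disjoint_def]
            intro x hx hx'
            obtain ⟨a, rfl⟩ := Submodule.mem_span_singleton.1 hx'
            have := eq_zero_of_mem_hypCompl hB hS hp (a := a) (b := 0) (by simpa using hL hx)
            rw [this.1, zero_smul]
          have := Submodule.finrank_sup_add_finrank_inf_eq L (Submodule.span k {e})
          rw [disjoint_iff.1 hd, finrank_bot, finrank_span_singleton he0] at this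
          omega
        · intro x hx
          obtain ⟨y, hy, z, hz, rfl⟩ := Submodule.mem_sup.1 hx
          obtain ⟨a, rfl⟩ := Submodule.mem_span_singleton.1 hz
          have : QuadraticMap.polar Q e y = 0 := (mem_hypCompl.1 (hL hy)).2.1
          rw [map_add_smul_eq Q he, hLQ y hy, QuadraticMap.polar_comm, this]
          simp
      · exact Or.inr (Or.inl ⟨hm, by rw [h]; ring⟩)
      · exact Or.inr (Or.inr ⟨hm, by rw [h]; ring⟩)

/-- The number of zeros of `Q` on a nondegenerate subspace, in terms of dimension and sign. -/
theorem zeroExcess_eq (hU : NondegSub Q.polarBilin {x | Q x = 0} U) :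
    zeroExcess Q U = sgn Q U * ((Nat.card k - 1) * Nat.card k ^ (Module.finrank k U / 2)) := by
  rw [sgn]
  by_cases hs : IsSplit Q U
  · obtain ⟨L, hL, hLn, hLQ⟩ := id hs
    have hev : Even (Module.finrank k U) := ⟨_, by rw [← hLn, two_mul]⟩
    rw [if_pos hev, if_pos hs, one_mul,
      zeroExcess_eq_of_isSplit Q _ U hU L hL rfl hLn.symm hLQ, ← hLn,
      Nat.mul_div_cancel_left _ two_pos]
  · rcases zeroExcess_trichotomy Q _ U rfl hU with h | ⟨h1, h2⟩ | ⟨h1, h2⟩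
    · exact absurd h.1 hs
    · rw [if_pos h1, if_neg hs, h2]
      ring
    · rw [if_neg h1, h2, zero_mul]

theorem two_le_natCard (k : Type*) [Field k] [Finite k] : 2 ≤ Nat.card k := Finite.one_lt_card

/-- The sign of a nondegenerate space can be read off from its excess. -/
theorem sgn_eq_of_zeroExcess {V' : Type*} [AddCommGroup V'] [Module k V'] [FiniteDimensional k V']
    [Finite V'] {Q' : QuadraticForm k V'} {W : Submodule k V'}
    (hU : NondegSub Q.polarBilin {x | Q x = 0} U) (hW : NondegSub Q'.polarBilin {x | Q' x = 0} W)
    (r : ℕ) (hr : Module.finrank k U = Module.finrank k W + 2 * r)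
    (h : zeroExcess Q U = Nat.card k ^ r * zeroExcess Q' W) : sgn Q U = sgn Q' W := by
  rw [zeroExcess_eq Q hU, zeroExcess_eq Q' hW, hr, Nat.add_mul_div_left _ _ two_pos, pow_add] at h
  have hq : (2 : ℤ) ≤ Nat.card k := by exact_mod_cast two_le_natCard k
  have h1 : ((Nat.card k : ℤ) - 1) * (Nat.card k ^ (Module.finrank k W / 2) * Nat.card k ^ r) ≠ 0 :=
    mul_ne_zero (by linarith) (by positivity)
  refine mul_right_cancel₀ h1 ?_
  rw [h]
  ring

theorem sgn_hypCompl (hU : NondegSub Q.polarBilin {x | Q x = 0} U) {p : V × V}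
    (hp : p ∈ hypPairs Q.polarBilin {x | Q x = 0} U) :
    sgn Q (hypCompl Q.polarBilin U p) = sgn Q U := by
  have hB := polarBilin_isRefl Q
  have hS : ∀ x ∈ {x | Q x = 0}, Q.polarBilin x x = 0 := fun x hx => polar_self_of_eq_zero Q hx
  refine (sgn_eq_of_zeroExcess Q hU ((nondegSub_hypCompl_iff hB hS hp).2 hU) 1 ?_ ?_).symm
  · rw [← finrank_hypCompl hB hS hp]
  · rw [zeroExcess_hypCompl Q hp, pow_one]

/-- The number of hyperbolic pairs, up to a power of `q`, as a number of zeros. -/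
theorem card_hypPairs_mul (hU : NondegSub Q.polarBilin {x | Q x = 0} U) :
    ((hypPairs Q.polarBilin {x | Q x = 0} U).ncard : ℤ) * Nat.card k ^ 2 =
      ((zeros Q U).ncard - 1) * Nat.card k ^ Module.finrank k U := by
  classical
  have hex : ∀ e, ∃ f, e ∈ zeros Q U \ {0} → (e, f) ∈ hypPairs Q.polarBilin {x | Q x = 0} U :=
    fun e => by
      by_cases he : e ∈ zeros Q U \ {0}
      · obtain ⟨f, hf⟩ := exists_hypPair Q hU he.1.1 he.1.2 he.2
        exact ⟨f, fun _ => hf⟩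
      · exact ⟨0, fun h => absurd h he⟩
  choose f₀ hf₀ using hex
  have hself : ∀ e, Q e = 0 → QuadraticMap.polar Q e e = 0 := fun e =>
    polar_self_of_eq_zero Q
  set H := hypPairs Q.polarBilin {x | Q x = 0} U with hH
  have hHe : ∀ p ∈ H, p.1 ∈ zeros Q U \ {0} := by
    rintro p ⟨h1, -, h3, -, h5⟩
    refine ⟨⟨h1, h3⟩, fun h0 => ?_⟩
    rw [Set.mem_singleton_iff] at h0
    rw [h0, map_zero, LinearMap.zero_apply] at h5
    exact zero_ne_one h5
  let g : (V × V) × (k × k) → V × V := fun x =>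
    (x.1.1, x.1.2 + x.2.1 • x.1.1 + x.2.2 • f₀ x.1.1)
  have hg : g '' (H ×ˢ Set.univ) = (zeros Q U \ {0}) ×ˢ (U : Set V) := by
    ext ⟨e, y⟩
    constructor
    · rintro ⟨⟨⟨e', f⟩, ⟨t, s⟩⟩, ⟨hp, -⟩, h⟩
      obtain ⟨rfl, rfl⟩ := Prod.mk.inj h
      have he := hHe (e', f) hp
      exact ⟨he, U.add_mem (U.add_mem hp.2.1 (U.smul_mem _ hp.1))
        (U.smul_mem _ (hf₀ _ he).2.1)⟩
    · rintro ⟨he, hy⟩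
      have hp := hf₀ e he
      have hef : QuadraticMap.polar Q e (f₀ e) = 1 := hp.2.2.2.2
      set s := QuadraticMap.polar Q e y - 1 with hs
      set y' := y + (-s) • f₀ e with hy'
      have hy'U : y' ∈ U := U.add_mem hy (U.smul_mem _ hp.2.1)
      have hey' : QuadraticMap.polar Q e y' = 1 := by
        rw [hy', QuadraticMap.polar_add_right, QuadraticMap.polar_smul_right, hef, hs]
        simp
      refine ⟨((e, y' + (-Q y') • e), (Q y', s)), ⟨⟨he.1.1, U.add_mem hy'U (U.smul_mem _ he.1.1),
        he.1.2, ?_, ?_⟩, trivial⟩, ?_⟩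
      · change Q _ = 0
        rw [map_add_smul_eq Q he.1.2, QuadraticMap.polar_comm, hey']
        ring
      · change QuadraticMap.polar Q e _ = 1
        rw [QuadraticMap.polar_add_right, QuadraticMap.polar_smul_right, hself e he.1.2, hey']
        simp
      · simp [g, hy']
  have hinj : Set.InjOn g (H ×ˢ Set.univ) := by
    rintro ⟨⟨e, f⟩, ⟨t, s⟩⟩ ⟨hp, -⟩ ⟨⟨e', f'⟩, ⟨t', s'⟩⟩ ⟨hp', -⟩ h
    obtain ⟨rfl, h⟩ := Prod.mk.inj h
    simp only at h
    have he := hHe _ hp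
    have hef : QuadraticMap.polar Q e (f₀ e) = 1 := (hf₀ e he).2.2.2.2
    have hf : QuadraticMap.polar Q e f = 1 := hp.2.2.2.2
    have hf' : QuadraticMap.polar Q e f' = 1 := hp'.2.2.2.2
    have h1 := congrArg (QuadraticMap.polar Q e) h
    simp only [QuadraticMap.polar_add_right, QuadraticMap.polar_smul_right, hef, hf, hf',
      hself e he.1.2, smul_eq_mul, mul_zero, mul_one, add_zero, add_right_inj] at h1
    subst h1
    rw [add_left_inj] at h
    have h2 := congrArg Q h
    have hQf : Q f = 0 := hp.2.2.2.1
    have hQf' : Q f' = 0 := hp'.2.2.2.1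
    rw [map_add_smul_eq Q he.1.2, map_add_smul_eq Q he.1.2, QuadraticMap.polar_comm, hf,
      QuadraticMap.polar_comm Q f', hf', hQf, hQf', zero_add, mul_one, zero_add, mul_one] at h2
    subst h2
    rw [add_left_inj] at h
    rw [h]
  have h0 : (0 : V) ∈ zeros Q U := ⟨U.zero_mem, QuadraticMap.map_zero Q⟩
  have hc := hinj.ncard_image
  rw [hg, Set.ncard_prod, Set.ncard_prod, Set.ncard_univ, Nat.card_prod, card_eq_pow] at hc
  have hz := Set.ncard_sdiff_singleton_add_one h0
  have hz' : ((zeros Q U \ {0}).ncard : ℤ) = (zeros Q U).ncard - 1 := by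
    rw [← hz]; push_cast; ring
  rw [← hz']
  have hc' : ((zeros Q U \ {0}).ncard : ℤ) * Nat.card k ^ Module.finrank k U =
    H.ncard * (Nat.card k * Nat.card k) := by exact_mod_cast hc
  rw [hc']
  ring

theorem zeros_card_mul (hU : NondegSub Q.polarBilin {x | Q x = 0} U) :
    (Nat.card k : ℤ) * (zeros Q U).ncard = Nat.card k ^ Module.finrank k U +
      sgn Q U * ((Nat.card k - 1) * Nat.card k ^ (Module.finrank k U / 2)) := by
  rw [← zeroExcess_eq Q hU, zeroExcess]
  ring

theorem card_hypPairs_eq (hU : NondegSub Q.polarBilin {x | Q x = 0} U) :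
    (Nat.card k : ℤ) ^ 3 * (hypPairs Q.polarBilin {x | Q x = 0} U).ncard =
      (Nat.card k ^ Module.finrank k U - Nat.card k +
        sgn Q U * ((Nat.card k - 1) * Nat.card k ^ (Module.finrank k U / 2))) *
          Nat.card k ^ Module.finrank k U := by
  have h1 := card_hypPairs_mul Q hU
  have h2 := zeros_card_mul Q hU
  linear_combination (Nat.card k : ℤ) * h1 + (Nat.card k : ℤ) ^ Module.finrank k U * h2

end ZeroCount

/-! ### Functions of `q` and a sign that are polynomial up to a monic denominator -/

section QuasiPoly

open Polynomial

/-- The denominators: values at `q` of monic integral polynomials without zeros in `q ≥ 2`. -/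
def IsMonicValue (g : ℕ → ℚ) : Prop :=
  ∃ M : ℤ[X], M.Monic ∧ ∀ q : ℕ, 2 ≤ q → g q ≠ 0 ∧ ((M.eval (q : ℤ) : ℤ) : ℚ) = g q

theorem IsMonicValue.mul {g h : ℕ → ℚ} (hg : IsMonicValue g) (hh : IsMonicValue h) :
    IsMonicValue fun q => g q * h q := by
  obtain ⟨M, hM, hM'⟩ := hg
  obtain ⟨N, hN, hN'⟩ := hh
  refine ⟨M * N, hM.mul hN, fun q hq => ⟨mul_ne_zero (hM' q hq).1 (hN' q hq).1, ?_⟩⟩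
  rw [eval_mul, Int.cast_mul, (hM' q hq).2, (hN' q hq).2]

theorem isMonicValue_pow (j : ℕ) : IsMonicValue fun q => (q : ℚ) ^ j :=
  ⟨X ^ j, monic_X_pow j, fun q hq => ⟨by positivity, by simp⟩⟩

theorem isMonicValue_pow_sub_one {j : ℕ} (hj : j ≠ 0) : IsMonicValue fun q => (q : ℚ) ^ j - 1 := by
  refine ⟨X ^ j - 1, monic_X_pow_sub_C 1 hj, fun q hq => ⟨?_, by simp⟩⟩
  have : (1 : ℚ) < (q : ℚ) ^ j := one_lt_pow₀ (by exact_mod_cast hq) hj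
  linarith

theorem isMonicValue_pow_add_one {j : ℕ} (hj : j ≠ 0) : IsMonicValue fun q => (q : ℚ) ^ j + 1 :=
  ⟨X ^ j + 1, monic_X_pow_add_C 1 hj, fun q hq => ⟨by positivity, by simp⟩⟩

/-- Functions of `q` and of a sign `ε`, where `ε ^ 2 = c`, that have the form
`(A q + ε * B q) / M q` with integral polynomials `A`, `B` and `M`, where `M` is monic. -/
def QuasiPoly (c : ℤ) (Φ : ℕ → ℤ → ℚ) : Prop :=
  ∃ g : ℕ → ℚ, IsMonicValue g ∧ ∃ A B : ℤ[X], ∀ q : ℕ, 2 ≤ q → ∀ ε : ℤ, ε ^ 2 = c →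
    g q * Φ q ε = (A.eval (q : ℤ) : ℤ) + ε * (B.eval (q : ℤ) : ℤ)

variable {c : ℤ} {Φ Ψ : ℕ → ℤ → ℚ}

theorem quasiPoly_poly (P : ℤ[X]) : QuasiPoly c fun q _ => (P.eval (q : ℤ) : ℤ) :=
  ⟨_, isMonicValue_pow 0, P, 0, fun q _ ε _ => by simp⟩

theorem quasiPoly_const (z : ℤ) : QuasiPoly c fun _ _ => (z : ℚ) :=
  ⟨_, isMonicValue_pow 0, C z, 0, fun q _ ε _ => by simp⟩

theorem quasiPoly_one : QuasiPoly c fun _ _ => (1 : ℚ) := by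
  simpa using quasiPoly_const (c := c) 1

theorem quasiPoly_zero : QuasiPoly c fun _ _ => (0 : ℚ) := by
  simpa using quasiPoly_const (c := c) 0

theorem quasiPoly_pow (j : ℕ) : QuasiPoly c fun q _ => (q : ℚ) ^ j :=
  ⟨_, isMonicValue_pow 0, X ^ j, 0, fun q _ ε _ => by simp⟩

theorem quasiPoly_q : QuasiPoly c fun q _ => (q : ℚ) := by
  simpa using quasiPoly_pow (c := c) 1

theorem quasiPoly_sign : QuasiPoly c fun _ ε => (ε : ℚ) :=
  ⟨_, isMonicValue_pow 0, 0, 1, fun q _ ε _ => by simp⟩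

theorem QuasiPoly.add (hΦ : QuasiPoly c Φ) (hΨ : QuasiPoly c Ψ) :
    QuasiPoly c fun q ε => Φ q ε + Ψ q ε := by
  obtain ⟨g, ⟨M, hM, hgM⟩, A, B, h⟩ := hΦ
  obtain ⟨g', ⟨M', hM', hgM'⟩, A', B', h'⟩ := hΨ
  refine ⟨_, IsMonicValue.mul ⟨M, hM, hgM⟩ ⟨M', hM', hgM'⟩, A * M' + A' * M, B * M' + B' * M,
    fun q hq ε hε => ?_⟩
  have h1 := h q hq ε hε
  have h2 := h' q hq ε hε
  simp only [eval_add, eval_mul, Int.cast_add, Int.cast_mul, (hgM q hq).2, (hgM' q hq).2]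
  linear_combination g' q * h1 + g q * h2

theorem QuasiPoly.mul (hΦ : QuasiPoly c Φ) (hΨ : QuasiPoly c Ψ) :
    QuasiPoly c fun q ε => Φ q ε * Ψ q ε := by
  obtain ⟨g, hg, A, B, h⟩ := hΦ
  obtain ⟨g', hg', A', B', h'⟩ := hΨ
  refine ⟨_, hg.mul hg', A * A' + C c * (B * B'), A * B' + B * A', fun q hq ε hε => ?_⟩
  have h1 := h q hq ε hε
  have h2 := h' q hq ε hε
  have h3 : (c : ℚ) = (ε : ℚ) ^ 2 := by rw [← hε]; push_cast; ring
  simp only [eval_add, eval_mul, Int.cast_add, Int.cast_mul, eval_C, h3]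
  linear_combination g' q * Ψ q ε * h1 + ((A.eval (q : ℤ) : ℤ) + ε * (B.eval (q : ℤ) : ℤ)) * h2

theorem QuasiPoly.sub (hΦ : QuasiPoly c Φ) (hΨ : QuasiPoly c Ψ) :
    QuasiPoly c fun q ε => Φ q ε - Ψ q ε := by
  have := hΦ.add ((quasiPoly_const (c := c) (-1)).mul hΨ)
  simpa [sub_eq_add_neg] using this

theorem QuasiPoly.div (hΦ : QuasiPoly c Φ) {g : ℕ → ℚ} (hg : IsMonicValue g) :
    QuasiPoly c fun q ε => Φ q ε / g q := by
  obtain ⟨g', hg', A, B, h⟩ := hΦ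
  refine ⟨_, hg'.mul hg, A, B, fun q hq ε hε => ?_⟩
  rw [← h q hq ε hε]
  obtain ⟨M, -, hM⟩ := hg
  have := (hM q hq).1
  field_simp

/-- A quasi-polynomial function that, for a given sign, takes integral values at arbitrarily large `q`
is given by an integral polynomial for that sign: the remainder of the division by the monic
denominator is too small to be integral unless it vanishes. -/
theorem QuasiPoly.exists_polynomial (hΦ : QuasiPoly c Φ) {ε : ℤ} (hε : ε ^ 2 = c)
    (hint : ∀ N : ℕ, ∃ q : ℕ, N ≤ q ∧ 2 ≤ q ∧ ∃ z : ℤ, Φ q ε = z) :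
    ∃ P : ℤ[X], ∀ q : ℕ, 2 ≤ q → Φ q ε = (P.eval (q : ℤ) : ℤ) := by
  obtain ⟨g, ⟨M, hM, hgM⟩, A, B, h⟩ := hΦ
  set F : ℤ[X] := A + C ε * B with hF
  have hval : ∀ q : ℕ, 2 ≤ q → g q * Φ q ε = (F.eval (q : ℤ) : ℤ) := fun q hq => by
    rw [h q hq ε hε, hF]
    simp
  have hdecomp : ∀ x : ℤ, F.eval x = (F %ₘ M).eval x + M.eval x * (F /ₘ M).eval x := fun x => by
    conv_lhs => rw [← modByMonic_add_div F M]
    simp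
  have hR : F %ₘ M = 0 := by
    by_contra hR
    have hdeg : (F %ₘ M).degree < M.degree := degree_modByMonic_lt F hM
    -- for large arguments the remainder is smaller in absolute value than the divisor
    have hlt : ∀ᶠ x : ℝ in Filter.atTop,
        |((F %ₘ M).map (Int.castRingHom ℝ)).eval x| <
          |(M.map (Int.castRingHom ℝ)).eval x| := by
      have hdeg' : ((F %ₘ M).map (Int.castRingHom ℝ)).degree <
          (M.map (Int.castRingHom ℝ)).degree := by
        rwa [degree_map_eq_of_injective (RingHom.injective_int _),
          degree_map_eq_of_injective (RingHom.injective_int _)]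
      have hlo := Polynomial.isLittleO_atTop_of_degree_lt _ _ hdeg'
      have hM0 : (M.map (Int.castRingHom ℝ)) ≠ 0 := (hM.map _).ne_zero
      have hne : ∀ᶠ x : ℝ in Filter.atTop, (M.map (Int.castRingHom ℝ)).eval x ≠ 0 :=
        Polynomial.eventually_atTop_not_isRoot _ hM0
      filter_upwards [hlo.bound (show (0 : ℝ) < 1 / 2 by norm_num), hne] with x hx hx'
      have : 0 < |(M.map (Int.castRingHom ℝ)).eval x| := abs_pos.2 hx'
      simp only [Real.norm_eq_abs] at hx
      linarith
    have hne : ∀ᶠ x : ℝ in Filter.atTop, ((F %ₘ M).map (Int.castRingHom ℝ)).eval x ≠ 0 :=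
      Polynomial.eventually_atTop_not_isRoot _
        ((Polynomial.map_ne_zero_iff (RingHom.injective_int _)).2 hR)
    obtain ⟨N, hN⟩ := Filter.eventually_atTop.1 (hlt.and hne)
    obtain ⟨q, hqN, hq2, z, hz⟩ := hint ⌈N⌉₊
    obtain ⟨h1, h2⟩ := hN q ((Nat.le_ceil N).trans (by exact_mod_cast hqN))
    have hcast : ∀ P : ℤ[X], (P.map (Int.castRingHom ℝ)).eval (q : ℝ) =
        ((P.eval (q : ℤ) : ℤ) : ℝ) := fun P => by
      simpa only [Int.cast_natCast, eq_intCast] using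
        Polynomial.eval_intCast_map (Int.castRingHom ℝ) P (q : ℤ)
    rw [hcast, hcast] at h1
    rw [hcast] at h2
    have h3 : M.eval (q : ℤ) * z = F.eval (q : ℤ) := by
      have := hval q hq2
      rw [hz, ← (hgM q hq2).2] at this
      exact_mod_cast this
    have h4 : M.eval (q : ℤ) ∣ (F %ₘ M).eval (q : ℤ) :=
      ⟨z - (F /ₘ M).eval (q : ℤ), by linear_combination -hdecomp q - h3⟩
    have h5 : |(F %ₘ M).eval (q : ℤ)| < |M.eval (q : ℤ)| := by exact_mod_cast h1
    exact h2 (by rw [Int.eq_zero_of_abs_lt_dvd ((abs_dvd _ _).2 h4) h5, Int.cast_zero])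
  refine ⟨F /ₘ M, fun q hq => ?_⟩
  have h1 := hval q hq
  rw [hdecomp, hR, eval_zero, zero_add, Int.cast_mul, (hgM q hq).2] at h1
  exact mul_left_cancel₀ (hgM q hq).1 h1

end QuasiPoly

/-! ### The number of nondegenerate subspaces of a quadratic space -/

theorem ncard_eq_sum_fiber {α ι : Type*} (T : Set α) (s : Finset ι) (F : α → ι)
    (h : ∀ x ∈ T, F x ∈ s) (hT : T.Finite := by exact Set.toFinite _) : T.ncard = ∑ i ∈ s, {x ∈ T | F x = i}.ncard := by
  classical
  rw [Set.ncard_eq_toFinset_card T hT, Finset.card_eq_sum_card_fiberwise (f := F) (t := s)]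
  · refine Finset.sum_congr rfl fun i _ => ?_
    rw [Set.ncard_eq_toFinset_card _ (hT.subset fun x hx => hx.1)]
    congr 1
    ext x
    simp
  · intro x hx
    exact h x (by simpa using hx)

theorem finrank_span_pair {k V : Type*} [Field k] [AddCommGroup V] [Module k V] {x y : V}
    (h : LinearIndependent k ![x, y]) : Module.finrank k (Submodule.span k {x, y}) = 2 := by
  have := finrank_span_eq_card h
  rwa [Matrix.range_cons, Matrix.range_cons, Matrix.range_empty, Set.union_empty,
    Set.singleton_union, Fintype.card_fin] at this

section Sign

variable {k : Type*} [Field k] {V : Type*} [AddCommGroup V] [Module k V]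
  (Q : QuadraticForm k V) {U : Submodule k V}

theorem sgn_sq (U : Submodule k V) :
    sgn Q U ^ 2 = if Even (Module.finrank k U) then 1 else 0 := by
  rw [sgn]
  split_ifs <;> norm_num

theorem sgn_of_odd (h : ¬ Even (Module.finrank k U)) : sgn Q U = 0 := by
  rw [sgn, if_neg h]

theorem sgn_bot : sgn Q (⊥ : Submodule k V) = 1 := by
  rw [sgn, if_pos (by simp), if_pos]
  exact ⟨⊥, le_rfl, by simp, by simp⟩

theorem finrank_inf_ker_polar [FiniteDimensional k V]
    (hU : NondegSub Q.polarBilin {x | Q x = 0} U) {e : V}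
    (he : e ∈ zeros Q U) (he0 : e ≠ 0) :
    Module.finrank k (U ⊓ LinearMap.ker (Q.polarBilin e) : Submodule k V) + 1 =
      Module.finrank k U := by
  obtain ⟨f, hf⟩ := exists_hypPair Q hU he.1 he.2 he0
  refine finrank_inf_ker (x := f) hf.2.1 ?_
  rw [hf.2.2.2.2]
  exact one_ne_zero

end Sign

section Subs

variable {k : Type*} [Field k] {V : Type*} [AddCommGroup V] [Module k V] [Finite V]

/-- The nondegenerate subspaces of `U` of dimension `m`, as a finite set. -/
def subsFinset (B : LinearMap.BilinForm k V) (S : Set V) (U : Submodule k V) (m : ℕ) :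
    Finset (Submodule k V) := (Set.toFinite (nondegSubs B S U m)).toFinset

theorem mem_subsFinset {B : LinearMap.BilinForm k V} {S : Set V} {U W : Submodule k V} {m : ℕ} :
    W ∈ subsFinset B S U m ↔ W ≤ U ∧ Module.finrank k W = m ∧ NondegSub B S W := by
  rw [subsFinset, Set.Finite.mem_toFinset]
  rfl

/-- The nondegenerate subspaces of `U` of dimension `m` for a quadratic form. -/
abbrev quadSubs (Q : QuadraticForm k V) (U : Submodule k V) (m : ℕ) : Finset (Submodule k V) :=
  subsFinset Q.polarBilin {x | Q x = 0} U m

theorem quadSubs_zero [FiniteDimensional k V] (Q : QuadraticForm k V)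
    (U : Submodule k V) : quadSubs Q U 0 = {⊥} := by
  ext W
  rw [mem_subsFinset, Finset.mem_singleton, Submodule.finrank_eq_zero]
  constructor
  · exact fun h => h.2.1
  · rintro rfl
    exact ⟨bot_le, rfl, fun x hx _ _ => hx⟩

theorem quadSubs_eq_empty [FiniteDimensional k V] (Q : QuadraticForm k V)
    {U : Submodule k V} {m : ℕ} (h : Module.finrank k U < m) : quadSubs Q U m = ∅ := by
  rw [Finset.eq_empty_iff_forall_notMem]
  intro W hW
  obtain ⟨h1, h2, -⟩ := mem_subsFinset.1 hW
  have := Submodule.finrank_mono h1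
  omega

end Subs

section Count

variable {k : Type*} [Field k] [Finite k] {V : Type*} [AddCommGroup V] [Module k V]
  [FiniteDimensional k V] [Finite V]

variable (Q : QuadraticForm k V) {U : Submodule k V}

/-- The double count `sum_nondegSubs_mul_card_hypPairs`, with the numbers of hyperbolic pairs of
`W` and `U` put in. As the number for `W` depends on the sign of `W`, the weights `1` and `sgn`
give two linear relations between the number of the subspaces `W` and the sum of their signs. -/
theorem hypPairs_quad_sum (m : ℕ) (wt : Submodule k V → ℤ)
    (hwt : ∀ W p, NondegSub Q.polarBilin {x | Q x = 0} W →
      p ∈ hypPairs Q.polarBilin {x | Q x = 0} W → wt (hypCompl Q.polarBilin W p) = wt W)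
    {z : ℚ} (hz : ∀ p ∈ hypPairs Q.polarBilin {x | Q x = 0} U,
      ((∑ W ∈ quadSubs Q (hypCompl Q.polarBilin U p) m, wt W : ℤ) : ℚ) = z)
    (hU : NondegSub Q.polarBilin {x | Q x = 0} U) :
    ((Nat.card k : ℚ) ^ (m + 2) - Nat.card k) * Nat.card k ^ (m + 2) *
        ((∑ W ∈ quadSubs Q U (m + 2), wt W : ℤ) : ℚ) +
      ((Nat.card k : ℚ) - 1) * Nat.card k ^ (m / 2 + 1) * Nat.card k ^ (m + 2) *
        ((∑ W ∈ quadSubs Q U (m + 2), sgn Q W * wt W : ℤ) : ℚ) =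
      ((Nat.card k : ℚ) ^ Module.finrank k U - Nat.card k +
        sgn Q U * ((Nat.card k - 1) * Nat.card k ^ (Module.finrank k U / 2))) *
          Nat.card k ^ Module.finrank k U * z := by
  have hB := polarBilin_isRefl Q
  have hS : ∀ x ∈ {x | Q x = 0}, Q.polarBilin x x = 0 := fun x hx => polar_self_of_eq_zero Q hx
  have h := congrArg (Int.cast : ℤ → ℚ) (sum_nondegSubs_mul_card_hypPairs hB hS U m wt hwt)
  have h1 : ((∑ p ∈ (Set.toFinite (hypPairs Q.polarBilin {x | Q x = 0} U)).toFinset,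
      ∑ W ∈ (Set.toFinite (nondegSubs Q.polarBilin {x | Q x = 0}
        (hypCompl Q.polarBilin U p) m)).toFinset, wt W : ℤ) : ℚ) =
      (hypPairs Q.polarBilin {x | Q x = 0} U).ncard * z := by
    rw [Int.cast_sum]
    refine (Finset.sum_congr rfl fun p hp => hz p ((Set.Finite.mem_toFinset _).1 hp)).trans ?_
    rw [Finset.sum_const, Set.ncard_eq_toFinset_card _ (Set.toFinite _), nsmul_eq_mul]
  rw [h1] at h
  have hc := congrArg (Int.cast : ℤ → ℚ) (card_hypPairs_eq Q hU)
  push_cast at hc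
  have hI : ((Nat.card k : ℤ) ^ (m + 2) - Nat.card k) * Nat.card k ^ (m + 2) *
        (∑ W ∈ quadSubs Q U (m + 2), wt W) +
      ((Nat.card k : ℤ) - 1) * Nat.card k ^ (m / 2 + 1) * Nat.card k ^ (m + 2) *
        (∑ W ∈ quadSubs Q U (m + 2), sgn Q W * wt W) =
      (Nat.card k : ℤ) ^ 3 * ∑ W ∈ quadSubs Q U (m + 2),
        ((hypPairs Q.polarBilin {x | Q x = 0} W).ncard : ℤ) * wt W := by
    rw [Finset.mul_sum, Finset.mul_sum, Finset.mul_sum, ← Finset.sum_add_distrib]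
    refine Finset.sum_congr rfl fun W hW => ?_
    obtain ⟨-, h2, h3⟩ := mem_subsFinset.1 hW
    have h4 := card_hypPairs_eq Q h3
    have h5 : (m + 2) / 2 = m / 2 + 1 := by omega
    rw [h2, h5] at h4
    linear_combination -wt W * h4
  have hI' := congrArg (Int.cast : ℤ → ℚ) hI
  simp only [Int.cast_add, Int.cast_mul, Int.cast_sub, Int.cast_pow, Int.cast_natCast,
    Int.cast_one] at hI'
  rw [hI', ← hc, mul_assoc _ _ z, ← h]
  rfl

theorem card_nonzeros : {x | x ∈ U ∧ Q x ≠ 0}.ncard + (zeros Q U).ncard =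
    Nat.card k ^ Module.finrank k U := by
  rw [← card_eq_pow, ← Set.ncard_inter_add_ncard_sdiff_eq_ncard (U : Set V) (zeros Q U), add_comm]
  congr 2
  · ext x; simp [zeros]
  · ext x
    simp only [zeros, Set.mem_ofPred_eq, Set.mem_sdiff, SetLike.mem_coe]
    tauto

/-- A line is nondegenerate when its nonzero vectors are nonsingular. -/
theorem card_quadSubs_one : ((quadSubs Q U 1).card : ℤ) * (Nat.card k - 1) =
    Nat.card k ^ Module.finrank k U - (zeros Q U).ncard := by
  have h := card_nonzeros Q (U := U)
  have h1 := ncard_eq_sum_fiber {x | x ∈ U ∧ Q x ≠ 0} (quadSubs Q U 1)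
    (fun x => Submodule.span k {x}) ?_
  · have h2 : ∀ W ∈ quadSubs Q U 1,
        ({x ∈ {x | x ∈ U ∧ Q x ≠ 0} | Submodule.span k {x} = W}.ncard : ℤ) = Nat.card k - 1 := by
      intro W hW
      obtain ⟨hWU, hW1, hWn⟩ := mem_subsFinset.1 hW
      have h3 : {x ∈ {x | x ∈ U ∧ Q x ≠ 0} | Submodule.span k {x} = W} = (W : Set V) \ {0} := by
        ext x
        simp only [Set.mem_ofPred_eq, Set.mem_sdiff, SetLike.mem_coe, Set.mem_singleton_iff]
        constructor
        · rintro ⟨⟨-, h5⟩, rfl⟩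
          refine ⟨Submodule.mem_span_singleton_self x, ?_⟩
          rintro rfl
          exact h5 (QuadraticMap.map_zero Q)
        · rintro ⟨h4, h5⟩
          have h6 : Submodule.span k {x} = W := by
            apply Submodule.eq_of_le_of_finrank_eq
            · simpa using h4
            · rw [finrank_span_singleton h5, hW1]
          refine ⟨⟨hWU h4, fun h0 => h5 (hWn x h4 h0 fun y hy => ?_)⟩, h6⟩
          rw [← h6] at hy
          obtain ⟨a, rfl⟩ := Submodule.mem_span_singleton.1 hy
          rw [map_smul, QuadraticMap.polarBilin_apply_apply, polar_self_of_eq_zero Q h0, smul_zero]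
      have h4 := Set.ncard_sdiff_singleton_add_one (s := (W : Set V)) W.zero_mem
      rw [card_eq_pow, hW1, pow_one] at h4
      rw [h3, ← h4]
      push_cast
      ring
    have h5 : ({x | x ∈ U ∧ Q x ≠ 0}.ncard : ℤ) = (quadSubs Q U 1).card * (Nat.card k - 1) := by
      rw [h1, Nat.cast_sum, Finset.sum_congr rfl h2, Finset.sum_const, nsmul_eq_mul]
    rw [← h5, eq_sub_iff_add_eq]
    exact_mod_cast h
  · rintro x ⟨hx, hxQ⟩
    have hx0 : x ≠ 0 := by
      rintro rfl
      exact hxQ (QuadraticMap.map_zero Q)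
    refine mem_subsFinset.2 ⟨by simpa using hx, finrank_span_singleton hx0, fun y hy hyQ _ => ?_⟩
    obtain ⟨a, rfl⟩ := Submodule.mem_span_singleton.1 hy
    have : Q (a • x) = 0 := hyQ
    rw [QuadraticMap.map_smul, smul_eq_mul] at this
    have ha : a = 0 := by simpa using (mul_eq_zero.1 this).resolve_right hxQ
    rw [ha, zero_smul]

/-- The pairs of a nonsingular vector `x` and a singular vector orthogonal to `x`. -/
def orthoPairs (Q : QuadraticForm k V) (U : Submodule k V) : Set (V × V) :=
  {p | p.1 ∈ U ∧ Q p.1 ≠ 0 ∧ p.2 ∈ zeros Q U ∧ QuadraticMap.polar Q p.1 p.2 = 0}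

/-- Summing over the singular vector `e` of the pair: for `e = 0` all nonsingular vectors count,
and for `e ≠ 0` those of the hyperplane orthogonal to `e`, which has the same excess as `U`. -/
theorem card_orthoPairs (hU : NondegSub Q.polarBilin {x | Q x = 0} U) :
    (Nat.card k : ℤ) ^ 2 * (orthoPairs Q U).ncard =
      Nat.card k ^ 2 * (Nat.card k ^ Module.finrank k U - (zeros Q U).ncard) +
      ((zeros Q U).ncard - 1) * (2 * Nat.card k * Nat.card k ^ Module.finrank k U -
        Nat.card k ^ 2 * (zeros Q U).ncard - Nat.card k ^ Module.finrank k U) := by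
  classical
  have h := card_nonzeros Q (U := U)
  have h0 : (0 : V) ∈ zeros Q U := ⟨U.zero_mem, QuadraticMap.map_zero Q⟩
  have hfin := Set.toFinite (zeros Q U)
  have h1 := ncard_eq_sum_fiber (orthoPairs Q U) hfin.toFinset Prod.snd
    (fun p hp => by simpa using hp.2.2.1)
  have h2 : ∀ e ∈ zeros Q U, {p ∈ orthoPairs Q U | p.2 = e}.ncard =
      {x | x ∈ U ⊓ LinearMap.ker (Q.polarBilin e) ∧ Q x ≠ 0}.ncard := fun e he => by
    have : {p ∈ orthoPairs Q U | p.2 = e} =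
        (fun x => (x, e)) '' {x | x ∈ U ⊓ LinearMap.ker (Q.polarBilin e) ∧ Q x ≠ 0} := by
      ext ⟨x, y⟩
      simp only [orthoPairs, Set.mem_ofPred_eq, Set.mem_image, Submodule.mem_inf,
        LinearMap.mem_ker, QuadraticMap.polarBilin_apply_apply, Prod.mk.injEq]
      constructor
      · rintro ⟨⟨h1, h2, h3, h4⟩, rfl⟩
        exact ⟨x, ⟨⟨h1, by rw [QuadraticMap.polar_comm]; exact h4⟩, h2⟩, rfl, rfl⟩
      · rintro ⟨x, ⟨⟨h1, h2⟩, h3⟩, rfl, rfl⟩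
        exact ⟨⟨h1, h3, he, by rw [QuadraticMap.polar_comm]; exact h2⟩, rfl⟩
    rw [this, Set.InjOn.ncard_image]
    exact fun x _ y _ hxy => (Prod.mk.inj hxy).1
  have h3 : ∀ e ∈ zeros Q U, e ≠ 0 →
      (Nat.card k : ℤ) ^ 2 *
        {x | x ∈ U ⊓ LinearMap.ker (Q.polarBilin e) ∧ Q x ≠ 0}.ncard =
      2 * Nat.card k * Nat.card k ^ Module.finrank k U -
        Nat.card k ^ 2 * (zeros Q U).ncard - Nat.card k ^ Module.finrank k U := fun e he he0 => by
    have a1 := card_nonzeros Q (U := U ⊓ LinearMap.ker (Q.polarBilin e))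
    have a2 := zeroExcess_inf_ker Q he.1 he.2
    rw [zeroExcess, zeroExcess] at a2
    rw [← finrank_inf_ker_polar Q hU he he0] at a2 ⊢
    have a3 : ({x | x ∈ U ⊓ LinearMap.ker (Q.polarBilin e) ∧ Q x ≠ 0}.ncard : ℤ) +
      (zeros Q (U ⊓ LinearMap.ker (Q.polarBilin e))).ncard = Nat.card k ^
        Module.finrank k (U ⊓ LinearMap.ker (Q.polarBilin e) : Submodule k V) := by
      exact_mod_cast a1
    linear_combination (Nat.card k : ℤ) ^ 2 * a3 - (Nat.card k : ℤ) * a2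
  have h4 : {x | x ∈ U ⊓ LinearMap.ker (Q.polarBilin 0) ∧ Q x ≠ 0} = {x | x ∈ U ∧ Q x ≠ 0} := by
    ext x; simp
  have h5 : ({x | x ∈ U ∧ Q x ≠ 0}.ncard : ℤ) =
      Nat.card k ^ Module.finrank k U - (zeros Q U).ncard := by
    rw [eq_sub_iff_add_eq]
    exact_mod_cast h
  rw [h1, ← Finset.add_sum_erase _ _ (show (0 : V) ∈ hfin.toFinset by simpa using h0), h2 0 h0, h4]
  push_cast
  rw [h5, mul_add, Finset.mul_sum, Finset.sum_congr rfl fun e he => ?_, Finset.sum_const,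
    nsmul_eq_mul, Finset.card_erase_of_mem (by simpa using h0),
    ← Set.ncard_eq_toFinset_card _ hfin, Nat.cast_sub, Nat.cast_one]
  · exact (Set.ncard_pos hfin).2 ⟨0, h0⟩
  · simp only [Finset.mem_erase, Set.Finite.mem_toFinset] at he
    rw [h2 e he.2, h3 e he.2 he.1]

/-- The number of nondegenerate planes, weighted by nonsingular vectors: pairs `x, y` with `x`
nonsingular span a nondegenerate plane unless `y` is the sum of a multiple of `x` and a singular
vector orthogonal to `x`. -/
theorem sum_quadSubs_two :
    (Nat.card k ^ 2 - Nat.card k : ℤ) *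
        ∑ W ∈ quadSubs Q U 2, ((Nat.card k : ℤ) ^ 2 - (zeros Q W).ncard) =
      (Nat.card k ^ Module.finrank k U - (zeros Q U).ncard) * Nat.card k ^ Module.finrank k U -
        Nat.card k * (orthoPairs Q U).ncard := by
  classical
  set P : Set (V × V) := {x | x ∈ U ∧ Q x ≠ 0} ×ˢ (U : Set V) with hP
  set T : Set (V × V) := {p ∈ P | Submodule.span k {p.1, p.2} ∈ quadSubs Q U 2} with hT
  have hne : ∀ x, Q x ≠ 0 → x ≠ 0 := by
    rintro x hx rfl
    exact hx (QuadraticMap.map_zero Q)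
  have hbad : (P \ T).ncard = Nat.card k * (orthoPairs Q U).ncard := by
    have himg : (fun x : (V × V) × k => (x.1.1, x.1.2 + x.2 • x.1.1)) ''
        (orthoPairs Q U ×ˢ Set.univ) = P \ T := by
      ext ⟨x, y⟩
      constructor
      · rintro ⟨⟨⟨x, e⟩, a⟩, ⟨⟨h1, h2, h3, h4⟩, -⟩, h⟩
        simp only at h1 h2 h3 h4
        obtain ⟨rfl, rfl⟩ := Prod.mk.inj h
        refine ⟨⟨⟨h1, h2⟩, U.add_mem h3.1 (U.smul_mem _ h1)⟩, fun hxy => ?_⟩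
        obtain ⟨-, h5, h6⟩ := mem_subsFinset.1 hxy.2
        simp only at h5 h6
        have hspan : Submodule.span k {x, e + a • x} = Submodule.span k {x, e} := by
          apply le_antisymm <;> rw [Submodule.span_le]
          · rintro z (rfl | rfl)
            · exact Submodule.subset_span (by simp)
            · exact Submodule.mem_span_pair.2 ⟨a, 1, by simp [add_comm]⟩
          · rintro z (rfl | rfl)
            · exact Submodule.subset_span (by simp)
            · exact Submodule.mem_span_pair.2 ⟨-a, 1, by simp⟩
        rw [hspan] at h6
        have he0 : e = 0 := by
          refine h6 e (Submodule.subset_span (by simp)) h3.2 fun z hz => ?_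
          obtain ⟨b, c, rfl⟩ := Submodule.mem_span_pair.1 hz
          rw [map_add, map_smul, map_smul, QuadraticMap.polarBilin_apply_apply,
            QuadraticMap.polarBilin_apply_apply, QuadraticMap.polar_comm, h4,
            polar_self_of_eq_zero Q h3.2]
          simp
        subst he0
        have : Submodule.span k {x, (0 : V)} = Submodule.span k {x} := by
          rw [Set.pair_comm, Submodule.span_insert_zero]
        rw [hspan, this, finrank_span_singleton (hne x h2)] at h5
        omega
      · rintro ⟨⟨⟨h1, h2⟩, h3⟩, h4⟩
        simp only at h1 h2 h3
        by_contra hcon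
        have hcon' : ∀ e ∈ zeros Q U, QuadraticMap.polar Q x e = 0 → ∀ a : k, y ≠ e + a • x := by
          rintro e he hxe a rfl
          exact hcon ⟨((x, e), a), ⟨⟨h1, h2, he, hxe⟩, trivial⟩, rfl⟩
        have hspanU : Submodule.span k {x, y} ≤ U := by
          rw [Submodule.span_le]
          rintro z (rfl | rfl)
          exacts [h1, h3]
        refine h4 ⟨⟨⟨h1, h2⟩, h3⟩, mem_subsFinset.2 ⟨hspanU, ?_, ?_⟩⟩
        · have hli : LinearIndependent k ![x, y] := by
            rw [LinearIndependent.pair_iff' (hne x h2)]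
            rintro a rfl
            exact hcon' 0 ⟨U.zero_mem, QuadraticMap.map_zero Q⟩ (by simp) a (by simp)
          exact finrank_span_pair hli
        · intro v hv hvQ hvW
          obtain ⟨a, b, rfl⟩ := Submodule.mem_span_pair.1 hv
          have hvx := hvW x (Submodule.subset_span (by simp))
          by_cases hb : b = 0
          · subst hb
            have h0 : Q (a • x + (0 : k) • y) = 0 := hvQ
            rw [zero_smul, add_zero, QuadraticMap.map_smul, smul_eq_mul] at h0
            have ha : a = 0 := by simpa using (mul_eq_zero.1 h0).resolve_right h2
            rw [ha]; simp
          · exfalso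
            refine hcon' (b⁻¹ • (a • x + b • y)) ⟨U.smul_mem _ (hspanU hv), ?_⟩ ?_
              (-(b⁻¹ * a)) ?_
            · rw [QuadraticMap.map_smul, show Q (a • x + b • y) = 0 from hvQ, smul_zero]
            · rw [QuadraticMap.polar_smul_right, QuadraticMap.polar_comm]
              rw [QuadraticMap.polarBilin_apply_apply] at hvx
              rw [hvx, smul_zero]
            · rw [smul_add, smul_smul, smul_smul, inv_mul_cancel₀ hb, neg_smul]
              simp
    rw [← himg, Set.InjOn.ncard_image, Set.ncard_prod, Set.ncard_univ, mul_comm]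
    rintro ⟨⟨x, e⟩, a⟩ ⟨⟨h1, h2, h3, h4⟩, -⟩ ⟨⟨x', e'⟩, a'⟩ ⟨⟨-, -, h3', -⟩, -⟩ h
    obtain ⟨rfl, h⟩ := Prod.mk.inj h
    simp only at h h1 h2 h3 h4 h3'
    have h5 : e' = e + (a - a') • x := by
      rw [sub_smul, ← add_sub_assoc, h, add_sub_cancel_right]
    have h6 : (a - a') * (a - a') * Q x = 0 := by
      have := h3'.2
      rw [h5, QuadraticMap.map_add Q, h3.2, QuadraticMap.map_smul,
        QuadraticMap.polar_smul_right, QuadraticMap.polar_comm, h4] at this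
      simpa using this
    have h7 : a - a' = 0 := by simpa using (mul_eq_zero.1 h6).resolve_right h2
    rw [h7, zero_smul, add_zero] at h5
    rw [h5, sub_eq_zero.1 h7]
  have hTsum := ncard_eq_sum_fiber T (quadSubs Q U 2) (fun p => Submodule.span k {p.1, p.2})
    (fun p hp => hp.2)
  have hfib : ∀ W ∈ quadSubs Q U 2,
      ({p ∈ T | Submodule.span k {p.1, p.2} = W}.ncard : ℤ) =
        ((Nat.card k : ℤ) ^ 2 - Nat.card k) * ((Nat.card k : ℤ) ^ 2 - (zeros Q W).ncard) := by
    intro W hW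
    obtain ⟨hWU, hW2, hWn⟩ := mem_subsFinset.1 hW
    have hnz := card_nonzeros Q (U := W)
    rw [hW2] at hnz
    have hmem : ∀ p : V × V, p ∈ {p ∈ T | Submodule.span k {p.1, p.2} = W} ↔
        p.1 ∈ W ∧ Q p.1 ≠ 0 ∧ p.2 ∈ W ∧ p.2 ∉ Submodule.span k {p.1} := by
      rintro ⟨x, y⟩
      constructor
      · rintro ⟨⟨⟨⟨h1, h2⟩, h3⟩, h4⟩, rfl⟩
        refine ⟨Submodule.subset_span (by simp), h2, Submodule.subset_span (by simp), fun h => ?_⟩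
        have : Submodule.span k {x, y} ≤ Submodule.span k {x} := by
          rw [Submodule.span_le]
          rintro z (rfl | rfl)
          exacts [Submodule.mem_span_singleton_self _, h]
        have := Submodule.finrank_mono this
        rw [finrank_span_singleton (hne x h2)] at this
        have h7 : Module.finrank k (Submodule.span k {x, y}) = 2 := hW2
        omega
      · rintro ⟨h1, h2, h3, h4⟩
        simp only at h1 h2 h3 h4
        have hli : LinearIndependent k ![x, y] := by
          rw [LinearIndependent.pair_iff' (hne x h2)]
          rintro a rfl
          exact h4 (Submodule.mem_span_singleton.2 ⟨a, rfl⟩)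
        have : Submodule.span k {x, y} = W := by
          apply Submodule.eq_of_le_of_finrank_eq
          · rw [Submodule.span_le]
            rintro z (rfl | rfl)
            exacts [h1, h3]
          · rw [hW2, finrank_span_pair hli]
        refine ⟨⟨⟨⟨hWU h1, h2⟩, hWU h3⟩, ?_⟩, this⟩
        simp only [this]
        exact hW
    have h1 := ncard_eq_sum_fiber {p ∈ T | Submodule.span k {p.1, p.2} = W}
      (Set.toFinite {x | x ∈ W ∧ Q x ≠ 0}).toFinset Prod.fst
      (fun p hp => by
        rw [Set.Finite.mem_toFinset]
        exact ⟨((hmem p).1 hp).1, ((hmem p).1 hp).2.1⟩)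
    have h2 : ∀ x ∈ (Set.toFinite {x | x ∈ W ∧ Q x ≠ 0}).toFinset,
        ({p ∈ {p ∈ T | Submodule.span k {p.1, p.2} = W} | p.1 = x}.ncard : ℤ) =
          (Nat.card k : ℤ) ^ 2 - Nat.card k := by
      intro x hx
      rw [Set.Finite.mem_toFinset] at hx
      have h3 : {p ∈ {p ∈ T | Submodule.span k {p.1, p.2} = W} | p.1 = x} =
          (fun y => (x, y)) '' ((W : Set V) \ (Submodule.span k {x} : Set V)) := by
        ext ⟨x', y⟩
        constructor
        · rintro ⟨h, rfl⟩
          exact ⟨y, ((hmem _).1 h).2.2, rfl⟩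
        · rintro ⟨y, hy, h⟩
          obtain ⟨rfl, rfl⟩ := Prod.mk.inj h
          exact ⟨(hmem _).2 ⟨hx.1, hx.2, hy⟩, rfl⟩
      have h4 : (Submodule.span k {x} : Set V) ⊆ W := by
        have : Submodule.span k {x} ≤ W := by simpa using hx.1
        exact this
      have h5 := Set.ncard_sdiff_add_ncard_of_subset h4
      rw [card_eq_pow, card_eq_pow, finrank_span_singleton (hne x hx.2), hW2, pow_one] at h5
      rw [h3, Set.InjOn.ncard_image fun y _ y' _ h => (Prod.mk.inj h).2, eq_sub_iff_add_eq]
      exact_mod_cast h5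
    rw [h1, Nat.cast_sum, Finset.sum_congr rfl h2, Finset.sum_const, nsmul_eq_mul,
      ← Set.ncard_eq_toFinset_card]
    have h6 : ({x | x ∈ W ∧ Q x ≠ 0}.ncard : ℤ) = (Nat.card k : ℤ) ^ 2 - (zeros Q W).ncard := by
      rw [eq_sub_iff_add_eq]
      exact_mod_cast hnz
    rw [h6, mul_comm]
  have hsub : T ⊆ P := fun p hp => hp.1
  have hPc : P.ncard = (P \ T).ncard + T.ncard := (Set.ncard_sdiff_add_ncard_of_subset hsub).symm
  have hPn : (P.ncard : ℤ) = (Nat.card k ^ Module.finrank k U - (zeros Q U).ncard) *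
      Nat.card k ^ Module.finrank k U := by
    have h := card_nonzeros Q (U := U)
    have h5 : ({x | x ∈ U ∧ Q x ≠ 0}.ncard : ℤ) =
        Nat.card k ^ Module.finrank k U - (zeros Q U).ncard := by
      rw [eq_sub_iff_add_eq]
      exact_mod_cast h
    rw [hP, Set.ncard_prod, card_eq_pow]
    push_cast
    rw [h5]
  have hTn : (T.ncard : ℤ) = (Nat.card k ^ 2 - Nat.card k : ℤ) *
        ∑ W ∈ quadSubs Q U 2, ((Nat.card k : ℤ) ^ 2 - (zeros Q W).ncard) := by
    rw [hTsum, Nat.cast_sum, Finset.sum_congr rfl hfib, Finset.mul_sum]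
  rw [← hTn, ← hPn, hPc, hbad]
  push_cast
  ring

end Count

/-! ### The recursion for the number of nondegenerate subspaces -/

section Recursion

variable {c : ℤ}

/-- The square of the sign of a nondegenerate quadratic space of dimension `n`. -/
def signSq (n : ℕ) : ℤ := if Even n then 1 else 0

theorem signSq_add_two (n : ℕ) : signSq (n + 2) = signSq n := by
  simp [signSq, Nat.even_add]

theorem quasiPoly_signTerm (n : ℕ) :
    QuasiPoly c fun q ε => (ε : ℚ) * (((q : ℚ) - 1) * (q : ℚ) ^ (n / 2)) :=
  quasiPoly_sign.mul ((quasiPoly_q.sub quasiPoly_one).mul (quasiPoly_pow _))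

theorem isMonicValue_sub_one : IsMonicValue fun q => (q : ℚ) - 1 := by
  simpa using isMonicValue_pow_sub_one one_ne_zero

theorem isMonicValue_add_one : IsMonicValue fun q => (q : ℚ) + 1 := by
  simpa using isMonicValue_pow_add_one one_ne_zero

theorem isMonicValue_q : IsMonicValue fun q => (q : ℚ) := by
  simpa using isMonicValue_pow 1

/-- In a nondegenerate quadratic space of dimension `n`, the number of nondegenerate subspaces of
dimension `m`, and the sum of their signs, are quasi-polynomial in `q` and the sign of the space.
The recursion on `m` removes a hyperbolic plane; counting hyperbolic pairs with weights `1` and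
`sgn` gives two linear equations for the two unknowns, and these are independent except
for `m = 2`, where the count of planes by nonsingular vectors replaces the second one. -/
theorem exists_quasiPoly_card_quadSubs (m : ℕ) : ∀ n : ℕ, ∃ Φ Ψ : ℕ → ℤ → ℚ,
    QuasiPoly (signSq n) Φ ∧ QuasiPoly (signSq n) Ψ ∧
      ∀ (k : Type u) [Field k] [Finite k] (V : Type v) [AddCommGroup V] [Module k V]
        [FiniteDimensional k V] [Finite V] (Q : QuadraticForm k V) (U : Submodule k V),
        NondegSub Q.polarBilin {x | Q x = 0} U → Module.finrank k U = n →
        ((quadSubs Q U m).card : ℚ) = Φ (Nat.card k) (sgn Q U) ∧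
        ((∑ W ∈ quadSubs Q U m, sgn Q W : ℤ) : ℚ) = Ψ (Nat.card k) (sgn Q U) := by
  have hodd : ∀ m : ℕ, ¬ Even m → ∀ (k : Type u) [Field k] [Finite k] (V : Type v)
      [AddCommGroup V] [Module k V] [FiniteDimensional k V] [Finite V] (Q : QuadraticForm k V)
      (U : Submodule k V), ∑ W ∈ quadSubs Q U m, sgn Q W = 0 := by
    intro m hm k _ _ V _ _ _ _ Q U
    refine Finset.sum_eq_zero fun W hW => sgn_of_odd Q ?_
    rwa [(mem_subsFinset.1 hW).2.1]
  induction m using Nat.twoStepInduction with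
  | zero =>
    refine fun n => ⟨_, _, quasiPoly_one, quasiPoly_one, ?_⟩
    intro k _ _ V _ _ _ _ Q U hU hn
    rw [quadSubs_zero]
    simp [sgn_bot]
  | one =>
    refine fun n => ⟨_, _, ((quasiPoly_pow n).sub (((quasiPoly_pow n).add
      (quasiPoly_signTerm n)).div isMonicValue_q)).div isMonicValue_sub_one, quasiPoly_zero, ?_⟩
    intro k _ _ V _ _ _ _ Q U hU hn
    have hq : (2 : ℚ) ≤ Nat.card k := by exact_mod_cast two_le_natCard k
    have hq1 : (Nat.card k : ℚ) - 1 ≠ 0 := by linarith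
    rw [hodd 1 (by decide)]
    refine ⟨?_, by simp⟩
    have h1 := congrArg (Int.cast : ℤ → ℚ) (card_quadSubs_one Q (U := U))
    have h2 := congrArg (Int.cast : ℤ → ℚ) (zeros_card_mul Q hU)
    push_cast at h1 h2
    rw [hn] at h1 h2
    rw [← h2, mul_div_cancel_left₀ _ (by positivity), ← h1, mul_div_cancel_right₀ _ hq1]
  | more m ih _ =>
    intro n
    by_cases hn2 : n < m + 2
    · refine ⟨_, _, quasiPoly_zero, quasiPoly_zero, ?_⟩
      intro k _ _ V _ _ _ _ Q U hU hn
      rw [quadSubs_eq_empty Q (by omega)]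
      simp
    obtain ⟨n', rfl⟩ : ∃ n', n = n' + 2 := ⟨n - 2, by omega⟩
    obtain ⟨Φ, Ψ, hΦ, hΨ, h⟩ := ih n'
    rw [signSq_add_two]
    -- the number of hyperbolic pairs, up to a power of `q`
    have hκ : QuasiPoly (signSq n') fun q ε => ((q : ℚ) ^ (n' + 2) - q +
        ε * (((q : ℚ) - 1) * (q : ℚ) ^ ((n' + 2) / 2))) * (q : ℚ) ^ (n' + 2) :=
      (((quasiPoly_pow _).sub quasiPoly_q).add (quasiPoly_signTerm _)).mul (quasiPoly_pow _)
    set κ : ℕ → ℤ → ℚ := fun q ε => ((q : ℚ) ^ (n' + 2) - q +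
        ε * (((q : ℚ) - 1) * (q : ℚ) ^ ((n' + 2) / 2))) * (q : ℚ) ^ (n' + 2) with hκdef
    have E1 : ∀ (k : Type u) [Field k] [Finite k] (V : Type v) [AddCommGroup V] [Module k V]
        [FiniteDimensional k V] [Finite V] (Q : QuadraticForm k V) (U : Submodule k V),
        NondegSub Q.polarBilin {x | Q x = 0} U → Module.finrank k U = n' + 2 →
        ((Nat.card k : ℚ) ^ (m + 2) - Nat.card k) * Nat.card k ^ (m + 2) *
          (quadSubs Q U (m + 2)).card +
        ((Nat.card k : ℚ) - 1) * Nat.card k ^ (m / 2 + 1) * Nat.card k ^ (m + 2) *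
          ((∑ W ∈ quadSubs Q U (m + 2), sgn Q W : ℤ) : ℚ) =
        κ (Nat.card k) (sgn Q U) * Φ (Nat.card k) (sgn Q U) := by
      intro k _ _ V _ _ _ _ Q U hU hn
      have hB := polarBilin_isRefl Q
      have hS : ∀ x ∈ {x | Q x = 0}, Q.polarBilin x x = 0 := fun x hx =>
        polar_self_of_eq_zero Q hx
      have := hypPairs_quad_sum Q m (fun _ => 1) (fun _ _ _ _ => rfl)
        (z := Φ (Nat.card k) (sgn Q U)) (fun p hp => ?_) hU
      · rw [hn] at this
        simpa [hκdef] using this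
      · have h1 := finrank_hypCompl hB hS hp
        rw [← sgn_hypCompl Q hU hp, ← (h k V Q _ ((nondegSub_hypCompl_iff hB hS hp).2 hU)
          (by omega)).1]
        simp
    have E2 : ∀ (k : Type u) [Field k] [Finite k] (V : Type v) [AddCommGroup V] [Module k V]
        [FiniteDimensional k V] [Finite V] (Q : QuadraticForm k V) (U : Submodule k V),
        NondegSub Q.polarBilin {x | Q x = 0} U → Module.finrank k U = n' + 2 → Even m →
        ((Nat.card k : ℚ) ^ (m + 2) - Nat.card k) * Nat.card k ^ (m + 2) *
          ((∑ W ∈ quadSubs Q U (m + 2), sgn Q W : ℤ) : ℚ) +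
        ((Nat.card k : ℚ) - 1) * Nat.card k ^ (m / 2 + 1) * Nat.card k ^ (m + 2) *
          (quadSubs Q U (m + 2)).card =
        κ (Nat.card k) (sgn Q U) * Ψ (Nat.card k) (sgn Q U) := by
      intro k _ _ V _ _ _ _ Q U hU hn hm
      have hB := polarBilin_isRefl Q
      have hS : ∀ x ∈ {x | Q x = 0}, Q.polarBilin x x = 0 := fun x hx =>
        polar_self_of_eq_zero Q hx
      have := hypPairs_quad_sum Q m (sgn Q) (fun _ _ hW hp => sgn_hypCompl Q hW hp)
        (z := Ψ (Nat.card k) (sgn Q U)) (fun p hp => ?_) hU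
      · rw [hn, Finset.sum_congr rfl fun W hW => show sgn Q W * sgn Q W = 1 by
          rw [← sq, sgn_sq, (mem_subsFinset.1 hW).2.1, if_pos (by simpa [Nat.even_add] using hm)]]
          at this
        simpa [hκdef] using this
      · have h1 := finrank_hypCompl hB hS hp
        rw [← sgn_hypCompl Q hU hp, ← (h k V Q _ ((nondegSub_hypCompl_iff hB hS hp).2 hU)
          (by omega)).2]
    by_cases hm : Even m
    · rcases Nat.eq_zero_or_pos m with rfl | hm0
      · -- For planes the two equations coincide, as `q ^ 2 - q = (q - 1) * q`; the count of planes by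
        -- nonsingular vectors, with `Z` singular vectors and `O` orthogonal pairs, is the second one.
        have hZ : QuasiPoly (signSq n') fun q ε => ((q : ℚ) ^ (n' + 2) +
            ε * (((q : ℚ) - 1) * (q : ℚ) ^ ((n' + 2) / 2))) / q :=
          ((quasiPoly_pow _).add (quasiPoly_signTerm _)).div isMonicValue_q
        set Z : ℕ → ℤ → ℚ := fun q ε => ((q : ℚ) ^ (n' + 2) +
            ε * (((q : ℚ) - 1) * (q : ℚ) ^ ((n' + 2) / 2))) / q with hZdef
        have hO : QuasiPoly (signSq n') fun q ε => ((q : ℚ) ^ 2 * ((q : ℚ) ^ (n' + 2) - Z q ε) +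
            (Z q ε - 1) * (2 * (q : ℚ) * (q : ℚ) ^ (n' + 2) - (q : ℚ) ^ 2 * Z q ε -
              (q : ℚ) ^ (n' + 2))) / (q : ℚ) ^ 2 := by
          refine QuasiPoly.div ?_ (isMonicValue_pow 2)
          refine ((quasiPoly_pow _).mul ((quasiPoly_pow _).sub hZ)).add
            ((hZ.sub quasiPoly_one).mul (((QuasiPoly.mul ?_ (quasiPoly_pow _)).sub
            ((quasiPoly_pow _).mul hZ)).sub (quasiPoly_pow _)))
          exact (quasiPoly_const (c := signSq n') 2).mul quasiPoly_q
        set O : ℕ → ℤ → ℚ := fun q ε => ((q : ℚ) ^ 2 * ((q : ℚ) ^ (n' + 2) - Z q ε) +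
            (Z q ε - 1) * (2 * (q : ℚ) * (q : ℚ) ^ (n' + 2) - (q : ℚ) ^ 2 * Z q ε -
              (q : ℚ) ^ (n' + 2))) / (q : ℚ) ^ 2 with hOdef
        have hR : QuasiPoly (signSq n') fun q ε =>
            ((q : ℚ) ^ (n' + 2) - Z q ε) * (q : ℚ) ^ (n' + 2) - q * O q ε :=
          (((quasiPoly_pow _).sub hZ).mul (quasiPoly_pow _)).sub (quasiPoly_q.mul hO)
        set R : ℕ → ℤ → ℚ := fun q ε =>
            ((q : ℚ) ^ (n' + 2) - Z q ε) * (q : ℚ) ^ (n' + 2) - q * O q ε with hRdef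
        have hA := (hκ.mul hΦ).div ((isMonicValue_pow 3).mul isMonicValue_sub_one)
        have hN := (hA.add (hR.div (isMonicValue_q.mul
          (isMonicValue_sub_one.mul isMonicValue_sub_one)))).div isMonicValue_add_one
        refine ⟨_, _, hN, hA.sub hN, ?_⟩
        intro k _ _ V _ _ _ _ Q U hU hn
        have e1 := E1 k V Q U hU hn
        have e3 := congrArg (Int.cast : ℤ → ℚ) (sum_quadSubs_two Q (U := U))
        have e4 := congrArg (Int.cast : ℤ → ℚ) (zeros_card_mul Q hU)
        have e5 := congrArg (Int.cast : ℤ → ℚ) (card_orthoPairs Q hU)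
        have hq : (2 : ℚ) ≤ Nat.card k := by exact_mod_cast two_le_natCard k
        have hsum : ∑ W ∈ quadSubs Q U 2, ((Nat.card k : ℤ) ^ 2 - (zeros Q W).ncard) =
            (Nat.card k ^ 2 - Nat.card k) * (quadSubs Q U 2).card -
              (Nat.card k - 1) * ∑ W ∈ quadSubs Q U 2, sgn Q W := by
          rw [Finset.mul_sum, mul_comm, ← nsmul_eq_mul, ← Finset.sum_const,
            ← Finset.sum_sub_distrib]
          refine Finset.sum_congr rfl fun W hW => ?_
          obtain ⟨-, h2, h3⟩ := mem_subsFinset.1 hW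
          have h4 := zeros_card_mul Q h3
          have hq0 : (Nat.card k : ℤ) ≠ 0 := by
            have := two_le_natCard k
            positivity
          rw [h2] at h4
          refine mul_left_cancel₀ hq0 ?_
          norm_num at h4
          linear_combination -h4
        rw [hsum] at e3
        push_cast at e3 e4 e5
        rw [hn] at e3 e4 e5
        have hq0 : (Nat.card k : ℚ) ≠ 0 := by linarith
        have hq1 : (Nat.card k : ℚ) - 1 ≠ 0 := by linarith
        have hq2 : (Nat.card k : ℚ) + 1 ≠ 0 := by linarith
        have hz : ((zeros Q U).ncard : ℚ) = Z (Nat.card k) (sgn Q U) := by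
          rw [hZdef, eq_div_iff hq0, ← e4]
          ring
        have ho : ((orthoPairs Q U).ncard : ℚ) = O (Nat.card k) (sgn Q U) := by
          rw [hOdef, eq_div_iff (pow_ne_zero 2 hq0), ← hz, mul_comm, e5]
        rw [hz, ho] at e3
        change _ = R (Nat.card k) (sgn Q U) at e3
        have e1' : ((Nat.card k : ℚ) ^ 2 - Nat.card k) * Nat.card k ^ 2 * (quadSubs Q U 2).card +
            ((Nat.card k : ℚ) - 1) * Nat.card k * Nat.card k ^ 2 *
              ((∑ W ∈ quadSubs Q U 2, sgn Q W : ℤ) : ℚ) =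
            κ (Nat.card k) (sgn Q U) * Φ (Nat.card k) (sgn Q U) := by
          simpa using e1
        rw [zero_add, ← Int.cast_sum] at *
        have hNval : ((quadSubs Q U 2).card : ℚ) = (κ (Nat.card k) (sgn Q U) *
            Φ (Nat.card k) (sgn Q U) / ((Nat.card k : ℚ) ^ 3 * ((Nat.card k : ℚ) - 1)) +
            R (Nat.card k) (sgn Q U) / ((Nat.card k : ℚ) * (((Nat.card k : ℚ) - 1) *
              ((Nat.card k : ℚ) - 1)))) / ((Nat.card k : ℚ) + 1) := by
          rw [← e1', ← e3]
          field_simp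
          ring
        refine ⟨hNval, ?_⟩
        rw [← hNval, ← e1']
        field_simp
        ring
      · obtain ⟨j, rfl⟩ : ∃ j, m = 2 * j + 2 := by
          obtain ⟨i, rfl⟩ := hm
          exact ⟨i - 1, by omega⟩
        -- The equations have the matrix `!![a, b; b, a]`, up to the factor `q ^ (m + 2)`, with
        -- `a = q ^ (2 * j + 4) - q` and `b = (q - 1) * q ^ (j + 2)`; the product in `hg` has the factors
        -- `a - b = q * (q ^ (j + 1) - 1) * (q ^ (j + 2) + 1)` and
        -- `a + b = q * (q ^ (j + 1) + 1) * (q ^ (j + 2) - 1)` of the determinant.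
        have hg : IsMonicValue fun q => (q : ℚ) ^ (2 * j + 4) * (((q : ℚ) * ((q : ℚ) ^ (j + 1) - 1)) *
            ((q : ℚ) ^ (j + 2) + 1) * ((q : ℚ) * ((q : ℚ) ^ (j + 1) + 1)) *
              ((q : ℚ) ^ (j + 2) - 1)) :=
          (isMonicValue_pow _).mul ((((isMonicValue_q.mul (isMonicValue_pow_sub_one (by omega))).mul
            (isMonicValue_pow_add_one (by omega))).mul (isMonicValue_q.mul
              (isMonicValue_pow_add_one (by omega)))).mul (isMonicValue_pow_sub_one (by omega)))
        have ha : QuasiPoly (signSq n') fun q _ => (q : ℚ) ^ (2 * j + 4) - q :=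
          (quasiPoly_pow _).sub quasiPoly_q
        have hb : QuasiPoly (signSq n') fun q _ => ((q : ℚ) - 1) * (q : ℚ) ^ (j + 2) :=
          (quasiPoly_q.sub quasiPoly_one).mul (quasiPoly_pow _)
        refine ⟨_, _, (hκ.mul ((ha.mul hΦ).sub (hb.mul hΨ))).div hg,
          (hκ.mul ((ha.mul hΨ).sub (hb.mul hΦ))).div hg, ?_⟩
        intro k _ _ V _ _ _ _ Q U hU hn
        have e1 := E1 k V Q U hU hn
        have e2 := E2 k V Q U hU hn hm
        have hj : (2 * j + 2) / 2 + 1 = j + 2 := by omega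
        obtain ⟨M, -, hM⟩ := hg
        have hg0 := (hM _ (two_le_natCard k)).1
        simp only [hj] at e1 e2
        constructor
        · rw [eq_div_iff hg0]
          linear_combination ((Nat.card k : ℚ) ^ (2 * j + 4) - Nat.card k) * e1 -
            ((Nat.card k : ℚ) - 1) * (Nat.card k : ℚ) ^ (j + 2) * e2
        · rw [eq_div_iff hg0]
          linear_combination ((Nat.card k : ℚ) ^ (2 * j + 4) - Nat.card k) * e2 -
            ((Nat.card k : ℚ) - 1) * (Nat.card k : ℚ) ^ (j + 2) * e1
    · have hg : IsMonicValue fun q => (q : ℚ) * ((q : ℚ) ^ (m + 1) - 1) * (q : ℚ) ^ (m + 2) :=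
        (isMonicValue_q.mul (isMonicValue_pow_sub_one (by omega))).mul (isMonicValue_pow _)
      refine ⟨_, _, (hκ.mul hΦ).div hg, quasiPoly_zero, ?_⟩
      intro k _ _ V _ _ _ _ Q U hU hn
      have e1 := E1 k V Q U hU hn
      rw [hodd (m + 2) (by simpa [Nat.even_add] using hm)] at e1 ⊢
      refine ⟨?_, by simp⟩
      obtain ⟨M, -, hM⟩ := hg
      have hg0 := (hM _ (two_le_natCard k)).1
      rw [eq_div_iff hg0]
      push_cast at e1
      linear_combination e1

end Recursion

/-! ### Flags of nondegenerate subspaces -/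

section Flags

variable {k : Type*} [Field k] {V : Type*} [AddCommGroup V] [Module k V]

/-- The descending sequences of nondegenerate subspaces of `U` of dimensions `d 0, d 1, …`. -/
def nondegFlags (B : LinearMap.BilinForm k V) (S : Set V) (U : Submodule k V) (d : ℕ → ℕ) :
    Set (ℕ → Submodule k V) :=
  {F | F 0 ≤ U ∧ (∀ n, F (n + 1) ≤ F n) ∧ (∀ n, Module.finrank k (F n) = d n) ∧
    ∀ n, NondegSub B S (F n)}

theorem ncard_nondegFlags_zero [FiniteDimensional k V] (B : LinearMap.BilinForm k V) (S : Set V)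
    (U : Submodule k V) {d : ℕ → ℕ} (hd : ∀ n, d n = 0) : (nondegFlags B S U d).ncard = 1 := by
  rw [Set.ncard_eq_one]
  refine ⟨fun _ => ⊥, Set.ext fun F => ⟨fun hF => funext fun n => ?_, ?_⟩⟩
  · have h := hF.2.2.1 n
    rwa [hd n, Submodule.finrank_eq_zero] at h
  · rintro rfl
    exact ⟨bot_le, fun _ => le_rfl, fun n => by simp [hd n], fun _ x hx _ _ => hx⟩

variable [FiniteDimensional k V] [Finite V] (B : LinearMap.BilinForm k V) (S : Set V)
  (U : Submodule k V) {d : ℕ → ℕ}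

theorem finite_nondegFlags {L : ℕ} (hd : ∀ n, L ≤ n → d n = 0) :
    (nondegFlags B S U d).Finite := by
  refine Set.Finite.of_finite_image (f := fun F (i : Fin L) => F i) (Set.toFinite _) ?_
  intro F hF G hG h
  funext n
  by_cases hn : n < L
  · exact congrFun h ⟨n, hn⟩
  · have h1 := hF.2.2.1 n
    have h2 := hG.2.2.1 n
    rw [hd n (by omega), Submodule.finrank_eq_zero] at h1 h2
    rw [h1, h2]

/-- A flag consists of its first member `W` and a flag in `W`. -/
theorem ncard_nondegFlags_succ {L : ℕ} (hd : ∀ n, L ≤ n → d n = 0) :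
    (nondegFlags B S U d).ncard =
      ∑ W ∈ subsFinset B S U (d 0), (nondegFlags B S W fun n => d (n + 1)).ncard := by
  classical
  have hfin := finite_nondegFlags B S U hd
  rw [Set.ncard_eq_toFinset_card _ hfin, Finset.card_eq_sum_card_fiberwise (f := fun F => F 0)
    (t := subsFinset B S U (d 0))]
  · refine Finset.sum_congr rfl fun W hW => ?_
    obtain ⟨hWU, hWd, hWn⟩ := mem_subsFinset.1 hW
    have hfin' := finite_nondegFlags (L := L) (d := fun n => d (n + 1)) B S W
      (fun n hn => hd (n + 1) (by omega))
    rw [Set.ncard_eq_toFinset_card _ hfin']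
    refine Finset.card_bij' (fun F _ n => F (n + 1)) (fun F _ n => Nat.casesOn n W F) ?_ ?_ ?_ ?_
    · intro F hF
      simp only [Finset.mem_filter, Set.Finite.mem_toFinset] at hF ⊢
      obtain ⟨⟨h1, h2, h3, h4⟩, rfl⟩ := hF
      exact ⟨h2 0, fun n => h2 (n + 1), fun n => h3 (n + 1), fun n => h4 (n + 1)⟩
    · intro F hF
      simp only [Finset.mem_filter, Set.Finite.mem_toFinset] at hF ⊢
      obtain ⟨h1, h2, h3, h4⟩ := hF
      refine ⟨⟨hWU, ?_, ?_, ?_⟩, rfl⟩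
      · rintro (_ | n)
        exacts [h1, h2 n]
      · rintro (_ | n)
        exacts [hWd, h3 n]
      · rintro (_ | n)
        exacts [hWn, h4 n]
    · intro F hF
      simp only [Finset.mem_filter, Set.Finite.mem_toFinset] at hF
      funext n
      rcases n with _ | n
      exacts [hF.2.symm, rfl]
    · intro F hF
      rfl
  · intro F hF
    simp only [Set.Finite.coe_toFinset] at hF
    exact mem_subsFinset.2 ⟨hF.1, hF.2.2.1 0, hF.2.2.2 0⟩

end Flags

/-- The number of flags of nondegenerate subspaces of given dimensions in a nondegenerate quadratic
space is quasi-polynomial in `q` and the sign of the space. -/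
theorem exists_quasiPoly_quadFlags (L : ℕ) : ∀ (d : ℕ → ℕ) (n : ℕ), (∀ i, L ≤ i → d i = 0) →
    ∃ Φ : ℕ → ℤ → ℚ, QuasiPoly (signSq n) Φ ∧
      ∀ (k : Type u) [Field k] [Finite k] (V : Type v) [AddCommGroup V] [Module k V]
        [FiniteDimensional k V] [Finite V] (Q : QuadraticForm k V) (U : Submodule k V),
        NondegSub Q.polarBilin {x | Q x = 0} U → Module.finrank k U = n →
        ((nondegFlags Q.polarBilin {x | Q x = 0} U d).ncard : ℚ) = Φ (Nat.card k) (sgn Q U) := by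
  induction L with
  | zero =>
    intro d n hd
    refine ⟨_, quasiPoly_one, ?_⟩
    intro k _ _ V _ _ _ _ Q U _ _
    rw [ncard_nondegFlags_zero _ _ _ fun i => hd i (Nat.zero_le i), Nat.cast_one]
  | succ L ih =>
    intro d n hd
    obtain ⟨Φ, ⟨g, hg, A, B, hAB⟩, hΦ⟩ := ih (fun i => d (i + 1)) (d 0)
      (fun i hi => hd (i + 1) (by omega))
    obtain ⟨N, D, hN, hD, hND⟩ := exists_quasiPoly_card_quadSubs.{u, v} (d 0) n
    refine ⟨_, (((quasiPoly_poly A).div hg).mul hN).add (((quasiPoly_poly B).div hg).mul hD), ?_⟩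
    intro k _ _ V _ _ _ _ Q U hU hn
    have hq := two_le_natCard k
    obtain ⟨h1, h2⟩ := hND k V Q U hU hn
    rw [ncard_nondegFlags_succ _ _ _ hd, ← h1, ← h2]
    have hW : ∀ W ∈ quadSubs Q U (d 0),
        ((nondegFlags Q.polarBilin {x | Q x = 0} W fun i => d (i + 1)).ncard : ℚ) =
          (A.eval (Nat.card k : ℤ) : ℤ) / g (Nat.card k) +
            (B.eval (Nat.card k : ℤ) : ℤ) / g (Nat.card k) * (sgn Q W : ℤ) := by
      intro W hW
      obtain ⟨-, hWd, hWn⟩ := mem_subsFinset.1 hW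
      have hε : sgn Q W ^ 2 = signSq (d 0) := by rw [sgn_sq, hWd, signSq]
      obtain ⟨M, -, hM⟩ := hg
      have hg0 := (hM _ hq).1
      rw [hΦ k V Q W hWn hWd]
      have := hAB _ hq _ hε
      field_simp
      linear_combination this
    rw [Nat.cast_sum, Finset.sum_congr rfl hW, Finset.sum_add_distrib, Finset.sum_const,
      ← Finset.mul_sum, nsmul_eq_mul, Int.cast_sum]
    ring

/-! ### Counting in symplectic spaces -/

section Symplectic

variable {k : Type*} [Field k] {V : Type*} [AddCommGroup V] [Module k V]
  {B : LinearMap.BilinForm k V} {U : Submodule k V}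

theorem exists_hypPair_univ (hU : NondegSub B Set.univ U) {e : V} (he : e ∈ U) (he0 : e ≠ 0) :
    ∃ f, (e, f) ∈ hypPairs B Set.univ U := by
  have : ∃ y ∈ U, B e y ≠ 0 := by
    by_contra! h
    exact he0 (hU e he trivial h)
  obtain ⟨y, hyU, hy⟩ := this
  refine ⟨(B e y)⁻¹ • y, he, U.smul_mem _ hyU, trivial, trivial, ?_⟩
  simp [hy]

/-- For each nonzero `e`, the vectors `f` with `B e f = 1` form an affine hyperplane. -/
theorem card_hypPairs_univ [Finite k] [FiniteDimensional k V] [Finite V]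
    (hU : NondegSub B Set.univ U) :
    (hypPairs B Set.univ U).ncard * Nat.card k =
      (Nat.card k ^ Module.finrank k U - 1) * Nat.card k ^ Module.finrank k U := by
  have hex : ∀ e, ∃ f, e ∈ (U : Set V) \ {0} → (e, f) ∈ hypPairs B Set.univ U := fun e => by
    by_cases he : e ∈ (U : Set V) \ {0}
    · obtain ⟨f, hf⟩ := exists_hypPair_univ hU he.1 he.2
      exact ⟨f, fun _ => hf⟩
    · exact ⟨0, fun h => absurd h he⟩
  choose f₀ hf₀ using hex
  have hH : ∀ p ∈ hypPairs B Set.univ U, p.1 ∈ (U : Set V) \ {0} := by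
    rintro p ⟨h1, -, -, -, h5⟩
    refine ⟨h1, fun h0 => ?_⟩
    rw [Set.mem_singleton_iff] at h0
    rw [h0, map_zero, LinearMap.zero_apply] at h5
    exact zero_ne_one h5
  let g : (V × V) × k → V × V := fun x => (x.1.1, x.1.2 + x.2 • f₀ x.1.1)
  have hg : g '' (hypPairs B Set.univ U ×ˢ Set.univ) = ((U : Set V) \ {0}) ×ˢ (U : Set V) := by
    ext ⟨e, y⟩
    constructor
    · rintro ⟨⟨⟨e', f⟩, t⟩, ⟨hp, -⟩, h⟩
      obtain ⟨rfl, rfl⟩ := Prod.mk.inj h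
      have he := hH (e', f) hp
      exact ⟨he, U.add_mem hp.2.1 (U.smul_mem _ (hf₀ _ he).2.1)⟩
    · rintro ⟨he, hy⟩
      have hp := hf₀ e he
      have hef : B e (f₀ e) = 1 := hp.2.2.2.2
      refine ⟨((e, y - (B e y - 1) • f₀ e), B e y - 1), ⟨⟨he.1, U.sub_mem hy
        (U.smul_mem _ hp.2.1), trivial, trivial, ?_⟩, trivial⟩, ?_⟩
      · simp [hef]
      · simp [g]
  have hinj : Set.InjOn g (hypPairs B Set.univ U ×ˢ Set.univ) := by
    rintro ⟨⟨e, f⟩, t⟩ ⟨hp, -⟩ ⟨⟨e', f'⟩, t'⟩ ⟨hp', -⟩ h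
    obtain ⟨rfl, h⟩ := Prod.mk.inj h
    simp only at h
    have hef : B e (f₀ e) = 1 := (hf₀ e (hH (e, f) hp)).2.2.2.2
    have hf : B e f = 1 := hp.2.2.2.2
    have hf' : B e f' = 1 := hp'.2.2.2.2
    have h1 := congrArg (B e) h
    simp only [map_add, map_smul, hef, hf, hf', smul_eq_mul, mul_one, add_right_inj] at h1
    subst h1
    rw [add_left_inj] at h
    rw [h]
  have hc := hinj.ncard_image
  rw [hg, Set.ncard_prod, Set.ncard_prod, Set.ncard_univ, card_eq_pow] at hc
  have h0 := Set.ncard_sdiff_singleton_add_one (s := (U : Set V)) U.zero_mem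
  rw [card_eq_pow] at h0
  rw [← hc, ← h0, Nat.add_sub_cancel]

end Symplectic

/-- The number of nondegenerate subspaces of given even dimension in a symplectic space is
quasi-polynomial in `q`; hyperbolic pairs give the recursion. There is no sign here, whence the
parameter `0`. -/
theorem exists_quasiPoly_card_symplecticSubs (r : ℕ) : ∀ n : ℕ, ∃ Φ : ℕ → ℤ → ℚ,
    QuasiPoly 0 Φ ∧
      ∀ (k : Type u) [Field k] [Finite k] (V : Type v) [AddCommGroup V] [Module k V]
        [FiniteDimensional k V] [Finite V] (B : LinearMap.BilinForm k V) (U : Submodule k V),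
        B.IsAlt → NondegSub B Set.univ U → Module.finrank k U = n →
        ((subsFinset B Set.univ U (2 * r)).card : ℚ) = Φ (Nat.card k) 0 := by
  induction r with
  | zero =>
    refine fun n => ⟨_, quasiPoly_one, ?_⟩
    intro k _ _ V _ _ _ _ B U _ _ _
    have : subsFinset B Set.univ U (2 * 0) = {⊥} := by
      ext W
      rw [mem_subsFinset, Finset.mem_singleton, mul_zero, Submodule.finrank_eq_zero]
      constructor
      · exact fun h => h.2.1
      · rintro rfl
        exact ⟨bot_le, rfl, fun x hx _ _ => hx⟩
    rw [this, Finset.card_singleton, Nat.cast_one]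
  | succ r ih =>
    intro n
    by_cases hn2 : n < 2 * (r + 1)
    · refine ⟨_, quasiPoly_zero, ?_⟩
      intro k _ _ V _ _ _ _ B U _ _ hn
      have : subsFinset B Set.univ U (2 * (r + 1)) = ∅ := by
        rw [Finset.eq_empty_iff_forall_notMem]
        intro W hW
        obtain ⟨h1, h2, -⟩ := mem_subsFinset.1 hW
        have := Submodule.finrank_mono h1
        omega
      simp [this]
    obtain ⟨n', rfl⟩ : ∃ n', n = n' + 2 := ⟨n - 2, by omega⟩
    obtain ⟨Φ, hΦ, h⟩ := ih n'
    have hg : IsMonicValue fun q => ((q : ℚ) ^ (2 * r + 2) - 1) * (q : ℚ) ^ (2 * r + 2) :=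
      (isMonicValue_pow_sub_one (by omega)).mul (isMonicValue_pow _)
    refine ⟨_, ((((quasiPoly_pow (n' + 2)).sub quasiPoly_one).mul
      (quasiPoly_pow (n' + 2))).mul hΦ).div hg, ?_⟩
    intro k _ _ V _ _ _ _ B U hB hU hn
    have hq := two_le_natCard k
    have hS : ∀ x ∈ (Set.univ : Set V), B x x = 0 := fun x _ => hB x
    have hpow : ∀ j : ℕ, ((Nat.card k ^ j - 1 : ℕ) : ℚ) = (Nat.card k : ℚ) ^ j - 1 := fun j => by
      rw [Nat.cast_sub (Nat.one_le_pow _ _ (by omega))]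
      push_cast
      ring
    have hsum := congrArg (Int.cast : ℤ → ℚ) (sum_nondegSubs_mul_card_hypPairs hB.isRefl hS U (2 * r)
      (fun _ => 1) (fun _ _ _ _ => rfl))
    simp only [mul_one, Finset.sum_const, nsmul_eq_mul, Int.cast_sum, Int.cast_natCast] at hsum
    have hp : ∀ p ∈ (Set.toFinite (hypPairs B Set.univ U)).toFinset,
        ((Set.toFinite (nondegSubs B Set.univ (hypCompl B U p) (2 * r))).toFinset.card : ℚ) =
          Φ (Nat.card k) 0 := by
      intro p hp
      rw [Set.Finite.mem_toFinset] at hp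
      have h1 := finrank_hypCompl hB.isRefl hS hp
      exact h k V B _ hB ((nondegSub_hypCompl_iff hB.isRefl hS hp).2 hU) (by omega)
    have hW : ∀ W ∈ (Set.toFinite (nondegSubs B Set.univ U (2 * r + 2))).toFinset,
        ((hypPairs B Set.univ W).ncard : ℚ) =
          ((Nat.card k : ℚ) ^ (2 * r + 2) - 1) * (Nat.card k : ℚ) ^ (2 * r + 2) / Nat.card k := by
      intro W hW
      rw [Set.Finite.mem_toFinset] at hW
      rw [eq_div_iff (by positivity), ← hpow]
      have := card_hypPairs_univ hW.2.2
      rw [hW.2.1] at this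
      exact_mod_cast this
    have hUc : ((hypPairs B Set.univ U).ncard : ℚ) =
          ((Nat.card k : ℚ) ^ (n' + 2) - 1) * (Nat.card k : ℚ) ^ (n' + 2) / Nat.card k := by
      rw [eq_div_iff (by positivity), ← hpow]
      have := card_hypPairs_univ hU
      rw [hn] at this
      exact_mod_cast this
    rw [Finset.sum_congr rfl hW, Finset.sum_const, nsmul_eq_mul] at hsum
    rw [Finset.sum_congr rfl hp, Finset.sum_const, nsmul_eq_mul,
      ← Set.ncard_eq_toFinset_card (hypPairs B Set.univ U) (Set.toFinite _), hUc] at hsum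
    obtain ⟨M, -, hM⟩ := hg
    have hg0 := (hM _ hq).1
    rw [eq_div_iff hg0]
    have hq0 : (Nat.card k : ℚ) ≠ 0 := by positivity
    field_simp at hsum
    change ((Set.toFinite (nondegSubs B Set.univ U (2 * r + 2))).toFinset.card : ℚ) * _ = _
    linear_combination hsum

/-- The number of flags of nondegenerate subspaces of given even dimensions in a symplectic space
is quasi-polynomial in `q`. -/
theorem exists_quasiPoly_symplecticFlags (L : ℕ) : ∀ (d : ℕ → ℕ) (n : ℕ),
    (∀ i, L ≤ i → d i = 0) → (∀ i, Even (d i)) → ∃ Φ : ℕ → ℤ → ℚ, QuasiPoly 0 Φ ∧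
      ∀ (k : Type u) [Field k] [Finite k] (V : Type v) [AddCommGroup V] [Module k V]
        [FiniteDimensional k V] [Finite V] (B : LinearMap.BilinForm k V) (U : Submodule k V),
        B.IsAlt → NondegSub B Set.univ U → Module.finrank k U = n →
        ((nondegFlags B Set.univ U d).ncard : ℚ) = Φ (Nat.card k) 0 := by
  induction L with
  | zero =>
    intro d n hd _
    refine ⟨_, quasiPoly_one, ?_⟩
    intro k _ _ V _ _ _ _ B U _ _ _
    rw [ncard_nondegFlags_zero _ _ _ fun i => hd i (Nat.zero_le i), Nat.cast_one]
  | succ L ih =>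
    intro d n hd hev
    obtain ⟨Φ, hΦ, hΦ'⟩ := ih (fun i => d (i + 1)) (d 0)
      (fun i hi => hd (i + 1) (by omega)) fun i => hev (i + 1)
    obtain ⟨r, hr⟩ := (hev 0).two_dvd
    obtain ⟨N, hN, hN'⟩ := exists_quasiPoly_card_symplecticSubs.{u, v} r n
    refine ⟨_, hN.mul hΦ, ?_⟩
    intro k _ _ V _ _ _ _ B U hB hU hn
    rw [ncard_nondegFlags_succ _ _ _ hd, ← hN' k V B U hB hU hn, ← hr, Nat.cast_sum,
      Finset.sum_congr rfl fun W hW => hΦ' k V B W hB (mem_subsFinset.1 hW).2.2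
        (mem_subsFinset.1 hW).2.1, Finset.sum_const, nsmul_eq_mul]

/-! ### Symplectic frames and symplectic forms -/

section SymplecticFrames

variable {k : Type*} [Field k] {V : Type*} [AddCommGroup V] [Module k V]

/-- The symplectic frames of length `r` in `U`: families of hyperbolic pairs of `U` that are
orthogonal to one another. -/
def symplecticFrames (B : LinearMap.BilinForm k V) (U : Submodule k V) (r : ℕ) :
    Set (Fin r → V × V) :=
  {v | (∀ i, v i ∈ hypPairs B Set.univ U) ∧ ∀ i j, i < j →
    B (v i).1 (v j).1 = 0 ∧ B (v i).1 (v j).2 = 0 ∧ B (v i).2 (v j).1 = 0 ∧ B (v i).2 (v j).2 = 0}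

variable {B : LinearMap.BilinForm k V} {U : Submodule k V} {r : ℕ}

theorem cons_mem_symplecticFrames {p : V × V} {v : Fin r → V × V} :
    (Fin.cons p v : Fin (r + 1) → V × V) ∈ symplecticFrames B U (r + 1) ↔
      p ∈ hypPairs B Set.univ U ∧ v ∈ symplecticFrames B (hypCompl B U p) r := by
  constructor
  · rintro ⟨h1, h2⟩
    refine ⟨h1 0, fun i => ?_, fun i j hij => by simpa using h2 i.succ j.succ (by simpa using hij)⟩
    have h3 := h1 i.succ
    have h4 := h2 0 i.succ (Fin.succ_pos i)
    simp only [Fin.cons_succ, Fin.cons_zero] at h3 h4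
    exact ⟨mem_hypCompl.2 ⟨h3.1, h4.1, h4.2.2.1⟩, mem_hypCompl.2 ⟨h3.2.1, h4.2.1, h4.2.2.2⟩,
      h3.2.2⟩
  · rintro ⟨h1, h2, h3⟩
    refine ⟨fun i => ?_, fun i j hij => ?_⟩
    · refine Fin.cases h1 (fun i => ?_) i
      simpa using hypPairs_mono hypCompl_le (h2 i)
    · induction j using Fin.cases with
      | zero => exact absurd hij (Fin.not_lt_zero i)
      | succ j =>
        have h4 := h2 j
        induction i using Fin.cases with
        | zero =>
          have e1 := mem_hypCompl.1 h4.1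
          have e2 := mem_hypCompl.1 h4.2.1
          simp only [Fin.cons_succ, Fin.cons_zero]
          exact ⟨e1.2.1, e2.2.1, e1.2.2, e2.2.2⟩
        | succ i => simpa using h3 i j (by simpa using hij)

/-- The order of the symplectic group, as the number of frames: a frame is a hyperbolic pair and a
frame of its orthogonal. -/
theorem ncard_symplecticFrames [Finite k] [FiniteDimensional k V] [Finite V] (hB : B.IsAlt)
    (r : ℕ) : ∀ U : Submodule k V, NondegSub B Set.univ U → Module.finrank k U = 2 * r →
    (symplecticFrames B U r).ncard * Nat.card k ^ r =
      ∏ i ∈ Finset.range r, (Nat.card k ^ (2 * (i + 1)) - 1) * Nat.card k ^ (2 * (i + 1)) := by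
  induction r with
  | zero =>
    intro U _ _
    have : symplecticFrames B U 0 = Set.univ :=
      Set.eq_univ_of_forall fun v => ⟨fun i => i.elim0, fun i => i.elim0⟩
    rw [this, Set.ncard_univ]
    simp
  | succ r ih =>
    intro U hU hn
    have h1 := ncard_eq_sum_fiber (symplecticFrames B U (r + 1))
      (Set.toFinite (hypPairs B Set.univ U)).toFinset (fun v => v 0)
      (fun v hv => by simpa using hv.1 0)
    have h2 : ∀ p ∈ (Set.toFinite (hypPairs B Set.univ U)).toFinset,
        {v ∈ symplecticFrames B U (r + 1) | v 0 = p}.ncard * Nat.card k ^ r =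
        ∏ i ∈ Finset.range r, (Nat.card k ^ (2 * (i + 1)) - 1) * Nat.card k ^ (2 * (i + 1)) := by
      intro p hp
      rw [Set.Finite.mem_toFinset] at hp
      have hS : ∀ x ∈ (Set.univ : Set V), B x x = 0 := fun x _ => hB x
      have h3 : {v ∈ symplecticFrames B U (r + 1) | v 0 = p} =
          (fun v => (Fin.cons p v : Fin (r + 1) → V × V)) ''
            symplecticFrames B (hypCompl B U p) r := by
        ext v
        constructor
        · rintro ⟨hv, rfl⟩
          refine ⟨Fin.tail v, ?_, Fin.cons_self_tail v⟩
          rw [← Fin.cons_self_tail v, cons_mem_symplecticFrames] at hv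
          exact hv.2
        · rintro ⟨v, hv, rfl⟩
          exact ⟨cons_mem_symplecticFrames.2 ⟨hp, hv⟩, rfl⟩
      have hinj : Set.InjOn (fun v => (Fin.cons p v : Fin (r + 1) → V × V))
          (symplecticFrames B (hypCompl B U p) r) :=
        fun v _ w _ h => Fin.cons_right_injective (α := fun _ => V × V) p h
      rw [h3, hinj.ncard_image]
      have h4 := finrank_hypCompl hB.isRefl hS hp
      exact ih _ ((nondegSub_hypCompl_iff hB.isRefl hS hp).2 hU) (by omega)
    have h5 := card_hypPairs_univ hU
    rw [hn] at h5
    rw [h1, Finset.sum_mul, pow_succ, Finset.sum_congr rfl fun p hp => by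
      rw [← mul_assoc, h2 p hp], Finset.sum_const, ← Set.ncard_eq_toFinset_card, smul_eq_mul,
      Finset.prod_range_succ, ← h5]
    ring

/-- The form for which the basis is a symplectic frame. -/
def basisForm (b : Module.Basis (Fin r ⊕ Fin r) k V) : LinearMap.BilinForm k V :=
  ∑ i, (LinearMap.BilinForm.linMulLin (b.coord (Sum.inl i)) (b.coord (Sum.inr i)) -
    LinearMap.BilinForm.linMulLin (b.coord (Sum.inr i)) (b.coord (Sum.inl i)))

theorem basisForm_apply (b : Module.Basis (Fin r ⊕ Fin r) k V) (x y : V) :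
    basisForm b x y = ∑ i, (b.repr x (Sum.inl i) * b.repr y (Sum.inr i) -
      b.repr x (Sum.inr i) * b.repr y (Sum.inl i)) := by
  simp [basisForm, LinearMap.sum_apply]

theorem basisForm_isAlt (b : Module.Basis (Fin r ⊕ Fin r) k V) : (basisForm b).IsAlt := fun x => by
  rw [basisForm_apply]
  exact Finset.sum_eq_zero fun i _ => by ring

theorem basisForm_nondeg (b : Module.Basis (Fin r ⊕ Fin r) k V) :
    NondegSub (basisForm b) Set.univ ⊤ := by
  intro x _ _ hx
  refine b.repr.map_eq_zero_iff.1 (Finsupp.ext fun i => ?_)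
  rcases i with i | i
  · have := hx (b (Sum.inr i)) trivial
    rw [basisForm_apply] at this
    simpa [Finsupp.single_apply] using this
  · have := hx (b (Sum.inl i)) trivial
    rw [basisForm_apply] at this
    simpa [Finsupp.single_apply] using this

theorem gram_of_mem_symplecticFrames (hB : B.IsAlt) {v : Fin r → V × V}
    (hv : v ∈ symplecticFrames B U r) (i j : Fin r) :
    B (v i).1 (v j).1 = 0 ∧ B (v i).2 (v j).2 = 0 ∧
      B (v i).1 (v j).2 = (if i = j then 1 else 0) ∧
      B (v i).2 (v j).1 = -(if i = j then 1 else 0) := by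
  rcases lt_trichotomy i j with h | rfl | h
  · obtain ⟨h1, h2, h3, h4⟩ := hv.2 i j h
    simp [h1, h2, h3, h4, h.ne]
  · have h5 : B (v i).1 (v i).2 = 1 := (hv.1 i).2.2.2.2
    refine ⟨hB _, hB _, by simp [h5], ?_⟩
    rw [← hB.neg_eq, h5]
    simp
  · obtain ⟨h1, h2, h3, h4⟩ := hv.2 j i h
    refine ⟨?_, ?_, ?_, ?_⟩ <;> rw [← hB.neg_eq] <;> simp [h1, h2, h3, h4, h.ne']

theorem linearIndependent_of_mem_symplecticFrames (hB : B.IsAlt) {v : Fin r → V × V}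
    (hv : v ∈ symplecticFrames B U r) :
    LinearIndependent k (Sum.elim (fun i => (v i).1) (fun i => (v i).2)) := by
  rw [Fintype.linearIndependent_iff]
  intro g hg
  rw [Fintype.sum_sum_type] at hg
  simp only [Sum.elim_inl, Sum.elim_inr] at hg
  have hgram := gram_of_mem_symplecticFrames hB hv
  rintro (j | j)
  · have := congrArg (B (v j).2) hg
    simpa [hgram] using this
  · have := congrArg (B (v j).1) hg
    simpa [hgram] using this

/-- The nondegenerate alternating forms on `V`. -/
def symplecticForms (k V : Type*) [Field k] [AddCommGroup V] [Module k V] :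
    Set (LinearMap.BilinForm k V) := {ω | ω.IsAlt ∧ NondegSub ω Set.univ ⊤}

instance finite_linearMap {k M N : Type*} [Field k] [AddCommGroup M] [Module k M]
    [AddCommGroup N] [Module k N] [Finite M] [Finite N] : Finite (M →ₗ[k] N) :=
  Finite.of_injective (fun f : M →ₗ[k] N => (f : M → N)) DFunLike.coe_injective

/-- Counting the pairs of a symplectic form and a symplectic frame for it, which are the same as
the bases of `V`. -/
theorem card_symplecticForms [Finite k] [FiniteDimensional k V] [Finite V]
    (hn : Module.finrank k V = 2 * r) :
    (symplecticForms k V).ncard *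
        ∏ i ∈ Finset.range r, (Nat.card k ^ (2 * (i + 1)) - 1) * Nat.card k ^ (2 * (i + 1)) =
      Nat.card k ^ r * ∏ i ∈ Finset.range (2 * r), (Nat.card k ^ (2 * r) - Nat.card k ^ i) := by
  have := Fintype.ofFinite k
  have hcard := card_linearIndependent (K := k) (V := V) (k := 2 * r) hn.ge
  rw [hn, ← Nat.card_eq_fintype_card, Fin.prod_univ_eq_prod_range
    (fun i => Nat.card k ^ (2 * r) - Nat.card k ^ i)] at hcard
  rw [← hcard]
  set T : Set (LinearMap.BilinForm k V × (Fin r → V × V)) :=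
    {p | p.1 ∈ symplecticForms k V ∧ p.2 ∈ symplecticFrames p.1 ⊤ r} with hT
  have h1 := ncard_eq_sum_fiber T (Set.toFinite (symplecticForms k V)).toFinset Prod.fst
    (fun p hp => by simpa using hp.1)
  have h2 : ∀ ω ∈ (Set.toFinite (symplecticForms k V)).toFinset,
      {p ∈ T | p.1 = ω}.ncard * Nat.card k ^ r =
      ∏ i ∈ Finset.range r, (Nat.card k ^ (2 * (i + 1)) - 1) * Nat.card k ^ (2 * (i + 1)) := by
    intro ω hω
    rw [Set.Finite.mem_toFinset] at hω
    have h3 : {p ∈ T | p.1 = ω} = (fun v => (ω, v)) '' symplecticFrames ω ⊤ r := by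
      ext ⟨ω', v⟩
      constructor
      · rintro ⟨⟨-, h⟩, rfl⟩
        exact ⟨v, h, rfl⟩
      · rintro ⟨v, h, h'⟩
        obtain ⟨rfl, rfl⟩ := Prod.mk.inj h'
        exact ⟨⟨hω, h⟩, rfl⟩
    rw [h3, Set.InjOn.ncard_image fun v _ w _ h => (Prod.mk.inj h).2]
    exact ncard_symplecticFrames hω.1 r ⊤ hω.2 (by rw [finrank_top, hn])
  have h4 : T.ncard = Nat.card {s : Fin (2 * r) → V // LinearIndependent k s} := by
    let e : Fin r ⊕ Fin r ≃ Fin (2 * r) := finSumFinEquiv.trans (finCongr (two_mul r).symm)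
    refine Set.ncard_congr' (Equiv.ofBijective (fun p : T => ⟨Sum.elim (fun i => (p.1.2 i).1)
      (fun i => (p.1.2 i).2) ∘ e.symm, (linearIndependent_equiv e.symm).2
        (linearIndependent_of_mem_symplecticFrames p.2.1.1 p.2.2)⟩) ⟨?_, ?_⟩)
    · rintro ⟨⟨ω, v⟩, hω, hv⟩ ⟨⟨ω', v'⟩, hω', hv'⟩ h
      have h5 : Sum.elim (fun i => (v i).1) (fun i => (v i).2) =
          Sum.elim (fun i => (v' i).1) (fun i => (v' i).2) :=
        e.symm.surjective.injective_comp_right (Subtype.ext_iff.1 h)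
      have h6 : v = v' := funext fun i =>
        Prod.ext (congrFun h5 (Sum.inl i)) (congrFun h5 (Sum.inr i))
      subst h6
      have hli := linearIndependent_of_mem_symplecticFrames hω.1 hv
      let b := Module.Basis.mk hli (hli.span_eq_top_of_card_eq_finrank' (by simp [hn, two_mul])).ge
      have h7 : ω = ω' := by
        refine LinearMap.BilinForm.ext_basis b fun i j => ?_
        have g1 := gram_of_mem_symplecticFrames hω.1 hv
        have g2 := gram_of_mem_symplecticFrames hω'.1 hv'
        rcases i with i | i <;> rcases j with j | j <;> simp [b, g1, g2]
      subst h7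
      rfl
    · rintro ⟨s, hs⟩
      have hli : LinearIndependent k (s ∘ e) := (linearIndependent_equiv e).2 hs
      let b := Module.Basis.mk hli (hli.span_eq_top_of_card_eq_finrank' (by simp [hn, two_mul])).ge
      have hb : ∀ i, b i = s (e i) := fun i => by simp [b]
      refine ⟨⟨(basisForm b, fun i => (b (Sum.inl i), b (Sum.inr i))),
        ⟨basisForm_isAlt b, basisForm_nondeg b⟩, fun i => ⟨trivial, trivial, trivial, trivial, ?_⟩,
        fun i j hij => ?_⟩, ?_⟩
      · simp [basisForm_apply, Finsupp.single_apply]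
      · simp [basisForm_apply, Finsupp.single_apply, hij.ne]
      · apply Subtype.ext
        funext x
        obtain ⟨y, rfl⟩ := e.surjective x
        rcases y with y | y <;> simp [hb]
  rw [← h4, h1, Finset.mul_sum, Finset.sum_congr rfl fun ω hω => by rw [mul_comm, h2 ω hω],
    Finset.sum_const, ← Set.ncard_eq_toFinset_card, smul_eq_mul]

theorem isMonicValue_prod {ι : Type*} (s : Finset ι) (g : ι → ℕ → ℚ)
    (h : ∀ i ∈ s, IsMonicValue (g i)) : IsMonicValue fun q => ∏ i ∈ s, g i q := by
  classical
  induction s using Finset.induction_on with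
  | empty => simpa using isMonicValue_pow 0
  | insert i s hi ih =>
    simp only [Finset.prod_insert hi]
    exact (h i (Finset.mem_insert_self i s)).mul
      (ih fun j hj => h j (Finset.mem_insert_of_mem hj))

theorem quasiPoly_prod {c : ℤ} {ι : Type*} (s : Finset ι) (Φ : ι → ℕ → ℤ → ℚ)
    (h : ∀ i ∈ s, QuasiPoly c (Φ i)) : QuasiPoly c fun q ε => ∏ i ∈ s, Φ i q ε := by
  classical
  induction s using Finset.induction_on with
  | empty => simpa using quasiPoly_one
  | insert i s hi ih =>
    simp only [Finset.prod_insert hi]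
    exact (h i (Finset.mem_insert_self i s)).mul
      (ih fun j hj => h j (Finset.mem_insert_of_mem hj))

end SymplecticFrames

/-- The pairs of a symplectic form on `V` and a flag of nondegenerate subspaces for it. -/
def symplecticFlagPairs (k V : Type*) [Field k] [AddCommGroup V] [Module k V] (d : ℕ → ℕ) :
    Set (LinearMap.BilinForm k V × (ℕ → Submodule k V)) :=
  {p | p.1 ∈ symplecticForms k V ∧ p.2 ∈ nondegFlags p.1 Set.univ ⊤ d}

/-- The number of pairs of a symplectic form on a space of given even dimension and a flag of
nondegenerate subspaces for it is quasi-polynomial in `q`. -/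
theorem exists_quasiPoly_symplecticFlagPairs (L : ℕ) (d : ℕ → ℕ) (n : ℕ)
    (hd : ∀ i, L ≤ i → d i = 0) (hev : ∀ i, Even (d i)) (hn : Even n) :
    ∃ Φ : ℕ → ℤ → ℚ, QuasiPoly 0 Φ ∧
      ∀ (k : Type u) [Field k] [Finite k] (V : Type v) [AddCommGroup V] [Module k V]
        [FiniteDimensional k V] [Finite V], Module.finrank k V = n →
        ((symplecticFlagPairs k V d).ncard : ℚ) = Φ (Nat.card k) 0 := by
  obtain ⟨r, rfl⟩ := hn.two_dvd
  obtain ⟨Φ, hΦ, hΦ'⟩ := exists_quasiPoly_symplecticFlags.{u, v} L d (2 * r) hd hev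
  have hg : IsMonicValue fun q => ∏ i ∈ Finset.range r,
      ((q : ℚ) ^ (2 * (i + 1)) - 1) * (q : ℚ) ^ (2 * (i + 1)) :=
    isMonicValue_prod _ (fun i q => ((q : ℚ) ^ (2 * (i + 1)) - 1) * (q : ℚ) ^ (2 * (i + 1)))
      fun i _ => (isMonicValue_pow_sub_one (by omega)).mul (isMonicValue_pow _)
  have hA : QuasiPoly 0 fun q _ => ((q : ℚ) ^ r * ∏ i ∈ Finset.range (2 * r),
      ((q : ℚ) ^ (2 * r) - (q : ℚ) ^ i)) / ∏ i ∈ Finset.range r,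
      ((q : ℚ) ^ (2 * (i + 1)) - 1) * (q : ℚ) ^ (2 * (i + 1)) :=
    ((quasiPoly_pow r).mul (quasiPoly_prod _ (fun i q _ => (q : ℚ) ^ (2 * r) - (q : ℚ) ^ i)
      fun i _ => (quasiPoly_pow _).sub (quasiPoly_pow _))).div hg
  refine ⟨_, hA.mul hΦ, ?_⟩
  intro k _ _ V _ _ _ _ hn
  have hq := two_le_natCard k
  have hcount : ((symplecticFlagPairs k V d).ncard : ℚ) =
      (symplecticForms k V).ncard * Φ (Nat.card k) 0 := by
    have hfin : (symplecticFlagPairs k V d).Finite := by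
      refine Set.Finite.subset (Set.Finite.biUnion (Set.toFinite (symplecticForms k V))
        fun ω _ => (Set.toFinite {ω}).prod (finite_nondegFlags ω Set.univ ⊤ hd)) ?_
      rintro ⟨ω, F⟩ ⟨hω, hF⟩
      exact Set.mem_biUnion hω ⟨rfl, hF⟩
    classical
    rw [Set.ncard_eq_toFinset_card _ hfin, Finset.card_eq_sum_card_fiberwise (f := Prod.fst)
      (t := (Set.toFinite (symplecticForms k V)).toFinset)
      (fun p hp => by simpa using (show p ∈ symplecticFlagPairs k V d by simpa using hp).1)]
    push_cast
    rw [Finset.sum_congr rfl fun ω hω => ?_, Finset.sum_const,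
      ← Set.ncard_eq_toFinset_card _ (Set.toFinite _), nsmul_eq_mul]
    rw [Set.Finite.mem_toFinset] at hω
    rw [← hΦ' k V ω ⊤ hω.1 hω.2 (by rw [finrank_top, hn]), ← Set.ncard_coe_finset]
    congr 1
    have : (({p ∈ hfin.toFinset | p.1 = ω} : Finset _) : Set _) =
        (fun F => (ω, F)) '' nondegFlags ω Set.univ ⊤ d := by
      ext ⟨ω', F⟩
      simp only [Finset.coe_filter, Set.Finite.mem_toFinset, Set.mem_ofPred_eq, Set.mem_image,
        Prod.mk.injEq]
      constructor
      · rintro ⟨h, rfl⟩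
        exact ⟨F, h.2, rfl, rfl⟩
      · rintro ⟨F, h, rfl, rfl⟩
        exact ⟨⟨hω, h⟩, rfl⟩
    rw [this, Set.InjOn.ncard_image fun v _ w _ h => (Prod.mk.inj h).2]
  obtain ⟨M, -, hM⟩ := hg
  have hg0 := (hM _ hq).1
  rw [hcount]
  congr 1
  rw [eq_div_iff hg0]
  have h := congrArg (Nat.cast : ℕ → ℚ) (card_symplecticForms (k := k) (V := V) hn)
  push_cast at h
  have e1 : ∀ i ∈ Finset.range r, ((Nat.card k ^ (2 * (i + 1)) - 1 : ℕ) : ℚ) *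
      (Nat.card k : ℚ) ^ (2 * (i + 1)) =
      ((Nat.card k : ℚ) ^ (2 * (i + 1)) - 1) * (Nat.card k : ℚ) ^ (2 * (i + 1)) := fun i _ => by
    rw [Nat.cast_sub (Nat.one_le_pow _ _ (by omega))]
    push_cast
    ring
  have e2 : ∀ i ∈ Finset.range (2 * r), ((Nat.card k ^ (2 * r) - Nat.card k ^ i : ℕ) : ℚ) =
      (Nat.card k : ℚ) ^ (2 * r) - (Nat.card k : ℚ) ^ i := fun i hi => by
    rw [Nat.cast_sub (Nat.pow_le_pow_right (by omega) (Finset.mem_range.1 hi).le)]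
    push_cast
    ring
  rw [Finset.prod_congr rfl e1, Finset.prod_congr rfl e2] at h
  exact h

/-! ### Quadratic spaces of every dimension and sign -/

section Models

variable {k : Type*} [Field k] {N W : Type*} [AddCommGroup N] [Module k N] [AddCommGroup W]
  [Module k W] {Q₀ : QuadraticForm k W}

theorem polar_dualProd (x y : Module.Dual k N × N) :
    QuadraticMap.polar (QuadraticForm.dualProd k N) x y = x.1 y.2 + y.1 x.2 := by
  simp [QuadraticMap.polar]
  ring

/-- The sum of a hyperbolic space and an anisotropic one is nondegenerate. -/
theorem isNondeg_dualProd_prod (h₀ : Q₀.Anisotropic) :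
    IsNondeg ((QuadraticForm.dualProd k N).prod Q₀) := by
  rw [isNondeg_iff]
  rintro ⟨⟨f, u⟩, w⟩ hx hxy
  have hf : f = 0 := LinearMap.ext fun v => by
    simpa [polar_dualProd] using hxy ((0, v), 0)
  have hu : u = 0 := by
    rw [← Module.forall_dual_apply_eq_zero_iff k]
    intro g
    simpa [polar_dualProd] using hxy ((g, 0), 0)
  subst hf hu
  have hw : w = 0 := h₀ _ (by simpa using hx)
  rw [hw]
  rfl

/-- The totally singular subspaces of the sum of a hyperbolic space `N* × N` and an anisotropic
space have dimension at most `dim N`: the kernel of the projection to `N` consists of functionals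
that vanish on its image. -/
theorem finrank_le_of_dualProd_prod [FiniteDimensional k N] {E : Type*} [AddCommGroup E]
    [Module k E] [FiniteDimensional k E] (h₀ : Q₀.Anisotropic)
    (e : E ≃ₗ[k] (Module.Dual k N × N) × W) (L : Submodule k E)
    (hL : ∀ x ∈ L, (QuadraticForm.dualProd k N).prod Q₀ (e x) = 0) :
    Module.finrank k L ≤ Module.finrank k N := by
  set φ : L →ₗ[k] N :=
    LinearMap.snd k _ _ ∘ₗ LinearMap.fst k _ _ ∘ₗ e.toLinearMap ∘ₗ L.subtype with hφ
  have hker : ∀ x : LinearMap.ker φ, (e x).1.2 = 0 ∧ (e x).2 = 0 := by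
    intro x
    have hu : (e x).1.2 = 0 := x.2
    have h := hL _ x.1.2
    rw [QuadraticMap.prod_apply, QuadraticForm.dualProd_apply, hu, map_zero, zero_add] at h
    exact ⟨hu, h₀ _ h⟩
  have hann : ∀ x : LinearMap.ker φ, (e x).1.1 ∈ (LinearMap.range φ).dualAnnihilator := by
    intro x
    rw [Submodule.mem_dualAnnihilator]
    rintro _ ⟨y, rfl⟩
    have h := hL _ (x.1 + y).2
    have h2 := hL _ y.2
    obtain ⟨h3, h4⟩ := hker x
    simp only [Submodule.coe_add, map_add, QuadraticMap.prod_apply, QuadraticForm.dualProd_apply,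
      Prod.fst_add, Prod.snd_add, h3, h4, zero_add, LinearMap.add_apply] at h h2
    change (e x).1.1 (e y).1.2 = 0
    linear_combination h - h2
  let ψ : LinearMap.ker φ →ₗ[k] (LinearMap.range φ).dualAnnihilator :=
    LinearMap.codRestrict _ (LinearMap.fst k _ _ ∘ₗ LinearMap.fst k _ _ ∘ₗ e.toLinearMap ∘ₗ
      L.subtype ∘ₗ (LinearMap.ker φ).subtype) hann
  have hψ : Function.Injective ψ := by
    refine (injective_iff_map_eq_zero ψ).2 fun x hx => ?_
    obtain ⟨h3, h4⟩ := hker x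
    have h5 : e x = 0 := Prod.ext (Prod.ext (congrArg Subtype.val hx) h3) h4
    exact Subtype.ext (Subtype.ext (e.map_eq_zero_iff.1 h5))
  have h1 := LinearMap.finrank_le_finrank_of_injective hψ
  have h2 := LinearMap.finrank_range_add_finrank_ker φ
  have h3 := Subspace.finrank_add_finrank_dualAnnihilator_eq (LinearMap.range φ)
  omega

theorem anisotropic_sq : (QuadraticMap.sq : QuadraticForm k k).Anisotropic := fun x hx => by
  simpa using hx

/-- The form `x ^ 2 + y ^ 2` is anisotropic when `-1` is not a square. -/
theorem anisotropic_sq_prod_sq (h : ¬ IsSquare (-1 : k)) :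
    ((QuadraticMap.sq : QuadraticForm k k).prod QuadraticMap.sq).Anisotropic := by
  rintro ⟨x, y⟩ hxy
  simp only [QuadraticMap.prod_apply, QuadraticMap.sq_apply] at hxy
  have hy : y = 0 := by
    by_contra hy
    exact h ⟨x / y, by field_simp; linear_combination -hxy⟩
  subst hy
  simpa using hxy

end Models

section Existence

/-- Quadratic forms of every dimension and sign exist over arbitrarily large finite fields, in any
universe; for the sign `-1` the primes that are `3` modulo `4` are used. -/
theorem exists_quadraticForm (n M : ℕ) (ε : ℤ) (hε : ε = 1 ∨ ε = -1) (hn : ε = -1 → n ≠ 0) :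
    ∃ (k : Type u) (_ : Field k) (_ : Finite k) (V : Type v) (_ : AddCommGroup V) (_ : Module k V)
      (_ : FiniteDimensional k V) (Q : QuadraticForm k V), M ≤ Nat.card k ∧ IsNondeg Q ∧
        Module.finrank k V = n ∧ (Even n → wittSign Q = ε) := by
  obtain ⟨p, hpM, hp, hp3⟩ := Nat.forall_exists_prime_gt_and_modEq M (q := 4) (a := 3)
    (by norm_num) (by norm_num)
  have : Fact p.Prime := ⟨hp⟩
  have hsq : ¬ IsSquare (-1 : ULift.{u} (ZMod p)) := fun h => by
    have h2 : IsSquare (-1 : ZMod p) := by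
      simpa using h.map (ULift.ringEquiv : ULift.{u} (ZMod p) ≃+* ZMod p)
    exact ZMod.exists_sq_eq_neg_one_iff.1 h2 hp3
  -- It is enough to find an anisotropic form on a space `W` whose dimension accounts for `ε`.
  suffices H : ∀ (W : Type u) [AddCommGroup W] [Module (ULift.{u} (ZMod p)) W]
      [FiniteDimensional (ULift.{u} (ZMod p)) W]
      (Q₀ : QuadraticForm (ULift.{u} (ZMod p)) W), Q₀.Anisotropic → ∀ r : ℕ,
      n = 2 * r + Module.finrank (ULift.{u} (ZMod p)) W →
      (Even n → (Module.finrank (ULift.{u} (ZMod p)) W = 0 ↔ ε = 1)) →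
      ∃ (k : Type u) (_ : Field k) (_ : Finite k) (V : Type v) (_ : AddCommGroup V)
      (_ : Module k V) (_ : FiniteDimensional k V) (Q : QuadraticForm k V), M ≤ Nat.card k ∧
        IsNondeg Q ∧ Module.finrank k V = n ∧ (Even n → wittSign Q = ε) by
    rcases Nat.even_or_odd' n with ⟨r, rfl | rfl⟩
    · rcases hε with rfl | rfl
      · have h0 : Module.finrank (ULift.{u} (ZMod p)) PUnit.{u + 1} = 0 :=
          Module.finrank_zero_of_subsingleton
        exact H PUnit 0 (fun x _ => rfl) r (by rw [h0, add_zero]) (by simp [h0])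
      · obtain ⟨s, rfl⟩ := Nat.exists_eq_succ_of_ne_zero (n := r) (by
          rintro rfl
          exact hn rfl rfl)
        exact H _ _ (anisotropic_sq_prod_sq hsq) s (by simp; ring) (by simp)
    · refine H _ _ anisotropic_sq r (by simp) fun h => ?_
      exact absurd h (by simp)
  intro W _ _ _ Q₀ h₀ r hr hW
  let K := ULift.{u} (ZMod p)
  have : Finite W := Module.finite_of_finite K
  let E := (Module.Dual K (Fin r → K) × (Fin r → K)) × W
  have : Finite E := Module.finite_of_finite K
  let Q : QuadraticForm K E := (QuadraticForm.dualProd K (Fin r → K)).prod Q₀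
  have hE : Module.finrank K E = n := by
    simp only [E, Module.finrank_prod, Subspace.dual_finrank_eq, Module.finrank_fin_fun, hr]
    ring
  let e : Shrink.{v} E ≃ₗ[K] E := (equivShrink.{v} E).symm.linearEquiv K
  have hn' : Module.finrank K (Shrink.{v} E) = n := by rw [← hE, e.finrank_eq]
  have hfin : Module.Finite K (Shrink.{v} E) := Module.Finite.equiv e.symm
  refine ⟨K, inferInstance, inferInstance, Shrink.{v} E, inferInstance, inferInstance,
    hfin, Q.comp (e : Shrink.{v} E →ₗ[K] E), ?_, ?_, hn', fun hev => ?_⟩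
  · simp only [K, Nat.card_ulift, Nat.card_zmod]
    exact hpM.le
  · have h := (isNondeg_iff Q).1 (isNondeg_dualProd_prod h₀)
    refine (isNondeg_iff _).2 fun x hx hxy => ?_
    refine e.map_eq_zero_iff.1 (h _ hx fun y => ?_)
    simpa [QuadraticMap.polar] using hxy (e.symm y)
  · have key : (∃ L : Submodule K (Shrink.{v} E), 2 * Module.finrank K L =
        Module.finrank K (Shrink.{v} E) ∧ ∀ x ∈ L, Q.comp e x = 0) ↔ ε = 1 := by
      rw [← hW hev, hn']
      constructor
      · rintro ⟨L, hL1, hL2⟩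
        have h : Module.finrank K L ≤ Module.finrank K (Fin r → K) :=
          finrank_le_of_dualProd_prod h₀ e L hL2
        rw [Module.finrank_fin_fun] at h
        change Module.finrank K W = 0
        have hr' : n = 2 * r + Module.finrank K W := hr
        omega
      · intro h0
        let j : (Fin r → K) →ₗ[K] Shrink.{v} E := (e.symm : E →ₗ[K] Shrink.{v} E) ∘ₗ
          LinearMap.inl K _ W ∘ₗ LinearMap.inr K (Module.Dual K (Fin r → K)) (Fin r → K)
        have hj : Function.Injective j := e.symm.injective.comp
          (LinearMap.inl_injective.comp LinearMap.inr_injective)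
        refine ⟨LinearMap.range j, ?_, ?_⟩
        · rw [LinearMap.finrank_range_of_inj hj, Module.finrank_fin_fun]
          omega
        · rintro _ ⟨x, rfl⟩
          have h1 : e (j x) = ((0, x), 0) := e.apply_symm_apply _
          change Q (e (j x)) = 0
          rw [h1, QuadraticMap.prod_apply, QuadraticMap.map_zero, add_zero]
          rfl
    rw [wittSign]
    by_cases h : ε = 1
    · rw [if_pos (key.2 h), h]
    · rw [if_neg (fun h' => h (key.1 h'))]
      exact (hε.resolve_left h).symm

/-- The number of flags of nondegenerate subspaces of given dimensions of a nondegenerate quadratic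
space is a polynomial in `q`, which depends only on the dimension and the sign of the space. -/
theorem exists_polynomial_card_quadFlags (L : ℕ) (d : ℕ → ℕ) (n : ℕ) (hd : ∀ i, L ≤ i → d i = 0)
    (ε : ℤ) (hε : ε = 1 ∨ ε = -1) : ∃ P : Polynomial ℤ,
      ∀ (k : Type u) [Field k] [Finite k] (V : Type v) [AddCommGroup V] [Module k V]
        [FiniteDimensional k V] (Q : QuadraticForm k V), IsNondeg Q → Module.finrank k V = n →
        (Even n → wittSign Q = ε) →
        ((nondegFlags Q.polarBilin {x | Q x = 0} ⊤ d).ncard : ℤ) = P.eval (Nat.card k : ℤ) := by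
  obtain ⟨Φ, hΦ, hΦ'⟩ := exists_quasiPoly_quadFlags.{u, v} L d n hd
  set ε' : ℤ := if Even n then ε else 0 with hε'
  have hval : ∀ (k : Type u) [Field k] [Finite k] (V : Type v) [AddCommGroup V] [Module k V]
      [FiniteDimensional k V] (Q : QuadraticForm k V), IsNondeg Q → Module.finrank k V = n →
      (Even n → wittSign Q = ε) →
      ((nondegFlags Q.polarBilin {x | Q x = 0} ⊤ d).ncard : ℚ) = Φ (Nat.card k) ε' := by
    intro k _ _ V _ _ _ Q hQ hn hs
    have : Finite V := Module.finite_of_finite k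
    have e : sgn Q ⊤ = ε' := by
      rw [hε']
      split_ifs with hev
      · rw [sgn_top Q (by rwa [hn]), hs hev]
      · rw [sgn, finrank_top, hn, if_neg hev]
    rw [hΦ' k V Q ⊤ ((isNondeg_iff_top Q).1 hQ) (by rw [finrank_top, hn]), e]
  by_cases h0 : ε = -1 ∧ n = 0
  · refine ⟨0, fun k _ _ V _ _ _ Q _ hn hs => ?_⟩
    -- A space of dimension `0` has sign `1`.
    exfalso
    have h1 := hs (by simp [h0.2])
    rw [wittSign, if_pos ⟨⊥, by rw [hn, h0.2, finrank_bot], fun x hx => by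
      rw [(Submodule.mem_bot k).1 hx, QuadraticMap.map_zero]⟩, h0.1] at h1
    norm_num at h1
  · obtain ⟨P, hP⟩ := hΦ.exists_polynomial (ε := ε') (by
      rw [hε', signSq]
      split_ifs
      · rcases hε with rfl | rfl <;> norm_num
      · norm_num) (fun M => by
      obtain ⟨k, _, _, V, _, _, _, Q, h1, h2, h3, h4⟩ := exists_quadraticForm.{u, v} n M ε hε
        (fun h h' => h0 ⟨h, h'⟩)
      exact ⟨Nat.card k, h1, two_le_natCard k, _, by
        rw [← hval k V Q h2 h3 h4]
        exact (Int.cast_natCast _).symm⟩)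
    refine ⟨P, fun k _ _ V _ _ _ Q hQ hn hs => ?_⟩
    have h := hval k V Q hQ hn hs
    rw [hP _ (two_le_natCard k)] at h
    exact_mod_cast h

/-- The number of pairs of a symplectic form and a flag of nondegenerate subspaces of given
dimensions is a polynomial in `q`. -/
theorem exists_polynomial_card_symplecticFlagPairs (L : ℕ) (d : ℕ → ℕ) (n : ℕ)
    (hd : ∀ i, L ≤ i → d i = 0) (hev : ∀ i, Even (d i)) (hn : Even n) : ∃ P : Polynomial ℤ,
      ∀ (k : Type u) [Field k] [Finite k] (V : Type v) [AddCommGroup V] [Module k V]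
        [FiniteDimensional k V], Module.finrank k V = n →
        ((symplecticFlagPairs k V d).ncard : ℤ) = P.eval (Nat.card k : ℤ) := by
  obtain ⟨Φ, hΦ, hΦ'⟩ := exists_quasiPoly_symplecticFlagPairs.{u, v} L d n hd hev hn
  obtain ⟨P, hP⟩ := hΦ.exists_polynomial (ε := 0) (by norm_num) (fun M => by
    obtain ⟨k, _, _, V, _, _, _, Q, h1, h2, h3, h4⟩ := exists_quadraticForm.{u, v} n M 1 (Or.inl rfl)
      (by norm_num)
    have : Finite V := Module.finite_of_finite k
    exact ⟨Nat.card k, h1, two_le_natCard k, _, by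
      rw [← hΦ' k V h3]
      exact (Int.cast_natCast _).symm⟩)
  refine ⟨P, fun k _ _ V _ _ _ hn => ?_⟩
  have : Finite V := Module.finite_of_finite k
  have h := hΦ' k V hn
  rw [hP _ (two_le_natCard k)] at h
  exact_mod_cast h

end Existence

/-! ### The pairing of opposite graded pieces -/

namespace QFiltration

section Pairing

variable {k : Type u} [Field k] {V : Type v} [AddCommGroup V] [Module k V]
  {Q : QuadraticForm k V} (X : QFiltration Q)

theorem antitone_ge : Antitone X.ge := antitone_int_of_succ_le X.ge_succ_le

theorem ge_le_ge {a b : ℤ} (h : a ≤ b) : X.ge b ≤ X.ge a := X.antitone_ge h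

theorem polar_eq_zero_of_one_le {a b : ℤ} (h : 1 ≤ a + b) {x y : V} (hx : x ∈ X.ge a)
    (hy : y ∈ X.ge b) : QuadraticMap.polar Q x y = 0 :=
  X.polar_eq_zero (a := a) (b := -a) (by omega) hx (X.ge_le_ge (by omega) hy)

theorem mem_ge_of_polar {a : ℤ} (ha : 1 ≤ a) {x : V}
    (h : ∀ y ∈ X.ge a, QuadraticMap.polar Q x y = 0) : x ∈ X.ge (1 - a) := by
  rw [X.orthogonal a ha]
  intro y hy
  change QuadraticMap.polar Q y x = 0
  rw [QuadraticMap.polar_comm]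
  exact h y hy

theorem pairing_comm (a b : ℤ) (h : a + b = 0) (x : X.gr a) (y : X.gr b) :
    X.pairing a b h x y = X.pairing b a (by omega) y x := by
  obtain ⟨x, rfl⟩ := Submodule.Quotient.mk_surjective _ x
  obtain ⟨y, rfl⟩ := Submodule.Quotient.mk_surjective _ y
  simp [QuadraticMap.polar_comm]

variable [FiniteDimensional k V]

/-- For `c ≥ 1`, the orthogonal of the orthogonal of `X^{≥ c}` is the sum of `X^{≥ c}` and the
radical of `⟨,⟩`; these meet trivially, since `Q` vanishes on `X^{≥ c}`. -/
theorem exists_eq_add_of_polar (hQ : IsNondeg Q) {c : ℤ} (hc : 1 ≤ c) {x : V}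
    (h : ∀ y ∈ X.ge (1 - c), QuadraticMap.polar Q x y = 0) :
    ∃ w ∈ X.ge c, ∃ r, (∀ y, QuadraticMap.polar Q r y = 0) ∧ w + r = x := by
  have hB := polarBilin_isRefl Q
  rw [isNondeg_iff] at hQ
  set W := X.ge c with hW
  set R := LinearMap.BilinForm.orthogonal Q.polarBilin ⊤ with hR
  have hrad : ∀ r ∈ R, ∀ y, QuadraticMap.polar Q r y = 0 := fun r hr y => by
    rw [QuadraticMap.polar_comm]
    exact hr y trivial
  have hperp : LinearMap.BilinForm.orthogonal Q.polarBilin W = X.ge (1 - c) :=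
    (X.orthogonal c hc).symm
  have hWR : W ⊓ R = ⊥ := by
    rw [eq_bot_iff]
    rintro r ⟨h1, h2⟩
    exact hQ r (X.isotropic c hc r h1) (hrad r h2)
  have hRle : R ≤ X.ge (1 - c) := by
    rw [← hperp]
    exact fun r hr y _ => hr y trivial
  have h1 := LinearMap.BilinForm.finrank_add_finrank_orthogonal hB W
  have h2 := LinearMap.BilinForm.finrank_add_finrank_orthogonal hB (X.ge (1 - c))
  rw [← hR, hWR, finrank_bot, hperp] at h1
  rw [← hR, inf_eq_right.2 hRle] at h2
  have h3 := Submodule.finrank_sup_add_finrank_inf_eq W R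
  rw [hWR, finrank_bot] at h3
  have hle : W ⊔ R ≤ LinearMap.BilinForm.orthogonal Q.polarBilin (X.ge (1 - c)) := by
    refine sup_le (fun w hw y hy => ?_) fun r hr y _ => hr y trivial
    exact X.polar_eq_zero_of_one_le (by omega) hy hw
  have heq := Submodule.eq_of_le_of_finrank_eq hle (by omega)
  have hx' : x ∈ W ⊔ R := by
    rw [heq]
    intro y hy
    change QuadraticMap.polar Q y x = 0
    rw [QuadraticMap.polar_comm]
    exact h y hy
  obtain ⟨w, hw, r, hr, hwr⟩ := Submodule.mem_sup.1 hx'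
  exact ⟨w, hw, r, hrad r hr, hwr⟩

theorem finrank_ge_add (hQ : IsNondeg Q) {c : ℤ} (hc : 1 ≤ c) :
    Module.finrank k (X.ge c) + Module.finrank k (X.ge (1 - c)) = Module.finrank k V := by
  have h := LinearMap.BilinForm.finrank_add_finrank_orthogonal (polarBilin_isRefl Q) (X.ge c)
  rw [← X.orthogonal c hc] at h
  have hbot : X.ge c ⊓ LinearMap.BilinForm.orthogonal Q.polarBilin ⊤ = ⊥ := by
    rw [eq_bot_iff]
    rintro r ⟨h1, h2⟩
    refine (isNondeg_iff Q).1 hQ r (X.isotropic c hc r h1) fun y => ?_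
    rw [QuadraticMap.polar_comm]
    exact h2 y trivial
  rwa [hbot, finrank_bot, add_zero] at h

/-- The left kernel of the pairing of `X^{≥ c}` with `X^{≥ -c}` is `X^{≥ c+1}`: an element of that
kernel differs from `X^{≥ c+1}` by a radical vector of `X^{≥ c}`, which is singular and hence `0`.
-/
theorem mem_ge_add_one_of_polar (hQ : IsNondeg Q) {c : ℤ} (hc : 1 ≤ c) {x : V} (hx : x ∈ X.ge c)
    (h : ∀ y ∈ X.ge (-c), QuadraticMap.polar Q x y = 0) : x ∈ X.ge (c + 1) := by
  obtain ⟨w, hw, r, hr, rfl⟩ := X.exists_eq_add_of_polar hQ (c := c + 1) (by omega)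
    (by rwa [show 1 - (c + 1) = -c by ring])
  have hr' : r ∈ X.ge c := by simpa using Submodule.sub_mem _ hx (X.ge_succ_le c hw)
  rwa [(isNondeg_iff Q).1 hQ r (X.isotropic c hc r hr') hr, add_zero]

theorem eq_zero_of_pairing (hQ : IsNondeg Q) {a b : ℤ} (h : a + b = 0) (ha : a ≠ 0)
    {x : X.gr a} (hx : ∀ y, X.pairing a b h x y = 0) : x = 0 := by
  obtain ⟨x, rfl⟩ := Submodule.Quotient.mk_surjective _ x
  have hx' : ∀ y ∈ X.ge b, QuadraticMap.polar Q (x : V) y = 0 := fun y hy =>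
    hx (Submodule.Quotient.mk ⟨y, hy⟩)
  rw [Submodule.Quotient.mk_eq_zero]
  change (x : V) ∈ X.ge (a + 1)
  rcases lt_or_gt_of_ne ha with ha | ha
  · have := X.mem_ge_of_polar (a := b) (by omega) hx'
    rwa [show a + 1 = 1 - b by omega]
  · exact X.mem_ge_add_one_of_polar hQ ha x.2 (by rwa [show -a = b by omega])

theorem pairing_injective (hQ : IsNondeg Q) {a b : ℤ} (h : a + b = 0) (ha : a ≠ 0) :
    Function.Injective (X.pairing a b h) :=
  (injective_iff_map_eq_zero _).2 fun _ hx =>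
    X.eq_zero_of_pairing hQ h ha fun y => LinearMap.congr_fun hx y

theorem finrank_gr_eq (hQ : IsNondeg Q) {a b : ℤ} (h : a + b = 0) :
    Module.finrank k (X.gr a) = Module.finrank k (X.gr b) := by
  rcases eq_or_ne a 0 with rfl | ha
  · rw [show b = 0 by omega]
  · have h1 := LinearMap.finrank_le_finrank_of_injective (X.pairing_injective hQ h ha)
    have h2 := LinearMap.finrank_le_finrank_of_injective
      (X.pairing_injective hQ (a := b) (b := a) (by omega) (by omega))
    rw [Subspace.dual_finrank_eq] at h1 h2
    exact le_antisymm h1 h2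

/-- The pairing as an isomorphism of `gr^a` with the dual of `gr^b`, for `a + b = 0`, `a ≠ 0`. -/
def pairingEquiv (hQ : IsNondeg Q) {a b : ℤ} (h : a + b = 0) (ha : a ≠ 0) :
    X.gr a ≃ₗ[k] Module.Dual k (X.gr b) :=
  LinearEquiv.ofInjectiveOfFinrankEq (X.pairing a b h) (X.pairing_injective hQ h ha)
    ((X.finrank_gr_eq hQ h).trans (Subspace.dual_finrank_eq).symm)

@[simp] theorem pairingEquiv_apply (hQ : IsNondeg Q) {a b : ℤ} (h : a + b = 0) (ha : a ≠ 0)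
    (x : X.gr a) : X.pairingEquiv hQ h ha x = X.pairing a b h x := rfl

end Pairing

end QFiltration

/-! ### The isometries that shift the filtration, and their leading terms -/

namespace QFiltration

section Shift

variable {k : Type u} [Field k] {V : Type v} [AddCommGroup V] [Module k V]
  {Q : QuadraticForm k V} (X : QFiltration Q)

/-- The map `gr^a → gr^{a+i}` induced by an endomorphism that maps `X^{≥ b}` to `X^{≥ b+i}` for all
`b`. -/
def shiftMap (i : ℤ) (N : Module.End k V) (h : ∀ a, X.ge a ≤ (X.ge (a + i)).comap N) (a : ℤ) :
    X.gr a →ₗ[k] X.gr (a + i) :=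
  Submodule.mapQ _ _ (N.restrict (p := X.ge a) (q := X.ge (a + i)) (h a)) (by
    intro x hx
    change N (x : V) ∈ X.ge (a + i + 1)
    have e : a + i + 1 = a + 1 + i := by ring
    rw [e]
    exact h (a + 1) hx)

@[simp] theorem shiftMap_mk (i : ℤ) (N : Module.End k V)
    (h : ∀ a, X.ge a ≤ (X.ge (a + i)).comap N) (a : ℤ) (x : X.ge a) :
    X.shiftMap i N h a (Submodule.Quotient.mk x) = Submodule.Quotient.mk ⟨N x, h a x.2⟩ := rfl

variable [FiniteDimensional k V]

/-- The group of isometries `g` of `Q` such that `g - 1` maps `X^{≥ a}` to `X^{≥ a+i}` for all `a`,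
as a subgroup of the units of `End V`. -/
def isoGroup (i : ℕ) : Subgroup (Module.End k V)ˣ where
  carrier := {g | (∀ x, Q ((g : Module.End k V) x) = Q x) ∧
    ∀ a, ∀ x ∈ X.ge a, (g : Module.End k V) x - x ∈ X.ge (a + i)}
  one_mem' := ⟨fun x => rfl, fun a x _ => by simp⟩
  mul_mem' := by
    rintro g h ⟨hg, hg'⟩ ⟨hh, hh'⟩
    refine ⟨fun x => by simp [hg, hh], fun a x hx => ?_⟩
    have h1 := hh' a x hx
    have h2 := hg' (a + i) _ h1
    have h3 := X.ge_le_ge (a := a + i) (b := a + i + i) (by omega) h2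
    have h4 := Submodule.add_mem _ (Submodule.add_mem _ h3 (hg' a x hx)) h1
    have e : ((g * h : (Module.End k V)ˣ) : Module.End k V) x - x =
        (g : Module.End k V) ((h : Module.End k V) x - x) - ((h : Module.End k V) x - x) +
        ((g : Module.End k V) x - x) + ((h : Module.End k V) x - x) := by
      simp only [Units.val_mul, Module.End.mul_apply, map_sub]
      abel
    rw [e]
    exact h4
  inv_mem' := by
    rintro g ⟨hg, hg'⟩
    have hinv : ∀ x, (g : Module.End k V) (((g⁻¹ : (Module.End k V)ˣ) : Module.End k V) x) = x := fun x => by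
      rw [← Module.End.mul_apply, Units.mul_inv, Module.End.one_apply]
    have hinv' : ∀ x, ((g⁻¹ : (Module.End k V)ˣ) : Module.End k V) ((g : Module.End k V) x) = x :=
      fun x => by rw [← Module.End.mul_apply, Units.inv_mul, Module.End.one_apply]
    refine ⟨fun x => by rw [← hg, hinv], fun a x hx => ?_⟩
    have hle : (X.ge a).map (g : Module.End k V) ≤ X.ge a := by
      rintro _ ⟨y, hy, rfl⟩
      have := Submodule.add_mem _ (X.ge_le_ge (a := a) (b := a + i) (by omega) (hg' a y hy)) hy
      simpa using this
    -- A finite-dimensional subspace that `g` maps into itself is mapped onto itself.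
    have heq := Submodule.eq_of_le_of_finrank_eq hle
      (Submodule.equivMapOfInjective _ (Function.LeftInverse.injective hinv') _).finrank_eq.symm
    obtain ⟨y, hy, rfl⟩ : x ∈ (X.ge a).map (g : Module.End k V) := by rwa [heq]
    rw [hinv', ← neg_sub]
    exact Submodule.neg_mem _ (hg' a y hy)

variable {X} {i : ℕ}

theorem le_comap_of_mem_isoGroup {g : (Module.End k V)ˣ} (hg : g ∈ X.isoGroup i) (a : ℤ) :
    X.ge a ≤ (X.ge (a + i)).comap ((g : Module.End k V) - 1) := fun x hx => hg.2 a x hx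

theorem isoGroup_le {j : ℕ} (h : i ≤ j) : X.isoGroup j ≤ X.isoGroup i := fun g hg =>
  ⟨hg.1, fun a x hx => X.ge_le_ge (by omega) (hg.2 a x hx)⟩

theorem polar_map_of_mem_isoGroup {g : (Module.End k V)ˣ} (hg : g ∈ X.isoGroup i) (x y : V) :
    QuadraticMap.polar Q ((g : Module.End k V) x) ((g : Module.End k V) y) =
      QuadraticMap.polar Q x y := by
  simp only [QuadraticMap.polar, ← map_add, hg.1]

/-- The infinitesimal form of being an isometry. -/
theorem polar_sub_add_polar_sub {g : (Module.End k V)ˣ} (hg : g ∈ X.isoGroup i) (x y : V) :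
    QuadraticMap.polar Q ((g : Module.End k V) x - x) y +
      QuadraticMap.polar Q x ((g : Module.End k V) y - y) +
      QuadraticMap.polar Q ((g : Module.End k V) x - x) ((g : Module.End k V) y - y) = 0 := by
  have h := polar_map_of_mem_isoGroup hg x y
  simp only [QuadraticMap.polar_sub_left, QuadraticMap.polar_sub_right]
  linear_combination h

/-- The quadratic form of being an isometry, which carries more information in characteristic `2`.
-/
theorem map_sub_add_polar_sub {g : (Module.End k V)ˣ} (hg : g ∈ X.isoGroup i) (x : V) :
    Q ((g : Module.End k V) x - x) + QuadraticMap.polar Q x ((g : Module.End k V) x - x) = 0 := by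
  have h := QuadraticMap.map_add Q x ((g : Module.End k V) x - x)
  rw [add_sub_cancel, hg.1] at h
  linear_combination -h

/-- The leading terms of `g` in the group of isometries of shift `i`: the maps `gr^a → gr^{a+i}`
induced by `g - 1`. -/
def lead (g : X.isoGroup i) (a : ℤ) : X.gr a →ₗ[k] X.gr (a + i) :=
  X.shiftMap i ((g : (Module.End k V)ˣ) - 1) (le_comap_of_mem_isoGroup g.2) a

theorem lead_mk (g : X.isoGroup i) (a : ℤ) (x : X.ge a) :
    lead g a (Submodule.Quotient.mk x) = Submodule.Quotient.mk
      ⟨((g : (Module.End k V)ˣ) : Module.End k V) x - x, g.2.2 a x x.2⟩ := rfl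

/-- The leading terms are additive, as the product of `g - 1` and `h - 1` has shift `2 i > i`. -/
theorem lead_mul (hi : 1 ≤ i) (g h : X.isoGroup i) (a : ℤ) :
    lead (g * h) a = lead g a + lead h a := by
  refine LinearMap.ext fun x => ?_
  obtain ⟨x, rfl⟩ := Submodule.Quotient.mk_surjective _ x
  rw [LinearMap.add_apply, lead_mk, lead_mk, lead_mk, ← Submodule.Quotient.mk_add,
    Submodule.Quotient.eq]
  have h1 := g.2.2 (a + i) _ (h.2.2 a x x.2)
  have h2 := X.ge_le_ge (a := a + i + 1) (b := a + i + i) (by omega) h1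
  change _ - ((_ : V) + _) ∈ X.ge (a + i + 1)
  convert h2 using 1
  simp only [map_sub, Subgroup.coe_mul, Units.val_mul, Module.End.mul_apply]
  abel

theorem lead_one (hi : 1 ≤ i) (a : ℤ) : lead (1 : X.isoGroup i) a = 0 := by
  have := lead_mul hi (1 : X.isoGroup i) 1 a
  rwa [mul_one, left_eq_add] at this

theorem lead_eq_zero_iff (g : X.isoGroup i) (a : ℤ) : lead g a = 0 ↔
    ∀ x ∈ X.ge a, ((g : (Module.End k V)ˣ) : Module.End k V) x - x ∈ X.ge (a + i + 1) := by
  constructor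
  · intro h x hx
    have := LinearMap.congr_fun h (Submodule.Quotient.mk ⟨x, hx⟩)
    rw [lead_mk, LinearMap.zero_apply, Submodule.Quotient.mk_eq_zero] at this
    exact this
  · intro h
    refine LinearMap.ext fun x => ?_
    obtain ⟨x, rfl⟩ := Submodule.Quotient.mk_surjective _ x
    rw [lead_mk, LinearMap.zero_apply, Submodule.Quotient.mk_eq_zero]
    exact h x x.2

/-- An isometry of shift `i` has shift `i + 1` as soon as its leading terms of degree `a` with
`2 a ≤ -i` vanish: the other ones are adjoint to these. -/
theorem mem_isoGroup_succ_iff (hQ : IsNondeg Q) (hi : 1 ≤ i) (g : X.isoGroup i) :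
    (g : (Module.End k V)ˣ) ∈ X.isoGroup (i + 1) ↔ ∀ a : ℤ, 2 * a ≤ -i → lead g a = 0 := by
  constructor
  · intro h a _
    rw [lead_eq_zero_iff]
    intro x hx
    have := h.2 a x hx
    rwa [Nat.cast_add, Nat.cast_one, ← add_assoc] at this
  · intro h
    refine ⟨g.2.1, fun a x hx => ?_⟩
    rw [Nat.cast_add, Nat.cast_one, ← add_assoc]
    rcases le_or_gt (2 * a) (-i) with ha | ha
    · exact (lead_eq_zero_iff g a).1 (h a ha) x hx
    · refine X.mem_ge_add_one_of_polar hQ (by omega) (g.2.2 a x hx) fun y hy => ?_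
      have h1 := (lead_eq_zero_iff g (-(a + i))).1 (h _ (by omega)) y hy
      have h2 := polar_sub_add_polar_sub g.2 x y
      rwa [X.polar_eq_zero_of_one_le (by omega) hx h1,
        X.polar_eq_zero_of_one_le (by omega) (g.2.2 a x hx) h1, add_zero, add_zero] at h2

/-- The possible leading terms in degree `a`: there is a condition only for `2 a = -i`, when
`(x, y) ↦ ⟨x, t y⟩` has to be alternating. -/
def leadSpace (X : QFiltration Q) (i : ℕ) (a : ℤ) : Submodule k (X.gr a →ₗ[k] X.gr (a + i)) where
  carrier := {t | ∀ (h : a + (a + i) = 0) (x : X.gr a), X.pairing a (a + i) h x (t x) = 0}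
  zero_mem' := fun h x => by simp
  add_mem' := fun ha hb h x => by simp [ha h x, hb h x]
  smul_mem' := fun c t ht h x => by simp [ht h x]

/-- For `2 a = -i` the vector `(g - 1) x` has positive degree, so that it is singular and `⟨x, (g
- 1) x⟩` vanishes. -/
theorem lead_mem_leadSpace (hi : 1 ≤ i) (g : X.isoGroup i) (a : ℤ) :
    lead g a ∈ leadSpace X i a := by
  intro h x
  obtain ⟨x, rfl⟩ := Submodule.Quotient.mk_surjective _ x
  rw [lead_mk, pairing_mk]
  have h1 := map_sub_add_polar_sub g.2 x
  rwa [X.isotropic _ (by omega) _ (g.2.2 a x x.2), zero_add] at h1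

end Shift

end QFiltration

/-! ### Alternating forms -/

section Alternating

variable {k : Type*} [Field k] {M : Type*} [AddCommGroup M] [Module k M] {n : ℕ}

/-- The alternating form `e_i ∧ e_j` on a space with basis `b`, where `e` is the dual basis. -/
def wedge (b : Module.Basis (Fin n) k M) (p : Fin n × Fin n) : LinearMap.BilinForm k M :=
  LinearMap.BilinForm.linMulLin (b.coord p.1) (b.coord p.2) -
    LinearMap.BilinForm.linMulLin (b.coord p.2) (b.coord p.1)

theorem wedge_apply (b : Module.Basis (Fin n) k M) (p : Fin n × Fin n) (x y : M) :
    wedge b p x y = b.repr x p.1 * b.repr y p.2 - b.repr x p.2 * b.repr y p.1 := rfl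

theorem sum_wedge_apply (b : Module.Basis (Fin n) k M) (c : Fin n × Fin n → k) {i j : Fin n}
    (hij : i < j) : (∑ p with p.1 < p.2, c p • wedge b p) (b i) (b j) = c (i, j) := by
  simp only [LinearMap.sum_apply, LinearMap.smul_apply, wedge_apply]
  rw [Finset.sum_eq_single (i, j)]
  · simp [hij.ne, hij.ne']
  · rintro ⟨l, m⟩ hp hne
    simp only [Finset.mem_filter, Finset.mem_univ, true_and] at hp
    simp only [Module.Basis.repr_self, Finsupp.single_apply, smul_eq_mul]
    by_cases h1 : i = l
    · subst h1
      have h2 : j ≠ m := fun h => hne (by rw [h])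
      simp [h2, hp.ne]
    · by_cases h2 : i = m
      · subst h2
        simp [hij.ne', (hp.trans hij).ne', h1]
      · simp [h1, h2]
  · intro h
    exact absurd (by simpa using hij) h

theorem isAlt_sum_wedge (b : Module.Basis (Fin n) k M) (c : Fin n × Fin n → k) :
    (∑ p with p.1 < p.2, c p • wedge b p).IsAlt := fun x => by
  simp only [LinearMap.sum_apply, LinearMap.smul_apply, wedge_apply]
  exact Finset.sum_eq_zero fun p _ => by rw [mul_comm (b.repr x p.1), sub_self, smul_zero]

theorem eq_of_isAlt (b : Module.Basis (Fin n) k M) {ω ω' : LinearMap.BilinForm k M}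
    (hω : ω.IsAlt) (hω' : ω'.IsAlt) (h : ∀ i j, i < j → ω (b i) (b j) = ω' (b i) (b j)) :
    ω = ω' := by
  refine LinearMap.BilinForm.ext_basis b fun i j => ?_
  rcases lt_trichotomy i j with hij | rfl | hij
  · exact h _ _ hij
  · rw [hω, hω']
  · rw [← hω.neg_eq, ← hω'.neg_eq, h j i hij]

theorem eq_sum_wedge_of_isAlt (b : Module.Basis (Fin n) k M) {ω : LinearMap.BilinForm k M}
    (hω : ω.IsAlt) : ω = ∑ p with p.1 < p.2, ω (b p.1) (b p.2) • wedge b p :=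
  eq_of_isAlt b hω (isAlt_sum_wedge b _) fun _ _ hij =>
    (sum_wedge_apply b (fun p => ω (b p.1) (b p.2)) hij).symm

theorem card_filter_lt (n : ℕ) :
    Fintype.card {p : Fin n × Fin n // p.1 < p.2} = n * (n - 1) / 2 := by
  rw [Fintype.card_subtype, ← Finset.univ_product_univ, Finset.card_filter,
    Finset.sum_product_right]
  simp only [← Finset.card_filter]
  have : ∀ j : Fin n, (Finset.univ.filter fun i => i < j).card = j := fun j => by
    rw [Finset.filter_gt_eq_Iio, Fin.card_Iio]
  simp only [this]
  rw [Fin.sum_univ_eq_sum_range (fun i => i), Finset.sum_range_id]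

/-- An alternating form is given by its entries above the diagonal. -/
theorem card_isAlt [Finite k] [FiniteDimensional k M] :
    Nat.card {ω : LinearMap.BilinForm k M // ω.IsAlt} =
      Nat.card k ^ (Module.finrank k M * (Module.finrank k M - 1) / 2) := by
  classical
  have := Fintype.ofFinite k
  let b := Module.finBasis k M
  have e : {ω : LinearMap.BilinForm k M // ω.IsAlt} ≃
      ({p : Fin (Module.finrank k M) × Fin (Module.finrank k M) // p.1 < p.2} → k) := by
    refine Equiv.ofBijective (fun ω p => ω.1 (b p.1.1) (b p.1.2)) ⟨?_, ?_⟩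
    · intro ω ω' h
      exact Subtype.ext (eq_of_isAlt b ω.2 ω'.2 fun i j hij => congrFun h ⟨(i, j), hij⟩)
    · intro c
      refine ⟨⟨_, isAlt_sum_wedge b fun p => if h : p.1 < p.2 then c ⟨p, h⟩ else 0⟩, ?_⟩
      funext p
      simp only []
      rw [sum_wedge_apply b _ p.2, dif_pos p.2]
  rw [Nat.card_congr e, Nat.card_fun, Nat.card_eq_fintype_card (α := Subtype _), card_filter_lt]

theorem card_linearMap [Finite k] [FiniteDimensional k M] {N : Type*} [AddCommGroup N]
    [Module k N] [FiniteDimensional k N] : Nat.card (M →ₗ[k] N) =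
      Nat.card k ^ (Module.finrank k M * Module.finrank k N) := by
  rw [Module.natCard_eq_pow_finrank (K := k), Module.finrank_linearMap]

end Alternating

/-! ### Isometries with prescribed leading terms -/

namespace QFiltration

section Eichler

variable {k : Type u} [Field k] {V : Type v} [AddCommGroup V] [Module k V]
  {Q : QuadraticForm k V}

/-- The infinitesimal part of an Eichler transformation. -/
def eichler (Q : QuadraticForm k V) (u v : V) : Module.End k V :=
  (Q.polarBilin u).smulRight v - (Q.polarBilin v).smulRight u -
    Q v • (Q.polarBilin u).smulRight u

theorem eichler_apply (u v x : V) : eichler Q u v x = QuadraticMap.polar Q u x • v -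
    QuadraticMap.polar Q v x • u - Q v • QuadraticMap.polar Q u x • u := rfl

theorem isometry_eichler {u v : V} (hu : Q u = 0) (huv : QuadraticMap.polar Q u v = 0) (x : V) :
    Q ((1 + eichler Q u v) x) = Q x := by
  have huu := polar_self_of_eq_zero Q hu
  have hvv : QuadraticMap.polar Q v v = 2 * Q v := by
    rw [QuadraticMap.polar_self, two_smul, two_mul]
  set α := QuadraticMap.polar Q u x with hα
  set β := QuadraticMap.polar Q v x with hβ
  have e : (1 + eichler Q u v) x = x + (α • v + (-β - Q v * α) • u) := by
    simp only [LinearMap.add_apply, Module.End.one_apply, eichler_apply]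
    module
  rw [e, QuadraticMap.map_add Q x, QuadraticMap.map_add Q (α • v), QuadraticMap.map_smul,
    QuadraticMap.map_smul, hu, QuadraticMap.polar_add_right, QuadraticMap.polar_smul_right,
    QuadraticMap.polar_smul_right, QuadraticMap.polar_smul_left, QuadraticMap.polar_smul_right,
    QuadraticMap.polar_comm Q v u, huv, QuadraticMap.polar_comm Q x, QuadraticMap.polar_comm Q x,
    ← hα, ← hβ]
  simp only [smul_eq_mul]
  ring

variable {X : QFiltration Q} [FiniteDimensional k V] {i : ℕ}

/-- An isometric endomorphism is invertible, by the nondegeneracy of `Q`. -/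
theorem isUnit_of_isometry (hQ : IsNondeg Q) {g : Module.End k V} (hg : ∀ x, Q (g x) = Q x) :
    IsUnit g := by
  rw [LinearMap.isUnit_iff_ker_eq_bot, LinearMap.ker_eq_bot']
  intro x hx
  refine (isNondeg_iff Q).1 hQ x ?_ fun y => ?_
  · rw [← hg, hx, QuadraticMap.map_zero]
  · have h : QuadraticMap.polar Q (g x) (g y) = QuadraticMap.polar Q x y := by
      simp only [QuadraticMap.polar, ← map_add, hg]
    rw [← h, hx, QuadraticMap.polar_zero_left]

theorem exists_isoGroup (hQ : IsNondeg Q) {N : Module.End k V} (hN : ∀ x, Q ((1 + N) x) = Q x)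
    (hN' : ∀ a, ∀ x ∈ X.ge a, N x ∈ X.ge (a + i)) :
    ∃ g : X.isoGroup i, ∀ x, ((g : (Module.End k V)ˣ) : Module.End k V) x - x = N x := by
  obtain ⟨g, hg⟩ := isUnit_of_isometry hQ hN
  have h : ∀ x, (g : Module.End k V) x - x = N x := fun x => by rw [hg]; simp
  exact ⟨⟨g, by rwa [hg], fun a x hx => by rw [h]; exact hN' a x hx⟩, h⟩

/-- Eichler transformations in the group of isometries of shift `i`, and their leading terms. -/
theorem exists_eichler (hQ : IsNondeg Q) (hi : 1 ≤ i) {a c : ℤ} (hc : a + c = 0)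
    (ha : 2 * a ≤ -i) (u : X.ge c) (v : X.ge (a + i)) : ∃ g : X.isoGroup i,
      (∀ x, ((g : (Module.End k V)ˣ) : Module.End k V) x - x = eichler Q (u : V) (v : V) x) ∧
      ∀ a' : ℤ, 2 * a' ≤ -i → a' ≠ a → lead g a' = 0 := by
  have hu := X.isotropic c (by omega) u u.2
  have huv := X.polar_eq_zero_of_one_le (by omega) u.2 v.2
  have hterm : ∀ (d j : ℤ), (d ≤ a → d + j ≤ a + i) → (d + a + i ≤ 0 → d + j ≤ c) →
      ∀ x ∈ X.ge d, eichler Q (u : V) (v : V) x ∈ X.ge (d + j) := by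
    intro d j h1 h2 x hx
    rw [eichler_apply]
    have hux : QuadraticMap.polar Q (u : V) x ≠ 0 → d ≤ a := fun h => by
      by_contra hd
      exact h (X.polar_eq_zero_of_one_le (by omega) u.2 hx)
    have hvx : QuadraticMap.polar Q (v : V) x ≠ 0 → d + a + i ≤ 0 := fun h => by
      by_contra hd
      exact h (X.polar_eq_zero_of_one_le (by omega) v.2 hx)
    refine Submodule.sub_mem _ (Submodule.sub_mem _ ?_ ?_) (Submodule.smul_mem _ _ ?_)
    · by_cases h : QuadraticMap.polar Q (u : V) x = 0
      · rw [h, zero_smul]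
        exact Submodule.zero_mem _
      · exact Submodule.smul_mem _ _ (X.ge_le_ge (h1 (hux h)) v.2)
    · by_cases h : QuadraticMap.polar Q (v : V) x = 0
      · rw [h, zero_smul]
        exact Submodule.zero_mem _
      · exact Submodule.smul_mem _ _ (X.ge_le_ge (h2 (hvx h)) u.2)
    · by_cases h : QuadraticMap.polar Q (u : V) x = 0
      · rw [h, zero_smul]
        exact Submodule.zero_mem _
      · have := h1 (hux h)
        exact Submodule.smul_mem _ _ (X.ge_le_ge (by omega) u.2)
  obtain ⟨g, hg⟩ := exists_isoGroup (X := X) (i := i) hQ (isometry_eichler hu huv)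
    fun d x hx => hterm d i (by omega) (by omega) x hx
  refine ⟨g, hg, fun a' h1 h2 => (lead_eq_zero_iff g a').2 fun x hx => ?_⟩
  rw [hg, add_assoc]
  exact hterm a' (i + 1) (by omega) (by omega) x hx

/-- The Eichler transformation of `u ∈ X^{≥ -a}` and `v ∈ X^{≥ a+i}` has a leading term of rank
one for `2 a < -i`. -/
theorem exists_lead_smulRight (hQ : IsNondeg Q) (hi : 1 ≤ i) {a c : ℤ} (hc : c + a = 0)
    (ha : 2 * a < -i) (u : X.gr c) (w : X.gr (a + i)) : ∃ g : X.isoGroup i,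
      lead g a = (X.pairing c a hc u).smulRight w ∧
      ∀ a' : ℤ, 2 * a' ≤ -i → a' ≠ a → lead g a' = 0 := by
  obtain ⟨u, rfl⟩ := Submodule.Quotient.mk_surjective _ u
  obtain ⟨v, rfl⟩ := Submodule.Quotient.mk_surjective _ w
  obtain ⟨g, hg, hg'⟩ := exists_eichler hQ hi (by omega) ha.le u v
  refine ⟨g, LinearMap.ext fun x => ?_, hg'⟩
  obtain ⟨x, rfl⟩ := Submodule.Quotient.mk_surjective _ x
  rw [lead_mk, LinearMap.smulRight_apply, pairing_mk, ← Submodule.Quotient.mk_smul,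
    Submodule.Quotient.eq]
  change _ - _ ∈ X.ge (a + i + 1)
  have hu : (u : V) ∈ X.ge (a + i + 1) := X.ge_le_ge (by omega) u.2
  simp only [hg, eichler_apply, Submodule.coe_smul]
  have e : ∀ p q r s : V, p - q - r - p = -q - r := fun p q r s => by abel
  rw [e _ _ _ 0]
  exact Submodule.sub_mem _ (Submodule.neg_mem _ (Submodule.smul_mem _ _ hu))
    (Submodule.smul_mem _ _ (Submodule.smul_mem _ _ hu))

/-- For `2 a = -i` the leading term of an Eichler transformation is the alternating form `u ∧ w`.
-/
theorem exists_lead_wedge (hQ : IsNondeg Q) (hi : 1 ≤ i) {a : ℤ} (hc : a + i + a = 0)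
    (u w : X.gr (a + i)) : ∃ g : X.isoGroup i,
      lead g a = (X.pairing (a + i) a hc u).smulRight w - (X.pairing (a + i) a hc w).smulRight u ∧
      ∀ a' : ℤ, 2 * a' ≤ -i → a' ≠ a → lead g a' = 0 := by
  obtain ⟨u, rfl⟩ := Submodule.Quotient.mk_surjective _ u
  obtain ⟨v, rfl⟩ := Submodule.Quotient.mk_surjective _ w
  obtain ⟨g, hg, hg'⟩ := exists_eichler hQ hi (by omega) (by omega) u v
  refine ⟨g, LinearMap.ext fun x => ?_, hg'⟩
  obtain ⟨x, rfl⟩ := Submodule.Quotient.mk_surjective _ x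
  rw [lead_mk, LinearMap.sub_apply, LinearMap.smulRight_apply, LinearMap.smulRight_apply,
    pairing_mk, pairing_mk, ← Submodule.Quotient.mk_smul, ← Submodule.Quotient.mk_smul,
    ← Submodule.Quotient.mk_sub]
  congr 1
  apply Subtype.ext
  simp [hg, eichler_apply, X.isotropic (a + i) (by omega) v v.2]

/-- Every possible family of leading terms that is concentrated in one degree occurs. -/
theorem exists_lead_single (hQ : IsNondeg Q) (hi : 1 ≤ i) {a : ℤ} (ha : 2 * a ≤ -i)
    {t : X.gr a →ₗ[k] X.gr (a + i)} (ht : t ∈ leadSpace X i a) : ∃ g : X.isoGroup i,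
      lead g a = t ∧ ∀ a' : ℤ, 2 * a' ≤ -i → a' ≠ a → lead g a' = 0 := by
  -- The leading terms that occur are closed under addition.
  have hzero : ∃ g : X.isoGroup i, lead g a = 0 ∧
      ∀ a' : ℤ, 2 * a' ≤ -i → a' ≠ a → lead g a' = 0 :=
    ⟨1, lead_one hi a, fun a' _ _ => lead_one hi a'⟩
  have hadd : ∀ t t' : X.gr a →ₗ[k] X.gr (a + i),
      (∃ g : X.isoGroup i, lead g a = t ∧ ∀ a' : ℤ, 2 * a' ≤ -i → a' ≠ a → lead g a' = 0) →
      (∃ g : X.isoGroup i, lead g a = t' ∧ ∀ a' : ℤ, 2 * a' ≤ -i → a' ≠ a → lead g a' = 0) →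
      ∃ g : X.isoGroup i, lead g a = t + t' ∧
        ∀ a' : ℤ, 2 * a' ≤ -i → a' ≠ a → lead g a' = 0 := by
    rintro _ _ ⟨g, rfl, hg⟩ ⟨h, rfl, hh⟩
    exact ⟨g * h, lead_mul hi g h a, fun a' h1 h2 => by
      rw [lead_mul hi, hg a' h1 h2, hh a' h1 h2, add_zero]⟩
  let b := Module.finBasis k (X.gr a)
  rcases ha.lt_or_eq with ha | ha
  · have e : t = ∑ j, (b.coord j).smulRight (t (b j)) := b.ext fun j => by
      simp [LinearMap.sum_apply, Finsupp.single_apply, Finset.sum_ite_eq]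
    rw [e]
    refine Finset.sum_induction _ (fun t => ∃ g : X.isoGroup i, lead g a = t ∧
      ∀ a' : ℤ, 2 * a' ≤ -i → a' ≠ a → lead g a' = 0) hadd hzero fun j _ => ?_
    obtain ⟨u, hu⟩ := (X.pairingEquiv hQ (a := -a) (b := a) (by omega) (by omega)).surjective
      (b.coord j)
    rw [← hu]
    exact exists_lead_smulRight hQ hi (by omega) ha u _
  · have hc : a + i + a = 0 := by omega
    let E := X.pairingEquiv hQ hc (by omega)
    -- The form `(x, y) ↦ ⟨t x, y⟩` is a combination of the forms `e_j ∧ e_l`.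
    let ω : LinearMap.BilinForm k (X.gr a) := E.toLinearMap ∘ₗ t
    have hω : ω.IsAlt := fun x => by
      change X.pairing (a + i) a hc (t x) x = 0
      rw [pairing_comm]
      exact ht (by omega) x
    have e : t = ∑ p with p.1 < p.2, E.symm.toLinearMap ∘ₗ (ω (b p.1) (b p.2) • wedge b p) := by
      refine LinearMap.ext fun x => E.injective ?_
      change ω x = _
      conv_lhs => rw [eq_sum_wedge_of_isAlt b hω]
      simp [LinearMap.sum_apply, map_sum]
    rw [e]
    refine Finset.sum_induction _ (fun t => ∃ g : X.isoGroup i, lead g a = t ∧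
      ∀ a' : ℤ, 2 * a' ≤ -i → a' ≠ a → lead g a' = 0) hadd hzero fun p _ => ?_
    set r := ω (b p.1) (b p.2)
    obtain ⟨g, hg, hg'⟩ := exists_lead_wedge hQ hi hc (r • E.symm (b.coord p.1))
      (E.symm (b.coord p.2))
    refine ⟨g, ?_, hg'⟩
    have hE : ∀ w, X.pairing (a + i) a hc w = E w := fun w => rfl
    rw [hg, hE, hE, map_smul, LinearEquiv.apply_symm_apply, LinearEquiv.apply_symm_apply]
    refine LinearMap.ext fun x => E.injective (LinearMap.ext fun y => ?_)
    simp [wedge_apply]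
    ring

/-- Every family of elements of the spaces of leading terms in the degrees of a finite set is the
family of leading terms of an isometry. -/
theorem exists_lead (hQ : IsNondeg Q) (hi : 1 ≤ i) (S : Finset ℤ)
    (δ : ∀ a : ℤ, X.gr a →ₗ[k] X.gr (a + i)) (hδ : ∀ a : ℤ, 2 * a ≤ -i → δ a ∈ leadSpace X i a) :
    ∃ g : X.isoGroup i, ∀ a : ℤ, 2 * a ≤ -i → lead g a = if a ∈ S then δ a else 0 := by
  induction S using Finset.induction_on with
  | empty => exact ⟨1, fun a _ => by simp [lead_one hi]⟩
  | insert a S ha ih =>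
    obtain ⟨g, hg⟩ := ih
    by_cases h2a : 2 * a ≤ -i
    · obtain ⟨h, h1, h2⟩ := exists_lead_single hQ hi h2a (hδ a h2a)
      refine ⟨g * h, fun a' ha' => ?_⟩
      rw [lead_mul hi, hg a' ha']
      by_cases e : a' = a
      · subst e
        simp [ha, h1]
      · simp [e, h2 a' ha' e]
    · refine ⟨g, fun a' ha' => ?_⟩
      have e : a' ≠ a := fun e => h2a (e ▸ ha')
      simp [hg a' ha', e]

end Eichler

end QFiltration

/-! ### The order of the groups of isometries -/

/-- The exponent of `q` in the order of the group of isometries of shift `i`. -/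
def shiftDim (f : ℤ →₀ ℕ) (i : ℕ) : ℕ :=
  (∑ a ∈ f.support, ∑ b ∈ f.support, if a < b ∧ (i : ℤ) ≤ -a - b then f a * f b else 0) +
    ∑ a ∈ f.support, if (i : ℤ) ≤ -2 * a then f a * (f a - 1) / 2 else 0

theorem shiftDim_three (f : ℤ →₀ ℕ) : shiftDim f 3 = fibreDim f := by
  rw [shiftDim, fibreDim]
  congr 1
  refine Finset.sum_congr rfl fun a _ => ?_
  have : ((3 : ℕ) : ℤ) ≤ -2 * a ↔ 4 ≤ -2 * a := by omega
  simp only [this]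

theorem exists_forall_shiftDim_eq_zero (f : ℤ →₀ ℕ) : ∃ M : ℕ, ∀ i, M ≤ i → shiftDim f i = 0 := by
  have hB : ∀ a ∈ f.support, a.natAbs ≤ ∑ a ∈ f.support, a.natAbs := fun a ha =>
    Finset.single_le_sum (f := fun a : ℤ => a.natAbs) (fun _ _ => Nat.zero_le _) ha
  refine ⟨2 * (∑ a ∈ f.support, a.natAbs) + 1, fun i hi => ?_⟩
  rw [shiftDim, Nat.add_eq_zero_iff]
  constructor
  · refine Finset.sum_eq_zero fun a ha => Finset.sum_eq_zero fun b hb => if_neg ?_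
    have := hB a ha
    have := hB b hb
    omega
  · refine Finset.sum_eq_zero fun a ha => if_neg ?_
    have := hB a ha
    omega

/-- The dimension of the space of leading terms in degree `a`. -/
def leadDim (f : ℤ →₀ ℕ) (i : ℕ) (a : ℤ) : ℕ :=
  if 2 * a = -i then f a * (f a - 1) / 2 else f a * f (a + i)

/-- The exponent for shift `i` exceeds the one for shift `i + 1` by the dimensions of the spaces
of leading terms: the terms with `a + a' = -i` are the maps `gr^a → gr^{-a'}`. -/
theorem shiftDim_eq (f : ℤ →₀ ℕ) (hf : ∀ a, f (-a) = f a) (i : ℕ) :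
    shiftDim f i = (∑ a ∈ f.support with 2 * a ≤ -(i : ℤ), leadDim f i a) + shiftDim f (i + 1) := by
  rw [shiftDim, shiftDim, ← Finset.sum_add_distrib, ← Finset.sum_add_distrib, Finset.sum_filter,
    ← Finset.sum_add_distrib]
  refine Finset.sum_congr rfl fun a _ => ?_
  have h1 : ∀ b, (if a < b ∧ (i : ℤ) ≤ -a - b then f a * f b else 0) =
      (if b = -i - a then (if 2 * a < -i then f a * f b else 0) else 0) +
        if a < b ∧ ((i + 1 : ℕ) : ℤ) ≤ -a - b then f a * f b else 0 := by
    intro b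
    split_ifs <;> omega
  simp only [h1]
  rw [Finset.sum_add_distrib, Finset.sum_ite_eq']
  have h2 : (if -i - a ∈ f.support then if 2 * a < -i then f a * f (-i - a) else 0 else 0) =
      if 2 * a < -i then f a * f (a + i) else 0 := by
    rw [← hf (a + i), show -(a + i) = -i - a by ring]
    split_ifs with h3 h4
    · rfl
    · rfl
    · rw [Finsupp.notMem_support_iff.1 h3, mul_zero]
    · rfl
  rw [h2, leadDim]
  split_ifs <;> omega

namespace QFiltration

section Order

variable {k : Type u} [Field k] {V : Type v} [AddCommGroup V] [Module k V]
  {Q : QuadraticForm k V} {X : QFiltration Q} [FiniteDimensional k V] {i : ℕ}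

theorem lead_mul_inv (hi : 1 ≤ i) (g h : X.isoGroup i) (a : ℤ) :
    lead (g * h⁻¹) a = lead g a - lead h a := by
  have := lead_mul hi (g * h⁻¹) h a
  rw [inv_mul_cancel_right] at this
  rw [this, add_sub_cancel_right]

variable {f : ℤ →₀ ℕ}

theorem subsingleton_gr (hf : ∀ a, Module.finrank k (X.gr a) = f a) {a : ℤ} (ha : a ∉ f.support) :
    Subsingleton (X.gr a) :=
  Module.finrank_zero_iff.1 ((hf a).trans (Finsupp.notMem_support_iff.1 ha))

theorem apply_neg (hQ : IsNondeg Q) (hf : ∀ a, Module.finrank k (X.gr a) = f a) (a : ℤ) :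
    f (-a) = f a := by
  rw [← hf, ← hf, X.finrank_gr_eq hQ (neg_add_cancel a)]

theorem mul_inv_mem_isoGroup_succ (hQ : IsNondeg Q) (hi : 1 ≤ i) {g h : X.isoGroup i}
    (hgh : ∀ a : ℤ, 2 * a ≤ -i → lead g a = lead h a) :
    ((g * h⁻¹ : X.isoGroup i) : (Module.End k V)ˣ) ∈ X.isoGroup (i + 1) := by
  rw [mem_isoGroup_succ_iff hQ hi]
  intro a ha
  rw [lead_mul_inv hi, hgh a ha, sub_self]

theorem lead_mul_of_mem_succ (hQ : IsNondeg Q) (hi : 1 ≤ i) (h : X.isoGroup (i + 1))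
    (g : X.isoGroup i) {a : ℤ} (ha : 2 * a ≤ -i) :
    lead (⟨h, isoGroup_le (Nat.le_succ i) h.2⟩ * g) a = lead g a := by
  rw [lead_mul hi, (mem_isoGroup_succ_iff hQ hi ⟨h, isoGroup_le (Nat.le_succ i) h.2⟩).1 h.2 a ha,
    zero_add]

/-- The space of leading terms consists of all linear maps, or for `2 a = -i`, through the
pairing, of the alternating forms on `gr^a`. -/
theorem card_leadSpace [Finite k] (hQ : IsNondeg Q) (hi : 1 ≤ i)
    (hf : ∀ a, Module.finrank k (X.gr a) = f a) (a : ℤ) :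
    Nat.card (leadSpace X i a) = Nat.card k ^ leadDim f i a := by
  rw [leadDim]
  split_ifs with ha
  · have hc : a + i + a = 0 := by omega
    let E := X.pairingEquiv hQ hc (by omega)
    rw [← hf a, ← card_isAlt]
    refine Nat.card_congr (Equiv.subtypeEquiv (LinearEquiv.congrRight E).toEquiv fun t => ?_)
    change (∀ (h : a + (a + i) = 0) (x : X.gr a), X.pairing a (a + i) h x (t x) = 0) ↔
      ∀ x, X.pairing (a + i) a hc (t x) x = 0
    refine ⟨fun h x => ?_, fun h h' x => ?_⟩
    · rw [pairing_comm]
      exact h (by omega) x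
    · rw [pairing_comm]
      exact h x
  · have htop : leadSpace X i a = ⊤ := by
      rw [eq_top_iff]
      intro t _ h
      omega
    rw [htop, Nat.card_congr Submodule.topEquiv.toEquiv, card_linearMap, hf, hf]

/-- The leading terms fibre the group of shift `i` over the product of the spaces of leading
terms, and the fibres are cosets of the group of shift `i + 1`. -/
theorem card_isoGroup_succ [Finite k] (hQ : IsNondeg Q) (hi : 1 ≤ i)
    (hf : ∀ a, Module.finrank k (X.gr a) = f a) :
    Nat.card (X.isoGroup i) =
      Nat.card k ^ (∑ a ∈ f.support with 2 * a ≤ -(i : ℤ), leadDim f i a) *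
        Nat.card (X.isoGroup (i + 1)) := by
  classical
  have := Module.finite_of_finite k (M := V)
  set S := f.support.filter fun a : ℤ => 2 * a ≤ -i with hS
  have hSmem : ∀ a : ℤ, a ∈ S ↔ a ∈ f.support ∧ 2 * a ≤ -i := fun a => by
    rw [hS, Finset.mem_filter]
  let Λ : X.isoGroup i → ∀ a : S, leadSpace X i a := fun g a => ⟨lead g a, lead_mem_leadSpace hi g a⟩
  have hΛ : ∀ g h : X.isoGroup i, Λ g = Λ h ↔ ∀ a : ℤ, 2 * a ≤ -i → lead g a = lead h a := by
    intro g h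
    constructor
    · intro e a ha
      by_cases hm : a ∈ f.support
      · exact congrArg Subtype.val (congrFun e ⟨a, (hSmem a).2 ⟨hm, ha⟩⟩)
      · have := subsingleton_gr hf hm
        exact Subsingleton.elim _ _
    · intro e
      funext a
      exact Subtype.ext (e a ((hSmem a).1 a.2).2)
  have hsurj : Function.Surjective Λ := by
    intro δ
    obtain ⟨g, hg⟩ := exists_lead hQ hi S
      (fun a => if h : a ∈ S then (δ ⟨a, h⟩ : X.gr a →ₗ[k] X.gr (a + i)) else 0) (fun a _ => by
        simp only []
        split_ifs with h
        · exact (δ ⟨a, h⟩).2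
        · exact Submodule.zero_mem _)
    refine ⟨g, funext fun a => Subtype.ext ?_⟩
    change lead g a = _
    rw [hg a ((hSmem a).1 a.2).2, if_pos a.2, dif_pos a.2]
  let s := Function.surjInv hsurj
  have hs : ∀ δ, Λ (s δ) = δ := Function.surjInv_eq hsurj
  have hle : X.isoGroup (i + 1) ≤ X.isoGroup i := isoGroup_le (Nat.le_succ i)
  have hmul : ∀ (h : X.isoGroup (i + 1)) (g : X.isoGroup i), Λ (⟨h, hle h.2⟩ * g) = Λ g :=
    fun h g => (hΛ _ _).2 fun a ha => lead_mul_of_mem_succ hQ hi h g ha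
  let e : X.isoGroup i ≃ (∀ a : S, leadSpace X i a) × X.isoGroup (i + 1) :=
    { toFun := fun g => (Λ g, ⟨_, mul_inv_mem_isoGroup_succ hQ hi
        ((hΛ g (s (Λ g))).1 (hs (Λ g)).symm)⟩)
      invFun := fun p => ⟨p.2, hle p.2.2⟩ * s p.1
      left_inv := fun g => inv_mul_cancel_right g (s (Λ g))
      right_inv := fun p => by
        have h1 : Λ (⟨p.2, hle p.2.2⟩ * s p.1) = p.1 := by rw [hmul, hs]
        refine Prod.ext h1 (Subtype.ext ?_)
        simp only [h1, mul_inv_cancel_right] }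
  rw [Nat.card_congr e, Nat.card_prod, Nat.card_pi]
  congr 1
  rw [Finset.prod_coe_sort S (fun a => Nat.card (leadSpace X i a)), ← Finset.prod_pow_eq_pow_sum]
  exact Finset.prod_congr rfl fun a _ => card_leadSpace hQ hi hf a

theorem exists_isoGroup_eq_bot (X : QFiltration Q) : ∃ M : ℕ, ∀ i, M ≤ i → X.isoGroup i = ⊥ := by
  obtain ⟨lo, hlo⟩ := X.exists_eq_top
  obtain ⟨hi, hhi⟩ := X.exists_eq_bot
  refine ⟨(hi - lo).toNat, fun i h => (Subgroup.eq_bot_iff_forall _).2 fun g hg => ?_⟩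
  refine Units.ext (LinearMap.ext fun x => ?_)
  have h1 := X.ge_le_ge (a := hi) (by omega) (hg.2 lo x (hlo ▸ Submodule.mem_top))
  rw [hhi, Submodule.mem_bot, sub_eq_zero] at h1
  exact h1

theorem card_isoGroup [Finite k] (hQ : IsNondeg Q) (hf : ∀ a, Module.finrank k (X.gr a) = f a)
    (hi : 1 ≤ i) : Nat.card (X.isoGroup i) = Nat.card k ^ shiftDim f i := by
  obtain ⟨M, hM⟩ := X.exists_isoGroup_eq_bot
  obtain ⟨M', hM'⟩ := exists_forall_shiftDim_eq_zero f
  have key : ∀ n i : ℕ, 1 ≤ i → max M M' ≤ i + n →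
      Nat.card (X.isoGroup i) = Nat.card k ^ shiftDim f i := by
    intro n
    induction n with
    | zero =>
      intro i _ h
      rw [hM i (by omega), hM' i (by omega), pow_zero, Subgroup.card_bot]
    | succ n ih =>
      intro i hi h
      rw [card_isoGroup_succ hQ hi hf, ih (i + 1) (by omega) (by omega),
        shiftDim_eq f (apply_neg hQ hf) i, pow_add]
  exact key (max M M') i hi (by omega)

end Order

end QFiltration

/-! ### The associated graded space and the maps of degree two -/

namespace QFiltration

section Graded

variable {k : Type u} [Field k] {V : Type v} [AddCommGroup V] [Module k V]
  {Q : QuadraticForm k V} (X : QFiltration Q)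

theorem polar_quadZero (x y : X.gr 0) :
    QuadraticMap.polar X.quadZero x y = X.pairing 0 0 (by norm_num) x y := by
  obtain ⟨x, rfl⟩ := Submodule.Quotient.mk_surjective _ x
  obtain ⟨y, rfl⟩ := Submodule.Quotient.mk_surjective _ y
  rfl

theorem halfForm_lof (a : ℤ) (x : X.gr a) (y : ⨁ a, X.gr a) :
    X.halfForm (DirectSum.lof k ℤ X.gr a x) y =
      if 1 ≤ a then X.pairing a (-a) (add_neg_cancel a) x (DirectSum.component k ℤ X.gr (-a) y)
      else 0 := by
  rw [halfForm, DirectSum.toModule_lof]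
  split_ifs <;> rfl

theorem polar_grQuad (x y : ⨁ a, X.gr a) : QuadraticMap.polar X.grQuad x y =
    QuadraticMap.polar X.quadZero (DirectSum.component k ℤ X.gr 0 x)
      (DirectSum.component k ℤ X.gr 0 y) + X.halfForm x y + X.halfForm y x := by
  simp only [grQuad, QuadraticMap.polar, add_apply, QuadraticMap.comp_apply,
    LinearMap.BilinMap.toQuadraticMap_apply, map_add, LinearMap.add_apply]
  ring

theorem component_lof_of_ne {a b : ℤ} (h : a ≠ b) (x : X.gr a) :
    DirectSum.component k ℤ X.gr b (DirectSum.lof k ℤ X.gr a x) = 0 :=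
  DirectSum.of_eq_of_ne _ _ _ h.symm

theorem polar_grQuad_lof {a b : ℤ} (h : a + b = 0) (x : X.gr a) (y : X.gr b) :
    QuadraticMap.polar X.grQuad (DirectSum.lof k ℤ X.gr a x) (DirectSum.lof k ℤ X.gr b y) =
      X.pairing a b h x y := by
  obtain rfl : b = -a := by omega
  rw [polar_grQuad, halfForm_lof, halfForm_lof]
  rcases lt_trichotomy a 0 with ha | rfl | ha
  · rw [if_neg (by omega), if_pos (by omega), X.component_lof_of_ne (by omega),
      QuadraticMap.polar_zero_left, zero_add, zero_add]
    obtain ⟨b, hb⟩ : ∃ b, b = - -a := ⟨_, rfl⟩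
    obtain rfl : b = a := by omega
    have key : ∀ (c : ℤ) (hc : c = b) (h' : -b + c = 0), X.pairing (-b) c h' y
        (DirectSum.component k ℤ X.gr c (DirectSum.lof k ℤ X.gr b x)) =
          X.pairing (-b) b (by omega) y x := by
      rintro c rfl h'
      rw [DirectSum.component.lof_self]
    rw [key _ hb.symm, pairing_comm]
  · rw [if_neg (by omega), if_neg (by omega), add_zero, add_zero, polar_quadZero,
      DirectSum.component.lof_self]
    exact congrArg _ (DirectSum.component.lof_self (M := X.gr) k (0 : ℤ) y)
  · rw [if_pos (by omega), if_neg (by omega), X.component_lof_of_ne (by omega),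
      QuadraticMap.polar_zero_left, zero_add, add_zero, DirectSum.component.lof_self]

theorem polar_grQuad_lof_of_ne {a b : ℤ} (h : a + b ≠ 0) (x : X.gr a) (y : X.gr b) :
    QuadraticMap.polar X.grQuad (DirectSum.lof k ℤ X.gr a x) (DirectSum.lof k ℤ X.gr b y) = 0 := by
  rw [polar_grQuad, halfForm_lof, halfForm_lof, X.component_lof_of_ne (a := b) (b := -a) (by omega),
    X.component_lof_of_ne (a := a) (b := -b) (by omega)]
  have h0 : QuadraticMap.polar X.quadZero
      (DirectSum.component k ℤ X.gr 0 (DirectSum.lof k ℤ X.gr a x))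
      (DirectSum.component k ℤ X.gr 0 (DirectSum.lof k ℤ X.gr b y)) = 0 := by
    rcases eq_or_ne a 0 with ha | ha
    · rw [X.component_lof_of_ne (a := b) (by omega), QuadraticMap.polar_zero_right]
    · rw [X.component_lof_of_ne ha, QuadraticMap.polar_zero_left]
  simp [h0]

theorem grQuad_lof_zero : X.grQuad.comp (DirectSum.lof k ℤ X.gr 0) = X.quadZero := by
  ext x
  rw [QuadraticMap.comp_apply, grQuad, add_apply, QuadraticMap.comp_apply,
    LinearMap.BilinMap.toQuadraticMap_apply, halfForm_lof, if_neg (by norm_num), add_zero,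
    DirectSum.component.lof_self]

theorem grEnd_lof (N : Module.End k V) (h : ∀ a, X.ge a ≤ (X.ge (a + 2)).comap N) (a : ℤ)
    (x : X.gr a) : X.grEnd N h (DirectSum.lof k ℤ X.gr a x) =
      DirectSum.lof k ℤ X.gr (a + 2) (X.grMap N h a x) := by
  rw [grEnd, DirectSum.toModule_lof]
  rfl

variable {X}

theorem isNilpotent_of_shift {N : Module.End k V} {i : ℤ} (hi : 1 ≤ i)
    (h : ∀ a, ∀ x ∈ X.ge a, N x ∈ X.ge (a + i)) : IsNilpotent N := by
  obtain ⟨lo, hlo⟩ := X.exists_eq_top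
  obtain ⟨hi', hhi⟩ := X.exists_eq_bot
  have hpow : ∀ (n : ℕ) (x : V), (N ^ n) x ∈ X.ge (lo + n) := by
    intro n
    induction n with
    | zero =>
      intro x
      simp [hlo]
    | succ n ih =>
      intro x
      rw [pow_succ', Module.End.mul_apply]
      exact X.ge_le_ge (by push_cast; omega) (h _ _ (ih x))
  refine ⟨(hi' - lo).toNat, LinearMap.ext fun x => ?_⟩
  have := X.ge_le_ge (a := hi') (by omega) (hpow (hi' - lo).toNat x)
  rwa [hhi, Submodule.mem_bot] at this

/-- The component of `T` from degree `a` to degree `b`. -/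
def block (T : Module.End k (⨁ a, X.gr a)) (a b : ℤ) : X.gr a →ₗ[k] X.gr b :=
  DirectSum.component k ℤ X.gr b ∘ₗ T ∘ₗ DirectSum.lof k ℤ X.gr a

theorem apply_lof_of_mem {T : Module.End k (⨁ a, X.gr a)} (hT : T ∈ gradedE2 X.grQuad)
    {a b : ℤ} (h : a + 2 = b) (x : X.gr a) :
    T (DirectSum.lof k ℤ X.gr a x) = DirectSum.lof k ℤ X.gr b (block T a b x) := by
  subst h
  obtain ⟨y, hy⟩ := hT.1 a x
  rw [block, LinearMap.comp_apply, LinearMap.comp_apply, hy, DirectSum.component.lof_self]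

/-- The components of `T` in opposite degrees are adjoint up to sign. -/
theorem pairing_block {T : Module.End k (⨁ a, X.gr a)} (hT : T ∈ gradedE2 X.grQuad)
    {a b c d : ℤ} (hab : a + 2 = b) (hcd : c + 2 = d) (hbc : b + c = 0) (had : a + d = 0)
    (x : X.gr a) (y : X.gr c) :
    X.pairing b c hbc (block T a b x) y = - X.pairing a d had x (block T c d y) := by
  have h := hT.2.1 (DirectSum.lof k ℤ X.gr a x) (DirectSum.lof k ℤ X.gr c y)
  rw [apply_lof_of_mem hT hab, apply_lof_of_mem hT hcd, X.polar_grQuad_lof hbc,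
    X.polar_grQuad_lof had] at h
  linear_combination h

variable [FiniteDimensional k V]

theorem le_comap_two (g : X.isoGroup 2) (a : ℤ) :
    X.ge a ≤ (X.ge (a + 2)).comap (((g : (Module.End k V)ˣ) : Module.End k V) - 1) :=
  le_comap_of_mem_isoGroup g.2 a

/-- The map of degree `2` on the associated graded space given by an isometry of shift `2`. -/
def gradedLead (g : X.isoGroup 2) : Module.End k (⨁ a, X.gr a) :=
  X.grEnd (((g : (Module.End k V)ˣ) : Module.End k V) - 1) (le_comap_two g)

theorem gradedLead_lof (g : X.isoGroup 2) (a : ℤ) (x : X.gr a) :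
    gradedLead g (DirectSum.lof k ℤ X.gr a x) = DirectSum.lof k ℤ X.gr (a + 2) (lead g a x) :=
  X.grEnd_lof _ _ a x

theorem gradedLead_mem (g : X.isoGroup 2) : gradedLead g ∈ gradedE2 X.grQuad := by
  refine ⟨fun a x => ⟨_, gradedLead_lof g a x⟩, fun x y => ?_, fun x => ?_⟩
  · have key : ∀ (a b : ℤ) (x : X.gr a) (y : X.gr b),
        QuadraticMap.polar X.grQuad (gradedLead g (DirectSum.lof k ℤ X.gr a x))
          (DirectSum.lof k ℤ X.gr b y) + QuadraticMap.polar X.grQuad (DirectSum.lof k ℤ X.gr a x)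
          (gradedLead g (DirectSum.lof k ℤ X.gr b y)) = 0 := by
      intro a b x y
      rw [gradedLead_lof, gradedLead_lof]
      by_cases h : a + 2 + b = 0
      · rw [X.polar_grQuad_lof h, X.polar_grQuad_lof (by omega)]
        obtain ⟨x, rfl⟩ := Submodule.Quotient.mk_surjective _ x
        obtain ⟨y, rfl⟩ := Submodule.Quotient.mk_surjective _ y
        have h1 := polar_sub_add_polar_sub g.2 (x : V) (y : V)
        rwa [X.polar_eq_zero_of_one_le (by push_cast; omega) (g.2.2 a x x.2) (g.2.2 b y y.2),
          add_zero] at h1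
      · rw [X.polar_grQuad_lof_of_ne h, X.polar_grQuad_lof_of_ne (by omega), add_zero]
    induction x using DirectSum.induction_on with
    | zero => simp
    | add x x' hx hx' =>
      rw [map_add, QuadraticMap.polar_add_left, QuadraticMap.polar_add_left]
      linear_combination hx + hx'
    | of a x =>
      induction y using DirectSum.induction_on with
      | zero => simp
      | add y y' hy hy' =>
        rw [map_add, QuadraticMap.polar_add_right, QuadraticMap.polar_add_right]
        linear_combination hy + hy'
      | of b y => exact key a b x y
  · rw [gradedLead_lof, X.polar_grQuad_lof (by norm_num)]
    exact lead_mem_leadSpace (by norm_num) g (-1) (by norm_num) x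

/-- An element of `E²` is determined by its components in degrees `≤ -1`, as the others are
adjoint to these. -/
theorem eq_of_block {T T' : Module.End k (⨁ a, X.gr a)} (hQ : IsNondeg Q)
    (hT : T ∈ gradedE2 X.grQuad) (hT' : T' ∈ gradedE2 X.grQuad)
    (h : ∀ a ≤ -1, block T a (a + 2) = block T' a (a + 2)) : T = T' := by
  refine DirectSum.linearMap_ext k fun a => LinearMap.ext fun x => ?_
  change T (DirectSum.lof k ℤ X.gr a x) = T' (DirectSum.lof k ℤ X.gr a x)
  rw [apply_lof_of_mem hT rfl, apply_lof_of_mem hT' rfl]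
  congr 1
  rcases le_or_gt a (-1) with ha | ha
  · rw [h a ha]
  · refine X.pairing_injective hQ (a := a + 2) (b := -a - 2) (by omega) (by omega)
      (LinearMap.ext fun y => ?_)
    rw [pairing_block hT rfl rfl (by omega) (by omega),
      pairing_block hT' rfl rfl (by omega) (by omega), h _ (by omega)]

theorem block_gradedLead (g : X.isoGroup 2) (a : ℤ) :
    block (gradedLead g) a (a + 2) = lead g a := by
  refine LinearMap.ext fun x => ?_
  rw [block, LinearMap.comp_apply, LinearMap.comp_apply, gradedLead_lof]
  exact DirectSum.component.lof_self k (a + 2) _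

theorem gradedLead_eq_iff (hQ : IsNondeg Q) (g h : X.isoGroup 2) :
    gradedLead g = gradedLead h ↔ ∀ a : ℤ, 2 * a ≤ -((2 : ℕ) : ℤ) → lead g a = lead h a := by
  constructor
  · intro e a _
    rw [← block_gradedLead, ← block_gradedLead, e]
  · intro e
    refine eq_of_block hQ (gradedLead_mem g) (gradedLead_mem h) fun a ha => ?_
    rw [block_gradedLead, block_gradedLead]
    exact e a (by push_cast; omega)

variable {f : ℤ →₀ ℕ}

/-- Every family of leading terms in degrees `≤ -1` is realized by an element of `E²`. -/
theorem exists_gradedE2 (hQ : IsNondeg Q) (hf : ∀ a, Module.finrank k (X.gr a) = f a)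
    (δ : ∀ a : ℤ, X.gr a →ₗ[k] X.gr (a + 2))
    (hδ : ∀ (x : X.gr (-1)), X.pairing (-1) (-1 + 2) (by norm_num) x (δ (-1) x) = 0) :
    ∃ g : X.isoGroup 2, ∀ a ≤ -1, block (gradedLead g) a (a + 2) = δ a := by
  obtain ⟨g, hg⟩ := exists_lead (X := X) (i := 2) hQ (by norm_num) f.support δ (fun a _ h x => by
    obtain rfl : a = -1 := by push_cast at h; omega
    exact hδ x)
  refine ⟨g, fun a ha => ?_⟩
  rw [block_gradedLead, hg a (by push_cast; omega)]
  split_ifs with hm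
  · rfl
  · have := subsingleton_gr hf hm
    exact Subsingleton.elim _ _

/-- Every element of `E²` lifts to an isometry of `V`. -/
theorem exists_gradedLead_eq (hQ : IsNondeg Q) (hf : ∀ a, Module.finrank k (X.gr a) = f a)
    {T : Module.End k (⨁ a, X.gr a)} (hT : T ∈ gradedE2 X.grQuad) :
    ∃ g : X.isoGroup 2, gradedLead g = T := by
  obtain ⟨g, hg⟩ := exists_gradedE2 hQ hf (fun a => block T a (a + 2)) (fun x => by
    have := hT.2.2 x
    rwa [apply_lof_of_mem hT rfl, X.polar_grQuad_lof (by norm_num)] at this)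
  exact ⟨g, eq_of_block hQ (gradedLead_mem g) hT hg⟩

/-- The isometries with given leading terms form a coset of the group of shift `3`. -/
theorem ncard_gradedLead_fiber (hQ : IsNondeg Q) (g : X.isoGroup 2) :
    {h : X.isoGroup 2 | gradedLead h = gradedLead g}.ncard = Nat.card (X.isoGroup 3) := by
  have hle : X.isoGroup 3 ≤ X.isoGroup 2 := isoGroup_le (Nat.le_succ 2)
  symm
  refine Nat.card_congr (Equiv.ofBijective (fun h => ⟨⟨h, hle h.2⟩ * g, ?_⟩) ⟨?_, ?_⟩)
  · exact (gradedLead_eq_iff hQ _ _).2 fun a ha => lead_mul_of_mem_succ hQ (by norm_num) h g ha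
  · intro h h' e
    have e1 := mul_right_cancel (congrArg Subtype.val e)
    exact Subtype.ext (congrArg (fun x : X.isoGroup 2 => (x : (Module.End k V)ˣ)) e1)
  · rintro ⟨h, hh⟩
    refine ⟨⟨_, mul_inv_mem_isoGroup_succ hQ (by norm_num) ((gradedLead_eq_iff hQ _ _).1 hh)⟩, ?_⟩
    exact Subtype.ext (inv_mul_cancel_right h g)

section Finite

variable [Finite k]

theorem finite_gradedE2 (hQ : IsNondeg Q) (hf : ∀ a, Module.finrank k (X.gr a) = f a) :
    (gradedE2 X.grQuad).Finite := by
  have := Module.finite_of_finite k (M := V)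
  refine (Set.finite_range (gradedLead (X := X))).subset fun T hT => ?_
  exact exists_gradedLead_eq hQ hf hT

/-- The elements of `E^{≥2}` are the `g - 1` for `g` an isometry of shift `2`, and the map to `E²`
is surjective with fibres of `q ^ d` elements. -/
theorem ncard_E2Star (hQ : IsNondeg Q) (hf : ∀ a, Module.finrank k (X.gr a) = f a) :
    X.E2Star.ncard = Nat.card k ^ fibreDim f * (gradedE2Star X.grQuad).ncard := by
  have := Module.finite_of_finite k (M := V)
  have h1 : X.E2Star.ncard = {g : X.isoGroup 2 | gradedLead g ∈ gradedE2Star X.grQuad}.ncard := by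
    symm
    refine Set.ncard_congr (fun g _ => ((g : (Module.End k V)ˣ) : Module.End k V) - 1) ?_ ?_ ?_
    · intro g hg
      refine ⟨⟨⟨isNilpotent_of_shift (X := X) (i := 2) (by norm_num) g.2.2, fun x => ?_⟩,
        le_comap_two g⟩, hg⟩
      rw [add_sub_cancel]
      exact g.2.1 x
    · intro g h _ _ e
      exact Subtype.ext (Units.ext (sub_left_injective e))
    · rintro N ⟨⟨⟨hnil, hN⟩, hN'⟩, hN''⟩
      obtain ⟨g, hg⟩ := exists_isoGroup (X := X) (i := 2) hQ hN fun a x hx => hN' a hx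
      have e : ((g : (Module.End k V)ˣ) : Module.End k V) - 1 = N := LinearMap.ext hg
      subst e
      exact ⟨g, hN'', rfl⟩
  have hfin : (gradedE2Star X.grQuad).Finite :=
    (finite_gradedE2 hQ hf).subset fun T hT => hT.1
  rw [h1, ncard_eq_sum_fiber _ hfin.toFinset gradedLead fun g hg => by simpa using hg]
  have h2 : ∀ T ∈ hfin.toFinset, {g ∈ {g : X.isoGroup 2 | gradedLead g ∈ gradedE2Star X.grQuad} |
      gradedLead g = T}.ncard = Nat.card k ^ fibreDim f := by
    intro T hT
    rw [Set.Finite.mem_toFinset] at hT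
    obtain ⟨g, rfl⟩ := exists_gradedLead_eq hQ hf hT.1
    rw [← shiftDim_three, ← card_isoGroup hQ hf (by norm_num), ← ncard_gradedLead_fiber hQ g]
    congr 1
    ext h
    exact ⟨fun hh => hh.2, fun hh => ⟨by
      change gradedLead h ∈ gradedE2Star X.grQuad
      rw [show gradedLead h = gradedLead g from hh]
      exact hT, hh⟩⟩
  rw [Finset.sum_congr rfl h2, Finset.sum_const, smul_eq_mul, ← Set.ncard_eq_toFinset_card _ hfin,
    mul_comm]

end Finite

end Graded

end QFiltration

/-! ### The general linear group -/

section GeneralLinear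

variable {k : Type*} [Field k]

theorem prod_pow_sub_pow_eq_glCard (q m : ℕ) :
    ∏ i : Fin m, (q ^ m - q ^ (i : ℕ)) = glCard q m := by
  rw [Fin.prod_univ_eq_prod_range (fun i => q ^ m - q ^ i), glCard, ← Finset.sum_range_id,
    ← Finset.prod_pow_eq_pow_sum]
  have h : ∏ i ∈ Finset.Icc 1 m, (q ^ i - 1) = ∏ i ∈ Finset.range m, (q ^ (m - i) - 1) := by
    refine Finset.prod_nbij' (fun i => m - i) (fun i => m - i) ?_ ?_ ?_ ?_ ?_ <;> intro i hi <;>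
      simp only [Finset.mem_Icc, Finset.mem_range] at hi ⊢
    · omega
    · omega
    · omega
    · omega
    · rw [show m - (m - i) = i by omega]
  rw [h, ← Finset.prod_mul_distrib]
  refine Finset.prod_congr rfl fun i hi => ?_
  rw [Finset.mem_range] at hi
  rw [Nat.mul_sub, ← pow_add, mul_one, Nat.add_sub_cancel' hi.le]

theorem card_linearEquiv [Finite k] {N Y : Type*} [AddCommGroup N] [Module k N]
    [FiniteDimensional k N] [AddCommGroup Y] [Module k Y] [FiniteDimensional k Y]
    (h : Module.finrank k Y = Module.finrank k N) :
    Nat.card (N ≃ₗ[k] Y) = glCard (Nat.card k) (Module.finrank k N) := by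
  have := Fintype.ofFinite k
  let e : Y ≃ₗ[k] N := LinearEquiv.ofFinrankEq _ _ h
  let e' : (N ≃ₗ[k] Y) ≃ (N ≃ₗ[k] N) :=
    { toFun := fun φ => φ.trans e
      invFun := fun φ => φ.trans e.symm
      left_inv := fun φ => by ext; simp
      right_inv := fun φ => by ext; simp }
  rw [Nat.card_congr e',
    ← Nat.card_congr (LinearMap.GeneralLinearGroup.generalLinearEquiv k N).toEquiv,
    ← Nat.card_congr (Matrix.GeneralLinearGroup.toLin' (Module.finBasis k N)).toEquiv,
    Matrix.card_GL_field, ← Nat.card_eq_fintype_card, prod_pow_sub_pow_eq_glCard]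

theorem card_injective_range_eq [Finite k] {N M : Type*} [AddCommGroup N] [Module k N]
    [FiniteDimensional k N] [AddCommGroup M] [Module k M] (Y : Submodule k M)
    [FiniteDimensional k Y] (h : Module.finrank k Y = Module.finrank k N) :
    Nat.card {φ : N →ₗ[k] M // Function.Injective φ ∧ LinearMap.range φ = Y} =
      glCard (Nat.card k) (Module.finrank k N) := by
  rw [← card_linearEquiv h]
  refine Nat.card_congr
    { toFun := fun φ => (LinearEquiv.ofInjective φ.1 φ.2.1).trans (LinearEquiv.ofEq _ _ φ.2.2)
      invFun := fun e => ⟨Y.subtype ∘ₗ e.toLinearMap, Y.subtype_injective.comp e.injective, by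
        rw [LinearMap.range_comp, LinearEquiv.range, Submodule.map_top, Submodule.range_subtype]⟩
      left_inv := fun φ => by ext; rfl
      right_inv := fun e => by ext; rfl }

theorem exists_comp_eq_of_range_le {N N' M : Type*} [AddCommGroup N] [Module k N] [AddCommGroup N']
    [Module k N'] [AddCommGroup M] [Module k M] {φ : N →ₗ[k] M} {ψ : N' →ₗ[k] M}
    (hψ : Function.Injective ψ) (h : LinearMap.range φ ≤ LinearMap.range ψ) :
    ∃ t : N →ₗ[k] N', ∀ x, ψ (t x) = φ x := by
  refine ⟨(LinearEquiv.ofInjective ψ hψ).symm.toLinearMap ∘ₗ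
    φ.codRestrict (LinearMap.range ψ) fun x => h ⟨x, rfl⟩, fun x => ?_⟩
  exact congrArg Subtype.val ((LinearEquiv.ofInjective ψ hψ).apply_symm_apply _)

theorem injective_of_finrank_range_eq {N M : Type*} [AddCommGroup N] [Module k N]
    [FiniteDimensional k N] [AddCommGroup M] [Module k M] {φ : N →ₗ[k] M}
    (h : Module.finrank k (LinearMap.range φ) = Module.finrank k N) : Function.Injective φ := by
  have := LinearMap.finrank_range_add_finrank_ker φ
  rw [← LinearMap.ker_eq_bot, ← Submodule.finrank_eq_zero (R := k)]
  omega

end GeneralLinear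

section Comp

variable {k : Type*} [Field k] {M N : Type*} [AddCommGroup M] [Module k M] [AddCommGroup N]
  [Module k N]

/-- A pulled back form is nondegenerate when the map is injective and the form nondegenerate on
the image. -/
theorem isNondeg_comp_iff (q : QuadraticForm k M) (E : N →ₗ[k] M) :
    IsNondeg (q.comp E) ↔ Function.Injective E ∧ IsNondegOn q (LinearMap.range E) := by
  have hp : ∀ x y, QuadraticMap.polar (q.comp E) x y = QuadraticMap.polar q (E x) (E y) :=
    fun x y => by simp [QuadraticMap.polar]
  rw [isNondeg_iff, isNondegOn_iff]
  constructor
  · intro h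
    refine ⟨(injective_iff_map_eq_zero E).2 fun x hx => h x ?_ fun y => ?_, ?_⟩
    · rw [QuadraticMap.comp_apply, hx, QuadraticMap.map_zero]
    · rw [hp, hx, QuadraticMap.polar_zero_left]
    · rintro _ ⟨x, rfl⟩ hx hxy
      rw [h x hx fun y => (hp x y).trans (hxy (E y) ⟨y, rfl⟩), map_zero]
  · rintro ⟨h1, h2⟩ x hx hxy
    refine (injective_iff_map_eq_zero E).1 h1 x (h2 _ ⟨x, rfl⟩ hx ?_)
    rintro _ ⟨y, rfl⟩
    exact (hp x y).symm.trans (hxy y)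

theorem forall_comp_iff_bilinNondegOn (ω : LinearMap.BilinForm k M) (E : N →ₗ[k] M) :
    (∀ x, (∀ y, ω (E x) (E y) = 0) → x = 0) ↔
      Function.Injective E ∧ BilinNondegOn ω (LinearMap.range E) := by
  constructor
  · intro h
    refine ⟨(injective_iff_map_eq_zero E).2 fun x hx => h x fun y => ?_, ?_⟩
    · rw [hx, map_zero, LinearMap.zero_apply]
    · rintro _ ⟨x, rfl⟩ hxy
      rw [h x fun y => hxy (E y) ⟨y, rfl⟩, map_zero]
  · rintro ⟨h1, h2⟩ x hxy
    refine (injective_iff_map_eq_zero E).1 h1 x (h2 _ ⟨x, rfl⟩ ?_)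
    rintro _ ⟨y, rfl⟩
    exact hxy y

end Comp

/-! ### The images of the powers of a map of degree two -/

namespace QFiltration

section Powers

variable {k : Type u} [Field k] {V : Type v} [AddCommGroup V] [Module k V]
  {Q : QuadraticForm k V} {X : QFiltration Q} {T : Module.End k (⨁ a, X.gr a)}

theorem pow_apply_lof (hT : T ∈ gradedE2 X.grQuad) (n : ℕ) {a b : ℤ} (h : a + 2 * n = b)
    (x : X.gr a) : (T ^ n) (DirectSum.lof k ℤ X.gr a x) =
      DirectSum.lof k ℤ X.gr b (block (T ^ n) a b x) := by
  have key : ∀ (n : ℕ) (a b : ℤ) (_ : a + 2 * n = b) (x : X.gr a), ∃ y : X.gr b,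
      (T ^ n) (DirectSum.lof k ℤ X.gr a x) = DirectSum.lof k ℤ X.gr b y := by
    intro n
    induction n with
    | zero =>
      intro a b h x
      obtain rfl : a = b := by simpa using h
      exact ⟨x, rfl⟩
    | succ n ih =>
      intro a b h x
      rw [pow_succ, Module.End.mul_apply, apply_lof_of_mem hT rfl]
      exact ih _ _ (by push_cast at h; omega) _
  obtain ⟨y, hy⟩ := key n a b h x
  rw [block, LinearMap.comp_apply, LinearMap.comp_apply, hy, DirectSum.component.lof_self]

theorem polar_pow (hT : T ∈ gradedE2 X.grQuad) (n : ℕ) (x y : ⨁ a, X.gr a) :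
    QuadraticMap.polar X.grQuad x ((T ^ n) y) =
      (-1) ^ n * QuadraticMap.polar X.grQuad ((T ^ n) x) y := by
  induction n generalizing x y with
  | zero => simp
  | succ n ih =>
    have h := hT.2.1 ((T ^ n) x) y
    have e1 : (T ^ (n + 1)) x = T ((T ^ n) x) := by rw [pow_succ', Module.End.mul_apply]
    have e2 : (T ^ (n + 1)) y = (T ^ n) (T y) := by rw [pow_succ, Module.End.mul_apply]
    rw [e1, e2, ih, pow_succ]
    linear_combination (-1) ^ n * h

theorem omegaForm_apply (hT : T ∈ gradedE2 X.grQuad) (x y : X.gr (-1)) :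
    omegaForm X.grQuad T x y = X.pairing (-1) (-1 + 2) (by norm_num) x (block T (-1) (-1 + 2) y) := by
  rw [← X.polar_grQuad_lof, ← apply_lof_of_mem hT rfl]
  rfl

theorem block_pow_succ (hT : T ∈ gradedE2 X.grQuad) (n : ℕ) {a b c : ℤ} (h : a + 2 = b)
    (x : X.gr a) : block (T ^ (n + 1)) a c x = block (T ^ n) b c (block T a b x) := by
  rw [block, LinearMap.comp_apply, LinearMap.comp_apply, pow_succ, Module.End.mul_apply,
    apply_lof_of_mem hT h]
  rfl

variable [FiniteDimensional k V]

/-- The condition that defines `E²_*` in an even degree, in terms of the image in degree `0`. -/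
theorem isNondeg_iff_imageZero (hT : T ∈ gradedE2 X.grQuad) (n : ℕ) :
    IsNondeg (X.grQuad.comp ((T ^ n) ∘ₗ DirectSum.lof k ℤ X.gr (-(2 * n : ℤ)))) ↔
      Module.finrank k (imageZero T n) = Module.finrank k (X.gr (-(2 * n : ℤ))) ∧
        IsNondegOn (X.grQuad.comp (DirectSum.lof k ℤ X.gr 0)) (imageZero T n) := by
  have e : X.grQuad.comp ((T ^ n) ∘ₗ DirectSum.lof k ℤ X.gr (-(2 * n : ℤ))) =
      (X.grQuad.comp (DirectSum.lof k ℤ X.gr 0)).comp (block (T ^ n) (-(2 * n : ℤ)) 0) := by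
    ext x
    rw [QuadraticMap.comp_apply, LinearMap.comp_apply, pow_apply_lof hT n (b := 0) (by omega)]
    rfl
  rw [e, isNondeg_comp_iff]
  refine and_congr_left fun _ => ⟨fun h => ?_, injective_of_finrank_range_eq⟩
  exact LinearMap.finrank_range_of_inj h

/-- The condition that defines `E²_*` in an odd degree, in terms of the image in degree `-1`: up
to sign, `⟨x, T^{2n+1} y⟩` is `ω_T (T^n x) (T^n y)`. -/
theorem nondeg_iff_imageOne (hT : T ∈ gradedE2 X.grQuad) (n : ℕ) :
    (∀ x : X.gr (-(2 * n + 1 : ℤ)), (∀ y : X.gr (-(2 * n + 1 : ℤ)),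
      QuadraticMap.polar X.grQuad (DirectSum.lof k ℤ X.gr _ x)
        ((T ^ (2 * n + 1)) (DirectSum.lof k ℤ X.gr _ y)) = 0) → x = 0) ↔
      Module.finrank k (imageOne T n) = Module.finrank k (X.gr (-(2 * n + 1 : ℤ))) ∧
        BilinNondegOn (omegaForm X.grQuad T) (imageOne T n) := by
  have e : ∀ x y : X.gr (-(2 * n + 1 : ℤ)),
      QuadraticMap.polar X.grQuad (DirectSum.lof k ℤ X.gr _ x)
        ((T ^ (2 * n + 1)) (DirectSum.lof k ℤ X.gr _ y)) = 0 ↔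
      omegaForm X.grQuad T (block (T ^ n) (-(2 * n + 1 : ℤ)) (-1) x)
        (block (T ^ n) (-(2 * n + 1 : ℤ)) (-1) y) = 0 := by
    intro x y
    have h : omegaForm X.grQuad T (block (T ^ n) (-(2 * n + 1 : ℤ)) (-1) x)
        (block (T ^ n) (-(2 * n + 1 : ℤ)) (-1) y) =
        QuadraticMap.polar X.grQuad ((T ^ n) (DirectSum.lof k ℤ X.gr _ x))
          (T ((T ^ n) (DirectSum.lof k ℤ X.gr _ y))) := by
      rw [pow_apply_lof hT n (b := -1) (by omega), pow_apply_lof hT n (b := -1) (by omega)]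
      rfl
    have h' : ∀ x y : ⨁ a, X.gr a, QuadraticMap.polar X.grQuad x ((T ^ (2 * n + 1)) y) =
        (-1) ^ n * QuadraticMap.polar X.grQuad ((T ^ n) x) (T ((T ^ n) y)) := fun x y => by
      rw [show 2 * n + 1 = n + (1 + n) by ring, pow_add, Module.End.mul_apply, polar_pow hT,
        pow_add, pow_one, Module.End.mul_apply]
    rw [h, h']
    simp
  simp only [e]
  rw [forall_comp_iff_bilinNondegOn]
  refine and_congr_left fun _ => ⟨fun h => ?_, injective_of_finrank_range_eq⟩
  exact LinearMap.finrank_range_of_inj h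

/-- An element of `E²` is in `E²_*` when its images form flags of nondegenerate subspaces: the
nondegeneracy conditions make the maps onto the images injective. -/
theorem mem_gradedE2Star_iff (hT : T ∈ gradedE2 X.grQuad) : T ∈ gradedE2Star X.grQuad ↔
    psi X.grQuad T ∈ flagsZero X.grQuad ×ˢ flagsOne k X.gr := by
  constructor
  · rintro ⟨-, h1, h2⟩
    have h1' := fun n => (isNondeg_iff_imageZero hT n).1 (h1 n)
    have h2' := fun n => (nondeg_iff_imageOne hT n).1 (h2 n)
    refine ⟨⟨fun n => ?_, fun n => (h1' n).1, fun n => (h1' n).2⟩, ⟨fun x => ?_, ?_, fun n => ?_,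
      fun n => (h2' n).1, fun n => (h2' n).2⟩⟩
    · rintro _ ⟨x, rfl⟩
      exact ⟨_, (block_pow_succ hT n (a := -(2 * (n + 1 : ℕ) : ℤ)) (by push_cast; omega) x).symm⟩
    · exact hT.2.2 x
    · have h := (h2' 0).2
      have e : imageOne T 0 = ⊤ := Submodule.eq_top_of_finrank_eq
        ((h2' 0).1.trans (congrArg (fun a => Module.finrank k (X.gr a)) (by norm_num)))
      rw [e] at h
      exact h
    · rintro _ ⟨x, rfl⟩
      exact ⟨_, (block_pow_succ hT n (a := -(2 * (n + 1 : ℕ) + 1 : ℤ)) (by push_cast; omega)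
        x).symm⟩
  · rintro ⟨⟨-, h1, h2⟩, ⟨-, -, -, h3, h4⟩⟩
    exact ⟨hT, fun n => (isNondeg_iff_imageZero hT n).2 ⟨h1 n, h2 n⟩,
      fun n => (nondeg_iff_imageOne hT n).2 ⟨h3 n, h4 n⟩⟩

end Powers

end QFiltration

/-! ### The fibres of the map to flags -/

/-- The number of times that a map of degree `2` has to be applied to pass from degree `a ≤ 0` to
degree `0` or `-1`. -/
def height (a : ℤ) : ℕ := (-a).toNat / 2

theorem height_even (n : ℕ) : height (-(2 * n : ℤ)) = n := by rw [height]; omega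

theorem height_odd (n : ℕ) : height (-(2 * n + 1 : ℤ)) = n := by rw [height]; omega

theorem height_eq_succ {a : ℤ} (h : a ≤ -2) : height a = height (a + 2) + 1 := by
  rw [height, height]
  omega

theorem not_even_neg_two_mul_add_one (n : ℕ) : ¬ Even (-(2 * n + 1 : ℤ)) := by
  rw [even_neg, Int.not_even_iff_odd]
  exact ⟨n, rfl⟩

theorem even_neg_two_mul (n : ℕ) : Even (-(2 * n : ℤ)) := by
  rw [even_neg]
  exact even_two_mul _

theorem forall_nonpos_iff {P : ℤ → Prop} :
    (∀ a ≤ 0, P a) ↔ (∀ n : ℕ, P (-(2 * n : ℤ))) ∧ ∀ n : ℕ, P (-(2 * n + 1 : ℤ)) := by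
  refine ⟨fun h => ⟨fun n => h _ (by omega), fun n => h _ (by omega)⟩, fun h a ha => ?_⟩
  rcases Int.even_or_odd' (-a) with ⟨m, hm | hm⟩
  · obtain ⟨n, rfl⟩ := Int.eq_ofNat_of_zero_le (a := m) (by omega)
    obtain rfl : a = -(2 * n : ℤ) := by omega
    exact h.1 n
  · obtain ⟨n, rfl⟩ := Int.eq_ofNat_of_zero_le (a := m) (by omega)
    obtain rfl : a = -(2 * n + 1 : ℤ) := by omega
    exact h.2 n

namespace QFiltration

section Fibre

variable {k : Type u} [Field k] {V : Type v} [AddCommGroup V] [Module k V]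
  {Q : QuadraticForm k V} {X : QFiltration Q} {T : Module.End k (⨁ a, X.gr a)}

/-- The restriction to degree `a ≤ 0` of the power of `T` that maps to degree `0` or `-1`, with
values in the sum of the pieces of degree `0` and `-1`. -/
def towerMap (T : Module.End k (⨁ a, X.gr a)) (a : ℤ) : X.gr a →ₗ[k] X.gr 0 × X.gr (-1) :=
  (block (T ^ height a) a 0).prod (block (T ^ height a) a (-1))

open Classical in
/-- The members of a pair of flags in degrees `0` and `-1`, indexed by the nonpositive integers. -/
def towerTarget (X : QFiltration Q) (U : ℕ → Submodule k (X.gr 0))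
    (U' : ℕ → Submodule k (X.gr (-1))) (a : ℤ) : Submodule k (X.gr 0 × X.gr (-1)) :=
  if Even a then (U (height a)).map (LinearMap.inl k (X.gr 0) (X.gr (-1)))
  else (U' (height a)).map (LinearMap.inr k (X.gr 0) (X.gr (-1)))

theorem zero_mem_gradedE2 : (0 : Module.End k (⨁ a, X.gr a)) ∈ gradedE2 X.grQuad :=
  ⟨fun a x => ⟨0, by simp⟩, fun x y => by simp, fun x => by simp⟩

theorem block_pow_of_ne (hT : T ∈ gradedE2 X.grQuad) (n : ℕ) {a b : ℤ} (h : a + 2 * n ≠ b) :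
    block (T ^ n) a b = 0 := by
  refine LinearMap.ext fun x => ?_
  rw [block, LinearMap.comp_apply, LinearMap.comp_apply, pow_apply_lof hT n rfl,
    X.component_lof_of_ne h]
  rfl

theorem towerMap_eq_comp (hT : T ∈ gradedE2 X.grQuad) {a : ℤ} (ha : a ≤ -2) (x : X.gr a) :
    towerMap T a x = towerMap T (a + 2) (block T a (a + 2) x) := by
  rw [towerMap, height_eq_succ ha]
  exact Prod.ext (block_pow_succ hT _ rfl x) (block_pow_succ hT _ rfl x)

theorem towerMap_eq_of_height_eq_zero (T' : Module.End k (⨁ a, X.gr a)) {a : ℤ}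
    (h : height a = 0) : towerMap T a = towerMap T' a := by
  rw [towerMap, towerMap, h, pow_zero, pow_zero]

theorem range_towerMap_even (hT : T ∈ gradedE2 X.grQuad) (n : ℕ) :
    LinearMap.range (towerMap T (-(2 * n : ℤ))) =
      (imageZero T n).map (LinearMap.inl k (X.gr 0) (X.gr (-1))) := by
  rw [towerMap, height_even, block_pow_of_ne hT n (b := -1) (by omega), imageZero,
    ← LinearMap.range_comp]
  rfl

theorem range_towerMap_odd (hT : T ∈ gradedE2 X.grQuad) (n : ℕ) :
    LinearMap.range (towerMap T (-(2 * n + 1 : ℤ))) =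
      (imageOne T n).map (LinearMap.inr k (X.gr 0) (X.gr (-1))) := by
  rw [towerMap, height_odd, block_pow_of_ne hT n (b := 0) (by omega), imageOne,
    ← LinearMap.range_comp]
  rfl

theorem range_block_zero {a b : ℤ} (h : a = b) : LinearMap.range (block (T ^ 0) a b) = ⊤ := by
  subst h
  refine LinearMap.range_eq_top.2 fun x => ⟨x, ?_⟩
  exact DirectSum.component.lof_self k a x

variable {U : ℕ → Submodule k (X.gr 0)} {ω : LinearMap.BilinForm k (X.gr (-1))}
  {U' : ℕ → Submodule k (X.gr (-1))}

theorem towerTarget_even (n : ℕ) : towerTarget X U U' (-(2 * n : ℤ)) =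
    (U n).map (LinearMap.inl k (X.gr 0) (X.gr (-1))) := by
  rw [towerTarget, if_pos (even_neg_two_mul n), height_even]

theorem towerTarget_odd (n : ℕ) : towerTarget X U U' (-(2 * n + 1 : ℤ)) =
    (U' n).map (LinearMap.inr k (X.gr 0) (X.gr (-1))) := by
  rw [towerTarget, if_neg (not_even_neg_two_mul_add_one n), height_odd]

/-- The two flags of `ψ(T)`, as the images of the towers in the degrees `≤ 0`. -/
theorem psi_eq_iff (hT : T ∈ gradedE2 X.grQuad) : psi X.grQuad T = (U, (ω, U')) ↔
    omegaForm X.grQuad T = ω ∧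
      ∀ a ≤ 0, LinearMap.range (towerMap T a) = towerTarget X U U' a := by
  rw [forall_nonpos_iff]
  simp only [range_towerMap_even hT, range_towerMap_odd hT, towerTarget_even, towerTarget_odd,
    (Submodule.map_injective_of_injective LinearMap.inl_injective).eq_iff,
    (Submodule.map_injective_of_injective LinearMap.inr_injective).eq_iff]
  rw [psi, Prod.mk.injEq, Prod.mk.injEq, funext_iff, funext_iff]
  tauto

theorem finrank_towerTarget (hU : U ∈ flagsZero X.grQuad) (hU' : (ω, U') ∈ flagsOne k X.gr) {a : ℤ}
    (ha : a ≤ 0) : Module.finrank k (towerTarget X U U' a) = Module.finrank k (X.gr a) := by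
  revert a
  rw [forall_nonpos_iff]
  constructor
  · intro n
    rw [towerTarget_even, ← hU.2.1 n]
    exact (Submodule.equivMapOfInjective _ LinearMap.inl_injective _).finrank_eq.symm
  · intro n
    rw [towerTarget_odd, ← hU'.2.2.2.1 n]
    exact (Submodule.equivMapOfInjective _ LinearMap.inr_injective _).finrank_eq.symm

theorem towerTarget_le (hU : U ∈ flagsZero X.grQuad) (hU' : (ω, U') ∈ flagsOne k X.gr) {a : ℤ}
    (ha : a ≤ -2) : towerTarget X U U' a ≤ towerTarget X U U' (a + 2) := by
  have h2 : Even (a + 2) ↔ Even a := by rw [Int.even_add]; simp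
  rw [towerTarget, towerTarget, height_eq_succ ha]
  simp only [h2]
  split_ifs
  · exact Submodule.map_mono (hU.1 _)
  · exact Submodule.map_mono (hU'.2.2.1 _)

variable [FiniteDimensional k V]

theorem flag_zero_eq_top (hU : U ∈ flagsZero X.grQuad) : U 0 = ⊤ :=
  Submodule.eq_top_of_finrank_eq
    ((hU.2.1 0).trans (congrArg (fun a => Module.finrank k (X.gr a)) (by norm_num)))

theorem flag_one_eq_top (hU' : (ω, U') ∈ flagsOne k X.gr) : U' 0 = ⊤ :=
  Submodule.eq_top_of_finrank_eq
    ((hU'.2.2.2.1 0).trans (congrArg (fun a => Module.finrank k (X.gr a)) (by norm_num)))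

/-- In the degrees where nothing is to be prescribed, because the height is `0` or the piece is
trivial, the tower of the zero map has the right image. -/
theorem range_towerMap_zero (hU : U ∈ flagsZero X.grQuad) (hU' : (ω, U') ∈ flagsOne k X.gr)
    {f : ℤ →₀ ℕ} (hf : ∀ a, Module.finrank k (X.gr a) = f a) {a : ℤ} (ha : a ≤ 0)
    (h : a ∈ f.support → height a = 0) :
    LinearMap.range (towerMap (0 : Module.End k (⨁ a, X.gr a)) a) = towerTarget X U U' a := by
  by_cases hm : a ∈ f.support
  · have h0 := h hm
    rw [height] at h0
    obtain rfl | rfl : a = -(2 * (0 : ℕ) : ℤ) ∨ a = -(2 * (0 : ℕ) + 1 : ℤ) := by omega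
    · rw [range_towerMap_even zero_mem_gradedE2, towerTarget_even, flag_zero_eq_top hU]
      exact congrArg _ (range_block_zero (by norm_num))
    · rw [range_towerMap_odd zero_mem_gradedE2, towerTarget_odd, flag_one_eq_top hU']
      exact congrArg _ (range_block_zero (by norm_num))
  · have hrank := finrank_towerTarget hU hU' ha
    have := subsingleton_gr hf hm
    rw [hf, Finsupp.notMem_support_iff.1 hm] at hrank
    rw [Submodule.finrank_eq_zero.1 hrank, LinearMap.range_eq_bot]
    exact Subsingleton.elim _ _

/-- An element of `E²` with given form `ω` and flags `U`, `U'` is the same as a family of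
isomorphisms of the pieces of degree `≤ -2` with the members of the flags. -/
theorem card_psi_fibre_eq_prod (hQ : IsNondeg Q) {f : ℤ →₀ ℕ}
    (hf : ∀ a, Module.finrank k (X.gr a) = f a) (hU : U ∈ flagsZero X.grQuad)
    (hU' : (ω, U') ∈ flagsOne k X.gr) :
    {T ∈ gradedE2 X.grQuad | psi X.grQuad T = (U, (ω, U'))}.ncard =
      ∏ a ∈ f.support with a ≤ -2, Nat.card {φ : X.gr a →ₗ[k] X.gr 0 × X.gr (-1) //
        Function.Injective φ ∧ LinearMap.range φ = towerTarget X U U' a} := by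
  classical
  set S := f.support.filter fun a : ℤ => a ≤ -2 with hS
  have hSmem : ∀ a : ℤ, a ∈ S ↔ a ∈ f.support ∧ a ≤ -2 := fun a => by rw [hS, Finset.mem_filter]
  have hinj : ∀ {T : Module.End k (⨁ a, X.gr a)}, T ∈ gradedE2 X.grQuad →
      psi X.grQuad T = (U, (ω, U')) → ∀ a ≤ 0, Function.Injective (towerMap T a) := by
    intro T hT h a ha
    refine injective_of_finrank_range_eq ?_
    rw [((psi_eq_iff hT).1 h).2 a ha, finrank_towerTarget hU hU' ha]
  rw [← Finset.prod_coe_sort S (fun a => Nat.card {φ : X.gr a →ₗ[k] X.gr 0 × X.gr (-1) //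
        Function.Injective φ ∧ LinearMap.range φ = towerTarget X U U' a}), ← Nat.card_pi]
  refine Nat.card_congr (Equiv.ofBijective (fun T a => ⟨towerMap T.1 a,
    hinj T.2.1 T.2.2 a (by have := ((hSmem a).1 a.2).2; omega),
    ((psi_eq_iff T.2.1).1 T.2.2).2 a (by have := ((hSmem a).1 a.2).2; omega)⟩) ⟨?_, ?_⟩)
  · rintro ⟨T, hT, hψ⟩ ⟨T', hT', hψ'⟩ h
    have h1 : ∀ a ≤ 0, towerMap T a = towerMap T' a := by
      intro a ha
      by_cases hm : a ∈ f.support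
      · by_cases h2 : a ≤ -2
        · exact congrArg Subtype.val (congrFun h ⟨a, (hSmem a).2 ⟨hm, h2⟩⟩)
        · have h0 : height a = 0 := by rw [height]; omega
          exact towerMap_eq_of_height_eq_zero T' h0
      · have := subsingleton_gr hf hm
        exact Subsingleton.elim _ _
    refine Subtype.ext (eq_of_block hQ hT hT' fun a ha => LinearMap.ext fun x => ?_)
    rcases ha.lt_or_eq with ha | rfl
    · refine hinj hT hψ (a + 2) (by omega) ?_
      rw [← towerMap_eq_comp hT (by omega), h1 a (by omega), h1 (a + 2) (by omega),
        ← towerMap_eq_comp hT' (by omega)]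
    · refine X.pairing_injective hQ (a := -1 + 2) (b := -1) (by norm_num) (by norm_num)
        (LinearMap.ext fun y => ?_)
      rw [pairing_comm, pairing_comm (x := block T' _ _ x), ← omegaForm_apply hT,
        ← omegaForm_apply hT', ((psi_eq_iff hT).1 hψ).1, ((psi_eq_iff hT').1 hψ').1]
  · intro e
    -- The prescribed maps to degrees `0` and `-1`.
    let E : ∀ a : ℤ, X.gr a →ₗ[k] X.gr 0 × X.gr (-1) := fun a =>
      if h : a ∈ S then (e ⟨a, h⟩).1 else towerMap 0 a
    have hES : ∀ a (h : a ∈ S), E a = (e ⟨a, h⟩).1 := fun a h => dif_pos h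
    have hEn : ∀ a, a ∉ S → E a = towerMap 0 a := fun a h => dif_neg h
    have hErange : ∀ a ≤ 0, LinearMap.range (E a) = towerTarget X U U' a := by
      intro a ha
      by_cases h : a ∈ S
      · rw [hES a h]
        exact (e ⟨a, h⟩).2.2
      · rw [hEn a h]
        refine range_towerMap_zero hU hU' hf ha fun hm => ?_
        have : ¬ a ≤ -2 := fun h2 => h ((hSmem a).2 ⟨hm, h2⟩)
        rw [height]
        omega
    have hEinj : ∀ a ≤ 0, Function.Injective (E a) := fun a ha =>
      injective_of_finrank_range_eq (by rw [hErange a ha, finrank_towerTarget hU hU' ha])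
    have ht : ∀ a : ℤ, ∃ t : X.gr a →ₗ[k] X.gr (a + 2), a ≤ -2 → ∀ x, E (a + 2) (t x) = E a x := by
      intro a
      by_cases ha : a ≤ -2
      · obtain ⟨t, ht⟩ := exists_comp_eq_of_range_le (φ := E a) (hEinj (a + 2) (by omega)) (by
          rw [hErange a (by omega), hErange (a + 2) (by omega)]
          exact towerTarget_le hU hU' ha)
        exact ⟨t, fun _ => ht⟩
      · exact ⟨0, fun h => absurd h ha⟩
    choose t ht using ht
    -- The component of degree `-1` is given by `ω`.
    let P := X.pairingEquiv hQ (a := -1 + 2) (b := -1) (by norm_num) (by norm_num)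
    let t₁ : X.gr (-1) →ₗ[k] X.gr (-1 + 2) := P.symm.toLinearMap ∘ₗ ω.flip
    have ht₁ : ∀ x y, X.pairing (-1) (-1 + 2) (by norm_num) x (t₁ y) = ω x y := by
      intro x y
      rw [pairing_comm]
      exact LinearMap.congr_fun (P.apply_symm_apply (ω.flip y)) x
    obtain ⟨g, hg⟩ := exists_gradedE2 hQ hf (Function.update t (-1) t₁) (fun x => by
      rw [Function.update_self, ht₁]
      exact hU'.1 x)
    have hT := gradedLead_mem g
    have htower : ∀ (n : ℕ) (a : ℤ), a ≤ 0 → height a = n → towerMap (gradedLead g) a = E a := by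
      intro n
      induction n with
      | zero =>
        intro a ha h0
        rw [hEn a, towerMap_eq_of_height_eq_zero 0 h0]
        intro h
        rw [height] at h0
        have := ((hSmem a).1 h).2
        omega
      | succ n ih =>
        intro a ha hn
        have ha2 : a ≤ -2 := by
          rw [height] at hn
          omega
        have hn' : height (a + 2) = n := by
          rw [height_eq_succ ha2] at hn
          omega
        refine LinearMap.ext fun x => ?_
        rw [towerMap_eq_comp hT ha2, ih (a + 2) (by omega) hn', hg a (by omega),
          Function.update_of_ne (by omega), ht a ha2]
    have hψ : psi X.grQuad (gradedLead g) = (U, (ω, U')) := by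
      rw [psi_eq_iff hT]
      refine ⟨LinearMap.ext fun x => LinearMap.ext fun y => ?_, fun a ha => ?_⟩
      · rw [omegaForm_apply hT, hg (-1) le_rfl, Function.update_self, ht₁]
      · rw [htower _ a ha rfl, hErange a ha]
    refine ⟨⟨gradedLead g, hT, hψ⟩, funext fun a => Subtype.ext ?_⟩
    change towerMap (gradedLead g) a = (e a).1
    rw [htower _ a (by have := ((hSmem a).1 a.2).2; omega) rfl]
    exact hES a a.2

variable [Finite k]

/-- The fibres of `ψ`: an injective map with prescribed image is an isomorphism onto it, and
`gr^a` and `gr^{-a}` have the same dimension. -/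
theorem ncard_psi_fibre (hQ : IsNondeg Q) {f : ℤ →₀ ℕ}
    (hf : ∀ a, Module.finrank k (X.gr a) = f a)
    {r : (ℕ → Submodule k (X.gr 0)) ×
      (LinearMap.BilinForm k (X.gr (-1)) × (ℕ → Submodule k (X.gr (-1))))}
    (hr : r ∈ flagsZero X.grQuad ×ˢ flagsOne k X.gr) :
    {T ∈ gradedE2Star X.grQuad | psi X.grQuad T = r}.ncard =
      ∏ a ∈ f.support with 2 ≤ a, glCard (Nat.card k) (f a) := by
  obtain ⟨U, ω, U'⟩ := r
  have e : {T ∈ gradedE2Star X.grQuad | psi X.grQuad T = (U, (ω, U'))} =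
      {T ∈ gradedE2 X.grQuad | psi X.grQuad T = (U, (ω, U'))} := by
    ext T
    exact ⟨fun h => ⟨h.1.1, h.2⟩, fun h => ⟨(mem_gradedE2Star_iff h.1).2 (by
      rw [show psi X.grQuad T = (U, (ω, U')) from h.2]
      exact hr), h.2⟩⟩
  rw [e, card_psi_fibre_eq_prod hQ hf hr.1 hr.2]
  have hneg := apply_neg hQ hf
  refine Finset.prod_nbij' (fun a => -a) (fun a => -a) ?_ ?_ ?_ ?_ ?_
  · intro a ha
    simp only [Finset.mem_filter, Finsupp.mem_support_iff, hneg] at ha ⊢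
    omega
  · intro a ha
    simp only [Finset.mem_filter, Finsupp.mem_support_iff, hneg] at ha ⊢
    omega
  · simp
  · simp
  · intro a ha
    have ha2 := (Finset.mem_filter.1 ha).2
    rw [card_injective_range_eq _ (finrank_towerTarget hr.1 hr.2 (by omega)), hf, hneg]

theorem glCard_ne_zero (m : ℕ) : glCard (Nat.card k) m ≠ 0 := by
  have hq := two_le_natCard k
  rw [glCard]
  refine mul_ne_zero (pow_ne_zero _ (by omega)) (Finset.prod_ne_zero_iff.2 fun i hi => ?_)
  have := Nat.one_lt_pow (n := i) (by have := (Finset.mem_Icc.1 hi).1; omega) hq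
  omega

theorem ncard_gradedE2Star (hQ : IsNondeg Q) {f : ℤ →₀ ℕ}
    (hf : ∀ a, Module.finrank k (X.gr a) = f a) :
    (gradedE2Star X.grQuad).ncard = (flagsZero X.grQuad).ncard * (flagsOne k X.gr).ncard *
      ∏ a ∈ f.support with 2 ≤ a, glCard (Nat.card k) (f a) := by
  have hfin : (gradedE2Star X.grQuad).Finite := (finite_gradedE2 hQ hf).subset fun T hT => hT.1
  have hmaps : ∀ T ∈ gradedE2Star X.grQuad,
      psi X.grQuad T ∈ flagsZero X.grQuad ×ˢ flagsOne k X.gr := fun T hT =>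
    (mem_gradedE2Star_iff hT.1).1 hT
  -- All fibres are nonempty, so that there are finitely many flags.
  have hfin' : (flagsZero X.grQuad ×ˢ flagsOne k X.gr).Finite := by
    refine (hfin.image (psi X.grQuad)).subset fun r hr => ?_
    have h := ncard_psi_fibre hQ hf hr
    have h0 : {T ∈ gradedE2Star X.grQuad | psi X.grQuad T = r}.ncard ≠ 0 := by
      rw [h]
      exact Finset.prod_ne_zero_iff.2 fun a _ => glCard_ne_zero _
    obtain ⟨T, hT, hT'⟩ := Set.nonempty_of_ncard_ne_zero h0
    exact ⟨T, hT, hT'⟩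
  rw [ncard_eq_sum_fiber _ hfin'.toFinset (psi X.grQuad) (fun T hT => by
    rw [Set.Finite.mem_toFinset]
    exact hmaps T hT) hfin, Finset.sum_congr rfl fun r hr =>
      ncard_psi_fibre hQ hf (hfin'.mem_toFinset.1 hr), Finset.sum_const, smul_eq_mul,
    ← Set.ncard_eq_toFinset_card _ hfin', Set.ncard_prod]

end Fibre

end QFiltration

/-! ### The quadratic form in degree zero -/

namespace QFiltration

section DegreeZero

variable {k : Type u} [Field k] {V : Type v} [AddCommGroup V] [Module k V]
  {Q : QuadraticForm k V} (X : QFiltration Q) [FiniteDimensional k V]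

/-- A vector of `X^{≥ 0}` that is orthogonal to `X^{≥ 0}` is the sum of an element of `X^{≥ 1}`
and a radical vector; if it is singular, so is the radical vector, which is then `0`. -/
theorem isNondeg_quadZero (hQ : IsNondeg Q) : IsNondeg X.quadZero := by
  rw [isNondeg_iff]
  intro x hx hxy
  obtain ⟨x, rfl⟩ := Submodule.Quotient.mk_surjective _ x
  obtain ⟨w, hw, r, hr, hwr⟩ := X.exists_eq_add_of_polar hQ le_rfl (x := x) fun y hy => by
    rw [sub_self] at hy
    exact hxy (Submodule.Quotient.mk ⟨y, hy⟩)
  have hQr : Q r = 0 := by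
    have h : Q (x : V) = 0 := hx
    rwa [← hwr, QuadraticMap.map_add Q, X.isotropic 1 le_rfl w hw, zero_add,
      QuadraticMap.polar_comm, hr, add_zero] at h
  rw [(isNondeg_iff Q).1 hQ r hQr hr, add_zero] at hwr
  rw [Submodule.Quotient.mk_eq_zero]
  change (x : V) ∈ X.ge (0 + 1)
  rw [← hwr]
  exact hw

theorem finrank_ge_zero :
    Module.finrank k (X.ge 0) = Module.finrank k (X.gr 0) + Module.finrank k (X.ge 1) := by
  rw [← Submodule.finrank_quotient_add_finrank ((X.ge (0 + 1)).submoduleOf (X.ge 0)),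
    (Submodule.submoduleOfEquivOfLe (X.ge_succ_le 0)).finrank_eq]
  rfl

theorem finrank_eq_finrank_gr_zero_add (hQ : IsNondeg Q) :
    Module.finrank k V = Module.finrank k (X.gr 0) + 2 * Module.finrank k (X.ge 1) := by
  have h1 := X.finrank_ge_add hQ le_rfl
  have h2 := X.finrank_ge_zero
  rw [sub_self] at h1
  omega

variable [Finite k]

/-- `Q` is constant on the cosets of `X^{≥ 1}` in `X^{≥ 0}`. -/
theorem ncard_zeros_ge_zero : (zeros Q (X.ge 0)).ncard =
    Nat.card k ^ Module.finrank k (X.ge 1) * (zeros X.quadZero ⊤).ncard := by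
  have := Module.finite_of_finite k (M := V)
  have := Module.finite_of_finite k (M := X.gr 0)
  have h1 : zeros Q (X.ge 0) = Subtype.val '' {x : X.ge 0 | Q (x : V) = 0} := by
    ext x
    exact ⟨fun h => ⟨⟨x, h.1⟩, h.2, rfl⟩, by rintro ⟨y, hy, rfl⟩; exact ⟨y.2, hy⟩⟩
  rw [h1, Subtype.val_injective.injOn.ncard_image,
    ncard_eq_sum_fiber _ (Set.toFinite (zeros X.quadZero ⊤)).toFinset
      (fun x : X.ge 0 => (Submodule.Quotient.mk x : X.gr 0)) fun x hx => by
        rw [Set.Finite.mem_toFinset]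
        exact ⟨trivial, hx⟩]
  have h2 : ∀ y ∈ (Set.toFinite (zeros X.quadZero ⊤)).toFinset,
      {x ∈ {x : X.ge 0 | Q (x : V) = 0} | (Submodule.Quotient.mk x : X.gr 0) = y}.ncard =
        Nat.card k ^ Module.finrank k (X.ge 1) := by
    intro y hy
    rw [Set.Finite.mem_toFinset] at hy
    obtain ⟨x₀, rfl⟩ := Submodule.Quotient.mk_surjective _ y
    have h3 : {x ∈ {x : X.ge 0 | Q (x : V) = 0} |
        (Submodule.Quotient.mk x : X.gr 0) = Submodule.Quotient.mk x₀} =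
        (fun z => x₀ + z) '' ((X.ge (0 + 1)).submoduleOf (X.ge 0) : Set (X.ge 0)) := by
      ext x
      constructor
      · rintro ⟨-, h⟩
        exact ⟨x - x₀, (Submodule.Quotient.eq _).1 h, add_sub_cancel _ _⟩
      · rintro ⟨z, hz, rfl⟩
        have h : (Submodule.Quotient.mk (x₀ + z) : X.gr 0) = Submodule.Quotient.mk x₀ :=
          (Submodule.Quotient.eq _).2 (by rwa [add_sub_cancel_left])
        refine ⟨?_, h⟩
        change X.quadZero (Submodule.Quotient.mk (x₀ + z)) = 0
        rw [h]
        exact hy.2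
    rw [h3, (add_right_injective x₀).injOn.ncard_image, card_eq_pow,
      (Submodule.submoduleOfEquivOfLe (X.ge_succ_le 0)).finrank_eq]
    rfl
  rw [Finset.sum_congr rfl h2, Finset.sum_const, smul_eq_mul, ← Set.ncard_eq_toFinset_card,
    mul_comm]

/-- The sign of `V` is the sign of `gr^0`: up to a power of `q`, these spaces have the same excess of
zeros. -/
theorem sgn_quadZero (hQ : IsNondeg Q) : sgn Q ⊤ = sgn X.quadZero ⊤ := by
  have := Module.finite_of_finite k (M := V)
  have := Module.finite_of_finite k (M := X.gr 0)
  refine sgn_eq_of_zeroExcess Q ((isNondeg_iff_top Q).1 hQ)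
    ((isNondeg_iff_top _).1 (X.isNondeg_quadZero hQ)) (Module.finrank k (X.ge 1)) ?_ ?_
  · rw [finrank_top, finrank_top, X.finrank_eq_finrank_gr_zero_add hQ]
  · rw [← zeroExcess_inf_orthogonal Q (Z := X.ge 1) le_top (X.isotropic 1 le_rfl), top_inf_eq,
      ← X.orthogonal 1 le_rfl, sub_self, zeroExcess, zeroExcess, X.ncard_zeros_ge_zero,
      X.finrank_ge_zero, finrank_top]
    push_cast
    ring

theorem wittSign_quadZero (hQ : IsNondeg Q) {ε : ℤ}
    (h : Even (Module.finrank k V) → wittSign Q = ε) (hev : Even (Module.finrank k (X.gr 0))) :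
    wittSign X.quadZero = ε := by
  have hV : Even (Module.finrank k V) := by
    rw [X.finrank_eq_finrank_gr_zero_add hQ]
    exact hev.add (even_two_mul _)
  rw [← sgn_top _ hev, ← X.sgn_quadZero hQ, sgn_top _ hV, h hV]

end DegreeZero

section Flags

variable {k : Type u} [Field k] {V : Type v} [AddCommGroup V] [Module k V]
  {Q : QuadraticForm k V} {X : QFiltration Q} {f : ℤ →₀ ℕ}

theorem flagsZero_eq (hf : ∀ a, Module.finrank k (X.gr a) = f a) : flagsZero X.grQuad =
    nondegFlags X.quadZero.polarBilin {x | X.quadZero x = 0} ⊤ fun n => f (-(2 * n : ℤ)) := by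
  ext U
  have h : ∀ n, IsNondegOn (X.grQuad.comp (DirectSum.lof k ℤ X.gr 0)) (U n) ↔
      NondegSub X.quadZero.polarBilin {x | X.quadZero x = 0} (U n) := fun n => by
    rw [grQuad_lof_zero, isNondegOn_iff]
  constructor
  · rintro ⟨h1, h2, h3⟩
    exact ⟨le_top, h1, fun n => (h2 n).trans (hf _), fun n => (h n).1 (h3 n)⟩
  · rintro ⟨-, h1, h2, h3⟩
    exact ⟨h1, fun n => (h2 n).trans (hf _).symm, fun n => (h n).2 (h3 n)⟩

theorem flagsOne_eq (hf : ∀ a, Module.finrank k (X.gr a) = f a) :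
    flagsOne k X.gr = symplecticFlagPairs k (X.gr (-1)) fun n => f (-(2 * n + 1 : ℤ)) := by
  ext ⟨ω, U⟩
  have h : ∀ W : Submodule k (X.gr (-1)), BilinNondegOn ω W ↔ NondegSub ω Set.univ W := fun W =>
    ⟨fun h x hx _ => h x hx, fun h x hx => h x hx trivial⟩
  constructor
  · rintro ⟨h1, h2, h3, h4, h5⟩
    exact ⟨⟨h1, (h _).1 h2⟩, le_top, h3, fun n => (h4 n).trans (hf _), fun n => (h _).1 (h5 n)⟩
  · rintro ⟨⟨h1, h2⟩, -, h3, h4, h5⟩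
    exact ⟨h1, (h _).2 h2, h3, fun n => (h4 n).trans (hf _).symm, fun n => (h _).2 (h5 n)⟩

end Flags

end QFiltration

/-! ### The count is a polynomial -/

theorem exists_polynomial_glCard (m : ℕ) : ∃ P : Polynomial ℤ, ∀ q : ℕ, 1 ≤ q →
    (glCard q m : ℤ) = P.eval (q : ℤ) := by
  refine ⟨Polynomial.X ^ (m * (m - 1) / 2) * ∏ i ∈ Finset.Icc 1 m, (Polynomial.X ^ i - 1),
    fun q hq => ?_⟩
  rw [glCard, Polynomial.eval_mul, Polynomial.eval_prod, Nat.cast_mul, Nat.cast_prod]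
  congr 1
  · simp
  · refine Finset.prod_congr rfl fun i _ => ?_
    rw [Nat.cast_sub (Nat.one_le_pow _ _ hq)]
    simp

theorem exists_forall_apply_neg_eq_zero (f : ℤ →₀ ℕ) : ∃ L : ℕ, ∀ n : ℕ, L ≤ n →
    f (-(2 * n : ℤ)) = 0 ∧ f (-(2 * n + 1 : ℤ)) = 0 := by
  have hB : ∀ a, f a ≠ 0 → a.natAbs ≤ ∑ a ∈ f.support, a.natAbs := fun a ha =>
    Finset.single_le_sum (f := fun a : ℤ => a.natAbs) (fun _ _ => Nat.zero_le _)
      (Finsupp.mem_support_iff.2 ha)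
  refine ⟨(∑ a ∈ f.support, a.natAbs) + 1, fun n hn => ⟨?_, ?_⟩⟩
  · by_contra h
    have := hB _ h
    omega
  · by_contra h
    have := hB _ h
    omega

/-- The number of elements of `E^{≥2}_*` is `q ^ d`, times the number of quadratic flags in
`gr^0`, times that of symplectic flags in `gr^{-1}`, times orders of general linear groups; each
is a polynomial. -/
theorem exists_polynomial_ncard_E2Star (f : ℤ →₀ ℕ) (hf : Admissible f) (ε : ℤ)
    (hε : ε = 1 ∨ ε = -1) : ∃ P : Polynomial ℤ,
      ∀ (k : Type u) [Field k] [Finite k] (V : Type v) [AddCommGroup V] [Module k V]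
        [FiniteDimensional k V] (Q : QuadraticForm k V), IsNondeg Q →
        (Even (Module.finrank k V) → wittSign Q = ε) →
        ∀ X : QFiltration Q, (∀ a, Module.finrank k (X.gr a) = f a) →
          ((X.E2Star.ncard : ℕ) : ℤ) = P.eval (Nat.card k : ℤ) := by
  obtain ⟨L, hL⟩ := exists_forall_apply_neg_eq_zero f
  have hodd : ∀ n : ℕ, Even (f (-(2 * n + 1 : ℤ))) := fun n =>
    hf.2 _ (odd_neg.2 ⟨n, rfl⟩)
  obtain ⟨P₀, h₀⟩ := exists_polynomial_card_quadFlags.{u, v} L (fun n => f (-(2 * n : ℤ))) (f 0)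
    (fun n hn => (hL n hn).1) ε hε
  obtain ⟨P₁, h₁⟩ := exists_polynomial_card_symplecticFlagPairs.{u, v} L
    (fun n => f (-(2 * n + 1 : ℤ))) (f (-1)) (fun n hn => (hL n hn).2) hodd (by simpa using hodd 0)
  choose G hG using exists_polynomial_glCard
  refine ⟨Polynomial.X ^ fibreDim f * (P₀ * P₁ * ∏ a ∈ f.support with 2 ≤ a, G (f a)), ?_⟩
  intro k _ _ V _ _ _ Q hQ hs X hX
  have e₀ := h₀ k (X.gr 0) X.quadZero (X.isNondeg_quadZero hQ) (hX 0) fun hev =>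
    X.wittSign_quadZero hQ hs (by rwa [hX])
  have e₁ := h₁ k (X.gr (-1)) (hX (-1))
  rw [← QFiltration.flagsZero_eq hX] at e₀
  rw [← QFiltration.flagsOne_eq hX] at e₁
  rw [QFiltration.ncard_E2Star hQ hX, QFiltration.ncard_gradedE2Star hQ hX]
  push_cast
  rw [e₀, e₁]
  simp only [Polynomial.eval_mul, Polynomial.eval_pow, Polynomial.eval_X, Polynomial.eval_prod]
  congr 2
  exact Finset.prod_congr rfl fun a _ => hG (f a) _ Nat.card_pos

end Lusztig

end

theorem mainTheorem3 (f : ℤ →₀ ℕ) (hf : Lusztig.Admissible f) :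
    (∀ ε : ℤ, ε = 1 ∨ ε = -1 →
      ∃ P : Polynomial ℤ,
        ∀ (k : Type u) [Field k] [Finite k] (V : Type v) [AddCommGroup V] [Module k V]
          [FiniteDimensional k V] (Q : QuadraticForm k V), Lusztig.IsNondeg Q →
          (Even (Module.finrank k V) → Lusztig.wittSign Q = ε) →
          ∀ X : Lusztig.QFiltration Q, (∀ a, Module.finrank k (X.gr a) = f a) →
            ((X.E2Star.ncard : ℕ) : ℤ) = P.eval (Nat.card k : ℤ)) ∧
    (∀ (k : Type u) [Field k] [Finite k] (V : Type v) [AddCommGroup V] [Module k V]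
      [FiniteDimensional k V] (Q : QuadraticForm k V), Lusztig.IsNondeg Q →
      ∀ X : Lusztig.QFiltration Q, (∀ a, Module.finrank k (X.gr a) = f a) →
        X.E2Star.ncard =
            Nat.card k ^ Lusztig.fibreDim f * (Lusztig.gradedE2Star X.grQuad).ncard ∧
        Set.MapsTo (Lusztig.psi X.grQuad) (Lusztig.gradedE2Star X.grQuad)
            (Lusztig.flagsZero X.grQuad ×ˢ Lusztig.flagsOne k X.gr) ∧
        (∀ r ∈ Lusztig.flagsZero X.grQuad ×ˢ Lusztig.flagsOne k X.gr,
          {T ∈ Lusztig.gradedE2Star X.grQuad | Lusztig.psi X.grQuad T = r}.ncard =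
            ∏ a ∈ f.support with 2 ≤ a, Lusztig.glCard (Nat.card k) (f a)) ∧
        (Lusztig.gradedE2Star X.grQuad).ncard =
          (Lusztig.flagsZero X.grQuad).ncard * (Lusztig.flagsOne k X.gr).ncard *
            ∏ a ∈ f.support with 2 ≤ a, Lusztig.glCard (Nat.card k) (f a)) := by
  refine ⟨Lusztig.exists_polynomial_ncard_E2Star f hf, ?_⟩
  intro k _ _ V _ _ _ Q hQ X hX
  exact ⟨Lusztig.QFiltration.ncard_E2Star hQ hX,
    fun T hT => (Lusztig.QFiltration.mem_gradedE2Star_iff hT.1).1 hT,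
    fun r hr => Lusztig.QFiltration.ncard_psi_fibre hQ hX hr,
    Lusztig.QFiltration.ncard_gradedE2Star hQ hX⟩
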